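/- Let $N\ge 2$, $p\ge 2$, $s_1\in(0,1)$ and $s_p\in\left(\frac{p-1}{p},1\right)$. **Setting.** Let $\Omega\subset\mathbb R^N$ be a bounded domain. Write $B_R(x_0)$ for the open Euclidean ball, and $V\subset\subset\Omega$ if $V$ is open and $\overline V$ is a compact subset of $\Omega$. For $s\in(0,1)$, $q\ge 1$ and measurable $V$, let $$[u]_{W^{s,q}(V)}:=\Big(\int_V\int_V\frac{|u(x)-u(y)|^q}{|x-y|^{N+sq}}\,dx\,dy\Big)^{1/q},\qquad W^{s,q}(V):=\{u\in L^q(V): [u]_{W^{s,q}(V)}<\infty\},$$ and let $W^{s,q}_{\rm loc}(\Omega)$ consist of the functions that belong to $W^{s,q}(V)$ for every $V\subset\subset\Omega$. The space $L^{p-1}_{s_pp}(\mathbb R^N)$ consists of all $u\in L^{p-1}_{\rm loc}(\mathbb R^N)$ with $\int_{\mathbb R^N}\frac{|u(x)|^{p-1}}{(1+|x|)^{N+s_pp}}\,dx<\infty$, and $$\mathrm{Tail}(u;x_0,R):=\Big(R^{s_pp}\int_{\mathbb R^N\setminus B_R(x_0)}\frac{|u(x)|^{p-1}}{|x-x_0|^{N+s_pp}}\,dx\Big)^{\frac1{p-1}}.$$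 A function $u\in W^{s_1,1}_{\rm loc}(\Omega)\cap W^{s_p,p}_{\rm loc}(\Omega)\cap L^{p-1}_{s_pp}(\mathbb R^N)$ is a weak solution of $$(-\Delta_1)^{s_1}u+(-\Delta_p)^{s_p}u=0\quad\text{in }\Omega$$ if there is $Z\in L^\infty(\mathbb R^N\times\mathbb R^N)$ with $Z(x,y)\in\mathrm{sgn}(u(x)-u(y))$ for a.e. $(x,y)$ (where $\mathrm{sgn}(t)=\{t/|t|\}$ for $t\ne0$ and $\mathrm{sgn}(0)=[-1,1]$) such that $$\int_{\mathbb R^N}\int_{\mathbb R^N}Z(x,y)\frac{\varphi(x)-\varphi(y)}{|x-y|^{N+s_1}}\,dx\,dy+\int_{\mathbb R^N}\int_{\mathbb R^N}\frac{|u(x)-u(y)|^{p-2}(u(x)-u(y))(\varphi(x)-\varphi(y))}{|x-y|^{N+s_pp}}\,dx\,dy=0$$ for every $\varphi\in W^{s_1,1}(\mathbb R^N)\cap W^{s_p,p}(\mathbb R^N)$ with compact support in $\Omega$. **Theorem.** Every locally bounded weak solution $u$ (that is, $u\in L^\infty(V)$ for every $V\subset\subset\Omega$) has a weak gradient $\nabla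 u$ in $\Omega$, and $u\in W^{1,q}_{\rm loc}(\Omega)$ for every $q\ge p$. Moreover, for every $q\ge p$ there are constants $C,\kappa>0$ depending only on $N,p,q,s_1,s_p$ such that, for every bounded domain $\Omega$, every locally bounded weak solution $u$ in $\Omega$, every ball $B_R=B_R(x_0)\subset\subset\Omega$ with $R\in(0,1)$ and every $r\in(0,R)$, with $B_r=B_r(x_0)$, $$\|\nabla u\|^q_{L^q(B_r)}\le\frac{C\left(\mathcal T+[u]_{W^{s_p,p}(B_R)}+1\right)^q}{(R-r)^\kappa},\qquad \mathcal T:=\|u\|_{L^\infty(B_R(x_0))}+\mathrm{Tail}(u;x_0,R).$$ -/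

import Mathlib

open MeasureTheory Set
open scoped ENNReal

namespace NonlocalOneP

/-- Euclidean space `ℝ^N`. -/
abbrev RN (N : ℕ) : Type := EuclideanSpace ℝ (Fin N)

/-- `V ⊂⊂ Ω`: the set `V` is open and its closure is a compact subset of `Ω`. -/
def CompactlyInside {N : ℕ} (V Ω : Set (RN N)) : Prop :=
  IsOpen V ∧ IsCompact (closure V) ∧ closure V ⊆ Ω

/-- The Gagliardo seminorm
`[u]_{W^{s,q}(V)} = (∫_V ∫_V |u(x) - u(y)|^q / |x - y|^{N + s q} dx dy)^{1/q}`,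
with values in `[0, ∞]`. -/
noncomputable def gagliardo {N : ℕ} (s q : ℝ) (V : Set (RN N)) (u : RN N → ℝ) : ℝ≥0∞ :=
  (∫⁻ x in V, ∫⁻ y in V,
    ENNReal.ofReal (|u x - u y| ^ q / ‖x - y‖ ^ ((N : ℝ) + s * q))) ^ (1 / q)

/-- The fractional Sobolev space `W^{s,q}(V)`. -/
def MemW {N : ℕ} (s q : ℝ) (V : Set (RN N)) (u : RN N → ℝ) : Prop :=
  MemLp u (ENNReal.ofReal q) (volume.restrict V) ∧ gagliardo s q V u < ∞

/-- The local fractional Sobolev space `W^{s,q}_loc(Ω)`. -/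
def MemWLoc {N : ℕ} (s q : ℝ) (Ω : Set (RN N)) (u : RN N → ℝ) : Prop :=
  ∀ V : Set (RN N), CompactlyInside V Ω → MemW s q V u

/-- The tail space `L^q_γ(ℝ^N)`: functions in `L^q_loc(ℝ^N)` with
`∫ |u|^q / (1 + |x|)^{N + γ} dx < ∞`. -/
def MemTailSpace {N : ℕ} (q γ : ℝ) (u : RN N → ℝ) : Prop :=
  (∀ K : Set (RN N), IsCompact K → MemLp u (ENNReal.ofReal q) (volume.restrict K)) ∧
  ∫⁻ x, ENNReal.ofReal (|u x| ^ q / (1 + ‖x‖) ^ ((N : ℝ) + γ)) < ∞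

/-- `Tail(u; x₀, R)
  = (R^{s p} ∫_{ℝ^N ∖ B_R(x₀)} |u(x)|^{p-1} / |x - x₀|^{N + s p} dx)^{1/(p-1)}`,
with values in `[0, ∞]`. -/
noncomputable def tail {N : ℕ} (s p : ℝ) (u : RN N → ℝ) (x₀ : RN N) (R : ℝ) : ℝ≥0∞ :=
  (ENNReal.ofReal (R ^ (s * p)) *
    ∫⁻ x in (Metric.ball x₀ R)ᶜ,
      ENNReal.ofReal (|u x| ^ (p - 1) / ‖x - x₀‖ ^ ((N : ℝ) + s * p))) ^ (1 / (p - 1))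

/-- `‖u‖_{L^∞(B_R(x₀))} + Tail(u; x₀, R)`. -/
noncomputable def supTail {N : ℕ} (s p : ℝ) (u : RN N → ℝ) (x₀ : RN N) (R : ℝ) : ℝ≥0∞ :=
  eLpNorm u ∞ (volume.restrict (Metric.ball x₀ R)) + tail s p u x₀ R

/-- The set-valued sign: `sgn(0) = [-1, 1]` and `sgn(t) = {t / |t|}` for `t ≠ 0`. -/
def sgn (t : ℝ) : Set ℝ :=
  {z | (0 < t → z = 1) ∧ (t < 0 → z = -1) ∧ (t = 0 → z ∈ Icc (-1 : ℝ) 1)}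

/-- Test functions: elements of `W^{s₁,1}(ℝ^N) ∩ W^{s_p,p}(ℝ^N)` with compact support in `Ω`.
Since a solution lies in `W^{s_p,p}(V)` only for `V ⊂⊂ Ω`, these are the test functions for which
the double integrals in the equation are guaranteed to converge absolutely. -/
def IsTestFunction {N : ℕ} (s₁ sp p : ℝ) (Ω : Set (RN N)) (φ : RN N → ℝ) : Prop :=
  MemW s₁ 1 univ φ ∧ MemW sp p univ φ ∧ HasCompactSupport φ ∧ tsupport φ ⊆ Ω

/-- Weak solutions of `(-Δ₁)^{s₁} u + (-Δ_p)^{s_p} u = 0` in `Ω`. -/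
def IsWeakSolution {N : ℕ} (s₁ sp p : ℝ) (Ω : Set (RN N)) (u : RN N → ℝ) : Prop :=
  MemWLoc s₁ 1 Ω u ∧ MemWLoc sp p Ω u ∧ MemTailSpace (p - 1) (sp * p) u ∧
  ∃ Z : RN N × RN N → ℝ,
    MemLp Z ∞ (volume : Measure (RN N × RN N)) ∧
    (∀ᵐ z : RN N × RN N, Z z ∈ sgn (u z.1 - u z.2)) ∧
    ∀ φ : RN N → ℝ, IsTestFunction s₁ sp p Ω φ →
      (∫ z : RN N × RN N, Z z * (φ z.1 - φ z.2) / ‖z.1 - z.2‖ ^ ((N : ℝ) + s₁)) +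
      (∫ z : RN N × RN N, |u z.1 - u z.2| ^ (p - 2) * (u z.1 - u z.2) * (φ z.1 - φ z.2) /
        ‖z.1 - z.2‖ ^ ((N : ℝ) + sp * p)) = 0

/-- `u ∈ L^∞_loc(Ω)`. -/
def LocallyBounded {N : ℕ} (Ω : Set (RN N)) (u : RN N → ℝ) : Prop :=
  ∀ V : Set (RN N), CompactlyInside V Ω → MemLp u ∞ (volume.restrict V)

/-- `G` is the weak gradient of `u` in `Ω`. -/
def IsWeakGradient {N : ℕ} (Ω : Set (RN N)) (u : RN N → ℝ) (G : RN N → RN N) : Prop :=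
  LocallyIntegrableOn u Ω ∧ LocallyIntegrableOn G Ω ∧
  ∀ φ : RN N → ℝ, ContDiff ℝ ((⊤ : ℕ∞) : WithTop ℕ∞) φ → HasCompactSupport φ → tsupport φ ⊆ Ω →
    ∫ x in Ω, u x • gradient φ x = -∫ x in Ω, φ x • G x

/-- The local Sobolev space `W^{1,q}_loc(Ω)`. -/
def MemW1Loc {N : ℕ} (q : ℝ) (Ω : Set (RN N)) (u : RN N → ℝ) : Prop :=
  ∃ G : RN N → RN N, IsWeakGradient Ω u G ∧
    ∀ V : Set (RN N), CompactlyInside V Ω →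
      MemLp u (ENNReal.ofReal q) (volume.restrict V) ∧
      MemLp G (ENNReal.ofReal q) (volume.restrict V)

end NonlocalOneP

/-! The fractional 1-Laplacian enters only through monotonicity. Whatever selection `Z` of the sign
is made, two selections are ordered like their arguments (`sgn_mono`). In the equation for the
translation difference δ_h v(x) = v(x+h) - v(x), tested with |δ_h v|^(m-p) δ_h v times a squared
cutoff, the sign term is therefore nonnegative up to an error from the cutoff. The Lipschitz cutoff
lowers the singularity of that error to |x-y|^(-(N+s₁-1)), which is integrable near the diagonal.
All regularity comes from the fractional p-Laplacian.

The p-term controls the integral of |δ_h v(x) - δ_h v(y)|^m / |x-y|^(N+sp) near the diagonal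
(`exists_caccioppoli_pointwise`). Its cutoff error is shared by Young's inequality between the
W^{s,m₀} energy of v and the L^m norm of δ_h v (`young_error_term`). If that norm is of order |h|^γ,
the energy is of order |h|^(γ(m-p+1)) (`exists_nearEnergy_le`). Taking one more difference gains
|h|^(sp) (`exists_lintegral_diff_le`), so second differences have order (sp + γ(m-p+1))/m = γ + (sp
- γ(p-1))/m in L^m. The assumption s_p > (p-1)/p says sp > p-1, so the gain is bounded below by a
positive number for all γ ≤ 1. Second differences of order other than one control first differences
by dyadic doubling. Starting from the trivial order γ = 0, finitely many steps reach order one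
(`EnergyBound.diffBound_one`).

Order one in L^m bounds the W^{s,m} energy because s < 1 (`DiffBound.energyBound`), so m can play
the role of m₀. Each round allows m to exceed m₀ by as much as one, hence every exponent q ≥ p is
reached (`diffBound_one_of_le`).

Explicit dependence on the solution and on R - r comes from scaling. On a small ball a weak solution
is normalised to sup, tail and energy at most one (`exists_isUnitSolution`); this multiplies the
sign term by some μ in [0,1], and all estimates are uniform in such μ. Averaging over small balls
gives the translation bound on B_r (`exists_lintegral_diff_weakSolution_le`). Weak limits of
difference quotients then yield a gradient with the same L^q bound
(`exists_isWeakGradient_of_diff`). Uniqueness of weak gradients glues the local ones and transfers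
the estimate to any given one. -/

namespace NonlocalOneP

variable {N : ℕ}

/-! ### Algebraic inequalities for odd powers -/

/-- The odd power `|t|^a t`. -/
noncomputable def jpow (a t : ℝ) : ℝ := |t| ^ a * t

lemma jpow_neg (a t : ℝ) : jpow a (-t) = -jpow a t := by
  simp [jpow]

lemma jpow_of_nonneg {a t : ℝ} (ht : 0 ≤ t) : jpow a t = t ^ a * t := by
  simp [jpow, abs_of_nonneg ht]

lemma abs_jpow {a : ℝ} (ha : 0 ≤ a) (t : ℝ) : |jpow a t| = |t| ^ (a + 1) := by
  rw [jpow, abs_mul, abs_of_nonneg (Real.rpow_nonneg (abs_nonneg t) a),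
    Real.rpow_add_one' (abs_nonneg t) (by positivity)]

lemma measurable_jpow (a : ℝ) : Measurable (jpow a) := by
  unfold jpow
  fun_prop

/-- Reduction of a symmetric odd-invariant claim about pairs of reals to two cases. -/
lemma real_pair_cases {P : ℝ → ℝ → Prop} (hsymm : ∀ x y, P x y → P y x)
    (hneg : ∀ x y, P x y → P (-x) (-y)) (h₁ : ∀ x y, 0 ≤ y → y ≤ x → P x y)
    (h₂ : ∀ x y, 0 ≤ x → 0 ≤ y → P x (-y)) (x y : ℝ) : P x y := by
  have key : ∀ x y, y ≤ x → P x y := by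
    intro x y hxy
    rcases le_total 0 y with hy | hy
    · exact h₁ x y hy hxy
    · rcases le_total 0 x with hx | hx
      · simpa using h₂ x (-y) hx (by linarith)
      · simpa using hneg _ _ (hsymm _ _ (h₁ (-y) (-x) (by linarith) (by linarith)))
  rcases le_total y x with h | h
  · exact key x y h
  · exact hsymm _ _ (key y x h)

/-- For 0 ≤ y ≤ x one has |x| + |y| ≤ 2x and x^a (x-y) ≤ x^(a+1) - y^(a+1). For opposite signs |x-y|
= |x| + |y|, and the larger of the two already carries the power. This is the source of coercivity
in the p-term. -/
lemma jpow_lower {a : ℝ} (ha : 0 ≤ a) (x y : ℝ) :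
    (|x| + |y|) ^ a * (x - y) ^ 2 ≤ 2 ^ (a + 1) * ((jpow a x - jpow a y) * (x - y)) := by
  have h2 : (2 : ℝ) ^ (a + 1) = 2 ^ a * 2 := by rw [Real.rpow_add_one (by norm_num)]
  refine real_pair_cases (P := fun x y => (|x| + |y|) ^ a * (x - y) ^ 2 ≤
    2 ^ (a + 1) * ((jpow a x - jpow a y) * (x - y))) ?_ ?_ ?_ ?_ x y
  · intro x y h
    rw [add_comm |y|]
    linarith
  · intro x y h
    simp only [abs_neg, jpow_neg]
    linarith
  · intro x y hy hxy
    have hx : 0 ≤ x := hy.trans hxy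
    rw [jpow_of_nonneg hx, jpow_of_nonneg hy, abs_of_nonneg hx, abs_of_nonneg hy]
    have e1 : (x + y) ^ a ≤ 2 ^ a * x ^ a := by
      rw [← Real.mul_rpow (by norm_num) hx]
      exact Real.rpow_le_rpow (by positivity) (by linarith) ha
    have e2 : y ^ a ≤ x ^ a := Real.rpow_le_rpow hy hxy ha
    have e3 : 0 ≤ x ^ a := Real.rpow_nonneg hx a
    have e4 : (0 : ℝ) < 2 ^ a := by positivity
    have e5 : x ^ a * (x - y) ≤ x ^ a * x - y ^ a * y := by nlinarith
    rw [h2]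
    calc (x + y) ^ a * (x - y) ^ 2 ≤ 2 ^ a * x ^ a * (x - y) ^ 2 := by gcongr
      _ = 2 ^ a * ((x ^ a * (x - y)) * (x - y)) := by ring
      _ ≤ 2 ^ a * ((x ^ a * x - y ^ a * y) * (x - y)) := by
          have : 0 ≤ x - y := by linarith
          gcongr
      _ ≤ 2 ^ a * 2 * ((x ^ a * x - y ^ a * y) * (x - y)) := by
          have : 0 ≤ (x ^ a * x - y ^ a * y) * (x - y) := by
            have h0 : 0 ≤ x - y := by linarith
            exact mul_nonneg (le_trans (mul_nonneg e3 h0) e5) h0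
          nlinarith [mul_nonneg e4.le this]
  · intro x y hx hy
    rw [jpow_neg, jpow_of_nonneg hx, jpow_of_nonneg hy, abs_neg, abs_of_nonneg hx,
      abs_of_nonneg hy]
    have key : (x + y) ^ a * (x + y) ≤ 2 ^ (a + 1) * (x ^ a * x + y ^ a * y) := by
      set M := max x y
      have hM : 0 ≤ M := le_max_of_le_left hx
      have hxM : x ≤ M := le_max_left _ _
      have hyM : y ≤ M := le_max_right _ _
      have e1 : (x + y) ^ a ≤ 2 ^ a * M ^ a := by
        rw [← Real.mul_rpow (by norm_num) hM]
        exact Real.rpow_le_rpow (by positivity) (by linarith) ha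
      have e2 : M ^ a * M ≤ x ^ a * x + y ^ a * y := by
        rcases max_choice x y with h | h
        · rw [show M = x from h]; have := mul_nonneg (Real.rpow_nonneg hy a) hy; linarith
        · rw [show M = y from h]; have := mul_nonneg (Real.rpow_nonneg hx a) hx; linarith
      calc (x + y) ^ a * (x + y) ≤ (2 ^ a * M ^ a) * (2 * M) := by
            gcongr; linarith
        _ = 2 ^ (a + 1) * (M ^ a * M) := by rw [h2]; ring
        _ ≤ _ := by gcongr
    have hxy : 0 ≤ x + y := by positivity
    have := mul_le_mul_of_nonneg_right key hxy
    calc (x + y) ^ a * (x - -y) ^ 2 = (x + y) ^ a * (x + y) * (x + y) := by ring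
      _ ≤ _ := this
      _ = _ := by ring

/-- For equal signs this is Bernoulli's inequality with exponent a+1 at the ratio y/x, that is,
convexity of the power at its larger argument. For opposite signs both terms are dominated by the
power of the sum. -/
lemma jpow_upper {a : ℝ} (ha : 0 ≤ a) (x y : ℝ) :
    |jpow a x - jpow a y| ≤ (a + 1) * ((|x| + |y|) ^ a * |x - y|) := by
  refine real_pair_cases (P := fun x y => |jpow a x - jpow a y| ≤
    (a + 1) * ((|x| + |y|) ^ a * |x - y|)) ?_ ?_ ?_ ?_ x y
  · intro x y h
    rw [add_comm |y|, abs_sub_comm, abs_sub_comm y]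
    exact h
  · intro x y h
    simp only [abs_neg, jpow_neg]
    rw [show -jpow a x - -jpow a y = -(jpow a x - jpow a y) by ring,
      show -x - -y = -(x - y) by ring, abs_neg, abs_neg]
    exact h
  · intro x y hy hxy
    have hx : 0 ≤ x := hy.trans hxy
    rw [jpow_of_nonneg hx, jpow_of_nonneg hy, abs_of_nonneg hx, abs_of_nonneg hy,
      abs_of_nonneg (sub_nonneg.2 hxy)]
    have e2 : y ^ a ≤ x ^ a := Real.rpow_le_rpow hy hxy ha
    have e3 : 0 ≤ x ^ a := Real.rpow_nonneg hx a
    have e6 : 0 ≤ y ^ a := Real.rpow_nonneg hy a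
    rw [abs_of_nonneg (by nlinarith)]
    have e1 : x ^ a ≤ (x + y) ^ a := Real.rpow_le_rpow hx (by linarith) ha
    have key : x ^ a * x - y ^ a * y ≤ (a + 1) * (x ^ a * (x - y)) := by
      rcases hx.eq_or_lt with rfl | hx0
      · have : y = 0 := le_antisymm hxy hy
        subst this; simp
      have hb := one_add_mul_self_le_rpow_one_add (s := y / x - 1)
        (by have : 0 ≤ y / x := by positivity
            linarith) (p := a + 1) (by linarith)
      have : (1 + (y / x - 1)) ^ (a + 1) = y ^ a * y / (x ^ a * x) := by
        rw [show 1 + (y / x - 1) = y / x by ring, Real.div_rpow hy hx,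
          Real.rpow_add_one' hy (by positivity), Real.rpow_add_one' hx (by positivity)]
      rw [this, le_div_iff₀ (by positivity)] at hb
      have e : (1 + (a + 1) * (y / x - 1)) * (x ^ a * x) =
          x ^ a * x + (a + 1) * (x ^ a * (y - x)) := by
        field_simp
      rw [e] at hb
      nlinarith
    refine key.trans ?_
    have : 0 ≤ x - y := by linarith
    gcongr
  · intro x y hx hy
    rw [jpow_neg, jpow_of_nonneg hx, jpow_of_nonneg hy, abs_neg, abs_of_nonneg hx,
      abs_of_nonneg hy, sub_neg_eq_add, sub_neg_eq_add]
    have e1 : x ^ a ≤ (x + y) ^ a := Real.rpow_le_rpow hx (by linarith) ha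
    have e2 : y ^ a ≤ (x + y) ^ a := Real.rpow_le_rpow hy (by linarith) ha
    have e3 : 0 ≤ (x + y) ^ a := by positivity
    rw [abs_of_nonneg (by positivity), abs_of_nonneg (by positivity)]
    have : x ^ a * x + y ^ a * y ≤ (x + y) ^ a * (x + y) := by nlinarith
    nlinarith [mul_nonneg ha (mul_nonneg e3 (add_nonneg hx hy))]

set_option maxHeartbeats 400000 in
/-- The elementary inequality behind the Caccioppoli estimate for finite differences. -/
lemma exists_caccioppoli_pointwise {p m : ℝ} (hp : 2 ≤ p) (hm : p ≤ m) :
    ∃ c C : ℝ, 0 < c ∧ 0 < C ∧ ∀ a b A B e f : ℝ, A - B = a - b → 0 ≤ e → 0 ≤ f →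
      c * (|A - B| ^ m * (e ^ 2 + f ^ 2)) ≤
        (jpow (p - 2) a - jpow (p - 2) b) * (jpow (m - p) A * e ^ 2 - jpow (m - p) B * f ^ 2) +
        C * ((|a| + |b|) ^ (p - 2) * (|A| + |B|) ^ (m - p + 2) * (e - f) ^ 2) := by
  set k : ℝ := 2 ^ (p - 2 + 1) with hk
  set l : ℝ := 2 ^ (m - p + 1) with hl
  have hk0 : 0 < k := by positivity
  have hl0 : 0 < l := by positivity
  refine ⟨1 / (4 * k * l), (p - 1) * 2 * l, by positivity, by
    have : 0 < p - 1 := by linarith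
    positivity, ?_⟩
  -- In the application a and b are the increments between x and y of the shifted and the unshifted
  -- solution, A and B are the translation differences at x and y, and e, f are cutoff values. Both
  -- A - B and a - b are the same mixed second difference.
  intro a b A B e f hAB he hf
  have hJl := jpow_lower (a := p - 2) (by linarith) a b
  have hJu := jpow_upper (a := p - 2) (by linarith) a b
  have hFl := jpow_lower (a := m - p) (by linarith) A B
  have hX : 0 ≤ (|a| + |b|) ^ (p - 2) := by positivity
  have hS : 0 ≤ |A| + |B| := by positivity
  have hY : 0 ≤ (|A| + |B|) ^ (m - p + 2) := by positivity
  rcases eq_or_ne (a - b) 0 with h0 | h0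
  · have hA0 : A - B = 0 := hAB.trans h0
    have hab : a = b := by linarith
    rw [hA0, hab, sub_self, zero_mul, abs_zero, Real.zero_rpow (by linarith)]
    have : 0 < p - 1 := by linarith
    simp only [zero_mul, mul_zero, zero_add]
    positivity
  set D := a - b with hD
  -- Since A - B = a - b = D, both odd powers are written as slopes times the same D. The slope w is
  -- comparable to (|a|+|b|)^(p-2), and g is at least a multiple of S^(m-p), so the leading term is
  -- w g D².
  set w := (jpow (p - 2) a - jpow (p - 2) b) / D with hw
  set g := (jpow (m - p) A - jpow (m - p) B) / D with hg
  set S := |A| + |B| with hSdef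
  have hD2 : 0 < D ^ 2 := by positivity
  have hJw : jpow (p - 2) a - jpow (p - 2) b = w * D := by rw [hw]; field_simp
  have hFg : jpow (m - p) A - jpow (m - p) B = g * D := by rw [hg]; field_simp
  rw [hJw] at hJl hJu ⊢
  rw [hAB, hFg] at hFl
  have hwl : (|a| + |b|) ^ (p - 2) ≤ k * w := by
    refine le_of_mul_le_mul_right ?_ hD2
    linarith
  have hw0 : 0 ≤ w := by
    have := hX.trans hwl
    exact nonneg_of_mul_nonneg_right this hk0
  have hwu : w ≤ (p - 1) * (|a| + |b|) ^ (p - 2) := by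
    have hDp : 0 < |D| := abs_pos.2 h0
    rw [abs_mul, abs_of_nonneg hw0] at hJu
    refine le_of_mul_le_mul_right ?_ hDp
    linarith
  have hgl : S ^ (m - p) ≤ l * g := by
    refine le_of_mul_le_mul_right ?_ hD2
    linarith
  have hDS : |D| ≤ S := by rw [← hAB]; exact abs_sub A B
  have hDX : |D| ≤ |a| + |b| := abs_sub a b
  have hSm : 0 ≤ S ^ (m - p) := by positivity
  have hg0 : 0 ≤ g := nonneg_of_mul_nonneg_right (hSm.trans hgl) hl0
  have hY2 : S ^ (m - p + 2) = S ^ (m - p) * S ^ 2 := by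
    rw [Real.rpow_add_of_nonneg hS (by linarith) (by norm_num)]; norm_num
  have hFsum : |jpow (m - p) A + jpow (m - p) B| ≤ 2 * (S ^ (m - p) * S) := by
    have hA : |jpow (m - p) A| ≤ S ^ (m - p) * S := by
      rw [abs_jpow (by linarith), ← Real.rpow_add_one' hS (by linarith)]
      exact Real.rpow_le_rpow (abs_nonneg _) (by simp [hSdef]) (by linarith)
    have hB : |jpow (m - p) B| ≤ S ^ (m - p) * S := by
      rw [abs_jpow (by linarith), ← Real.rpow_add_one' hS (by linarith)]
      exact Real.rpow_le_rpow (abs_nonneg _) (by simp [hSdef]) (by linarith)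
    linarith [abs_add_le (jpow (m - p) A) (jpow (m - p) B)]
  have hDm : |D| ^ m ≤ (k * w) * (l * g) * D ^ 2 := by
    have : |D| ^ m = |D| ^ (p - 2) * |D| ^ (m - p) * D ^ 2 := by
      rw [← sq_abs D, ← Real.rpow_natCast |D| 2, ← Real.rpow_add (abs_pos.2 h0),
        ← Real.rpow_add (abs_pos.2 h0)]
      congr 1
      push_cast
      ring
    rw [this]
    have h1 : |D| ^ (p - 2) ≤ k * w :=
      (Real.rpow_le_rpow (abs_nonneg _) hDX (by linarith)).trans hwl
    have h2 : |D| ^ (m - p) ≤ l * g :=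
      (Real.rpow_le_rpow (abs_nonneg _) hDS (by linarith)).trans hgl
    gcongr
  have hQ : (e + f) ^ 2 ≤ 2 * (e ^ 2 + f ^ 2) := by nlinarith [sq_nonneg (e - f)]
  -- Symmetric product rule: the increment of the power times the mean of the squared cutoffs, plus
  -- the mean of the powers times the increment of the squared cutoffs.
  have hsplit : jpow (m - p) A * e ^ 2 - jpow (m - p) B * f ^ 2 =
      g * D * (e ^ 2 + f ^ 2) / 2 +
        (jpow (m - p) A + jpow (m - p) B) * ((e - f) * (e + f)) / 2 := by
    rw [← hFg]; ring
  -- absorb the cross term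
  have hcross : -(D * ((jpow (m - p) A + jpow (m - p) B) * ((e - f) * (e + f)) / 2)) ≤
      g * D ^ 2 * (e ^ 2 + f ^ 2) / 4 + 2 * l * (S ^ (m - p) * S ^ 2) * (e - f) ^ 2 := by
    have h1 : -(D * ((jpow (m - p) A + jpow (m - p) B) * ((e - f) * (e + f)) / 2)) ≤
        |D| * (S ^ (m - p) * S) * |e - f| * (e + f) := by
      refine (neg_le_abs _).trans ?_
      rw [abs_mul, abs_div, abs_mul, abs_mul, abs_of_nonneg (add_nonneg he hf), abs_two]
      have := mul_le_mul_of_nonneg_right hFsum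
        (show 0 ≤ |D| * (|e - f| * (e + f)) / 2 by positivity)
      linarith
    refine h1.trans ?_
    have h2 : |D| * (S ^ (m - p) * S) * |e - f| * (e + f) ≤
        S ^ (m - p) * (D ^ 2 * (e + f) ^ 2 / (8 * l) + 2 * l * (S ^ 2 * (e - f) ^ 2)) := by
      -- The weight 8l makes the first part, after S^(m-p) ≤ l g and (e+f)² ≤ 2(e²+f²), equal to
      -- half of the leading term, which can then be absorbed.
      have h3 : |D| * S * |e - f| * (e + f) ≤
          D ^ 2 * (e + f) ^ 2 / (8 * l) + 2 * l * (S ^ 2 * (e - f) ^ 2) := by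
        rw [← sub_nonneg]
        have : D ^ 2 * (e + f) ^ 2 / (8 * l) + 2 * l * (S ^ 2 * (e - f) ^ 2) -
            |D| * S * |e - f| * (e + f) =
            (|D| * (e + f) - 4 * l * (S * |e - f|)) ^ 2 / (8 * l) := by
          rw [← sq_abs D, ← sq_abs (e - f)]
          field_simp
          ring
        rw [this]
        positivity
      calc _ = S ^ (m - p) * (|D| * S * |e - f| * (e + f)) := by ring
        _ ≤ _ := by gcongr
    refine h2.trans ?_
    have h4 : S ^ (m - p) * (D ^ 2 * (e + f) ^ 2 / (8 * l)) ≤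
        g * D ^ 2 * (e ^ 2 + f ^ 2) / 4 := by
      calc S ^ (m - p) * (D ^ 2 * (e + f) ^ 2 / (8 * l)) ≤
          (l * g) * (D ^ 2 * (2 * (e ^ 2 + f ^ 2)) / (8 * l)) := by gcongr
        _ = _ := by field_simp; ring
    rw [mul_add]
    linarith
  have hmain : w * (g * D ^ 2 * (e ^ 2 + f ^ 2) / 4) ≤
      w * D * (jpow (m - p) A * e ^ 2 - jpow (m - p) B * f ^ 2) +
        w * (2 * l * (S ^ (m - p) * S ^ 2) * (e - f) ^ 2) := by
    rw [hsplit]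
    linarith [mul_le_mul_of_nonneg_left hcross hw0]
  have hlhs : 1 / (4 * k * l) * (|D| ^ m * (e ^ 2 + f ^ 2)) ≤
      w * (g * D ^ 2 * (e ^ 2 + f ^ 2) / 4) := by
    calc 1 / (4 * k * l) * (|D| ^ m * (e ^ 2 + f ^ 2)) ≤
        1 / (4 * k * l) * (((k * w) * (l * g) * D ^ 2) * (e ^ 2 + f ^ 2)) := by gcongr
      _ = _ := by field_simp
  have hrhs : w * (2 * l * (S ^ (m - p) * S ^ 2) * (e - f) ^ 2) ≤
      (p - 1) * 2 * l * ((|a| + |b|) ^ (p - 2) * S ^ (m - p + 2) * (e - f) ^ 2) := by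
    rw [hY2]
    calc w * (2 * l * (S ^ (m - p) * S ^ 2) * (e - f) ^ 2) ≤
        ((p - 1) * (|a| + |b|) ^ (p - 2)) * (2 * l * (S ^ (m - p) * S ^ 2) * (e - f) ^ 2) := by
          gcongr
      _ = _ := by ring
  rw [hAB]
  linarith

/-- Young's inequality for the error term of the Caccioppoli estimate. -/
lemma young_error_term {n s p m₀ m γ X S t H : ℝ} (hs : s ∈ Ioo (0 : ℝ) 1)
    (hp : 2 ≤ p) (hm₀ : p ≤ m₀) (hm : m₀ ≤ m) (hmm : m * (p - 2) ≤ m₀ * (p - 1))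
    (hγ : 0 ≤ γ) (hX : 0 ≤ X) (hS : 0 ≤ S) (hS4 : S ≤ 4) (ht : 0 < t) (ht1 : t ≤ 1)
    (hH : 0 < H) (hH1 : H ≤ 1) :
    X ^ (p - 2) * S ^ (m - p + 2) / t ^ (n + s * p - 2) ≤
      4 ^ (m - p + 2) * (H ^ (γ * (m - p + 1)) * (X ^ m₀ / t ^ (n + s * m₀)) +
        H ^ (-(γ * (p - 1))) * (S ^ m / t ^ (n - (2 - 2 * s)))) := by
  obtain ⟨hs0, hs1⟩ := hs
  have hm₀0 : 0 < m₀ := by linarith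
  -- With this Young weight, Y₁^θ carries exactly X^(p-2). The hypothesis on m and m₀ reads m θ ≤ p
  -- - 1, which makes the total exponent of H nonpositive, so that the powers of H only help.
  set θ := (p - 2) / m₀ with hθ
  have hθm : m₀ * θ = p - 2 := by rw [hθ]; field_simp
  have hθ0 : 0 ≤ θ := div_nonneg (by linarith) hm₀0.le
  have hθ1 : θ ≤ 1 := by rw [hθ, div_le_one hm₀0]; linarith
  have hθmm : m * θ ≤ p - 1 := by
    rw [hθ, ← mul_div_assoc, div_le_iff₀ hm₀0]; linarith
  -- After scaling S to at most one, its exponent m-p+2 may be lowered to m(1-θ), the one that Y₂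
  -- provides.
  set S' := S / 4 with hS'
  have hS'0 : 0 ≤ S' := by positivity
  have hS'1 : S' ≤ 1 := by rw [hS']; linarith
  set Y₁ := H ^ (γ * (m - p + 1)) * (X ^ m₀ / t ^ (n + s * m₀)) with hY₁
  set Y₂ := H ^ (-(γ * (p - 1))) * (S' ^ m / t ^ (n - (2 - 2 * s))) with hY₂
  have hY₁0 : 0 ≤ Y₁ := by positivity
  have hY₂0 : 0 ≤ Y₂ := by positivity
  have hyoung := Real.geom_mean_le_arith_mean2_weighted hθ0 (sub_nonneg.2 hθ1) hY₁0 hY₂0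
    (by ring)
  have hsum : Y₁ ^ θ * Y₂ ^ (1 - θ) ≤ Y₁ + Y₂ := by nlinarith
  have e₁ : Y₁ ^ θ = H ^ (γ * (m - p + 1) * θ) * (X ^ (p - 2) / t ^ ((n + s * m₀) * θ)) := by
    rw [hY₁, Real.mul_rpow (by positivity) (by positivity), Real.div_rpow (by positivity)
      (by positivity), ← Real.rpow_mul hH.le, ← Real.rpow_mul hX, ← Real.rpow_mul ht.le, hθm]
  have e₂ : Y₂ ^ (1 - θ) = H ^ (-(γ * (p - 1)) * (1 - θ)) *
      (S' ^ (m * (1 - θ)) / t ^ ((n - (2 - 2 * s)) * (1 - θ))) := by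
    rw [hY₂, Real.mul_rpow (by positivity) (by positivity), Real.div_rpow (by positivity)
      (by positivity), ← Real.rpow_mul hH.le, ← Real.rpow_mul hS'0, ← Real.rpow_mul ht.le]
  have hlow : X ^ (p - 2) * S' ^ (m - p + 2) / t ^ (n + s * p - 2) ≤ Y₁ ^ θ * Y₂ ^ (1 - θ) := by
    rw [e₁, e₂]
    have f1 : 1 ≤ H ^ (γ * (m - p + 1) * θ) * H ^ (-(γ * (p - 1)) * (1 - θ)) := by
      rw [← Real.rpow_add hH]
      refine Real.one_le_rpow_of_pos_of_le_one_of_nonpos hH hH1 ?_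
      have : γ * (m - p + 1) * θ + -(γ * (p - 1)) * (1 - θ) = γ * (m * θ - (p - 1)) := by ring
      rw [this]
      exact mul_nonpos_of_nonneg_of_nonpos hγ (by linarith)
    have f2 : S' ^ (m - p + 2) ≤ S' ^ (m * (1 - θ)) := by
      refine Real.rpow_le_rpow_of_exponent_ge' hS'0 hS'1 ?_ ?_
      · exact mul_nonneg (by linarith) (by linarith)
      · nlinarith
    -- The exponent on the left exceeds n + sp - 2 by (2-2s)θ ≥ 0, which is harmless because t ≤ 1.
    have f3 : t ^ ((n + s * m₀) * θ) * t ^ ((n - (2 - 2 * s)) * (1 - θ)) ≤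
        t ^ (n + s * p - 2) := by
      rw [← Real.rpow_add ht]
      refine Real.rpow_le_rpow_of_exponent_ge ht ht1 ?_
      have : (n + s * m₀) * θ + (n - (2 - 2 * s)) * (1 - θ) =
          n + s * (m₀ * θ) - (2 - 2 * s) * (1 - θ) := by ring
      rw [this, hθm]
      nlinarith
    calc X ^ (p - 2) * S' ^ (m - p + 2) / t ^ (n + s * p - 2)
        ≤ X ^ (p - 2) * S' ^ (m * (1 - θ)) /
          (t ^ ((n + s * m₀) * θ) * t ^ ((n - (2 - 2 * s)) * (1 - θ))) := by gcongr
      _ = 1 * (X ^ (p - 2) * S' ^ (m * (1 - θ)) /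
          (t ^ ((n + s * m₀) * θ) * t ^ ((n - (2 - 2 * s)) * (1 - θ)))) := by ring
      _ ≤ (H ^ (γ * (m - p + 1) * θ) * H ^ (-(γ * (p - 1)) * (1 - θ))) *
          (X ^ (p - 2) * S' ^ (m * (1 - θ)) /
          (t ^ ((n + s * m₀) * θ) * t ^ ((n - (2 - 2 * s)) * (1 - θ)))) := by gcongr
      _ = _ := by field_simp
  have hSS : S ^ (m - p + 2) = 4 ^ (m - p + 2) * S' ^ (m - p + 2) := by
    rw [← Real.mul_rpow (by norm_num) hS'0, hS']; congr 1; ring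
  calc X ^ (p - 2) * S ^ (m - p + 2) / t ^ (n + s * p - 2)
      = 4 ^ (m - p + 2) * (X ^ (p - 2) * S' ^ (m - p + 2) / t ^ (n + s * p - 2)) := by
        rw [hSS]; ring
    _ ≤ 4 ^ (m - p + 2) * (Y₁ + Y₂) := by
        gcongr; exact hlow.trans hsum
    _ ≤ _ := by
        have : S' ≤ S := by rw [hS']; linarith
        rw [hY₂]
        gcongr
        linarith

/-- Compare A with H^γ. The weights are such that a bound of order H^(γm) for the integral of A^m
gives order H^(γ(m-k)) for that of A^(m-k) on a set of finite measure, in place of Hölder's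
inequality. -/
lemma rpow_le_split {A H γ m k : ℝ} (hA : 0 ≤ A) (hH : 0 < H) (hk : 0 ≤ k) (hkm : k < m) :
    A ^ (m - k) ≤ H ^ (γ * (m - k)) + H ^ (-(γ * k)) * A ^ m := by
  rcases le_or_gt A (H ^ γ) with h | h
  · have : A ^ (m - k) ≤ H ^ (γ * (m - k)) := by
      rw [Real.rpow_mul hH.le]
      exact Real.rpow_le_rpow hA h (by linarith)
    have h2 : 0 ≤ H ^ (-(γ * k)) * A ^ m := by positivity
    linarith
  · have hA0 : 0 < A := lt_trans (by positivity) h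
    have h1 : A ^ (m - k) = A ^ (-k) * A ^ m := by
      rw [← Real.rpow_add hA0]; congr 1; ring
    have h2 : A ^ (-k) ≤ H ^ (-(γ * k)) := by
      rw [← mul_neg, Real.rpow_mul hH.le]
      exact Real.rpow_le_rpow_of_nonpos (by positivity) h.le (by linarith)
    have h3 : 0 ≤ H ^ (γ * (m - k)) := by positivity
    rw [h1]
    have : A ^ (-k) * A ^ m ≤ H ^ (-(γ * k)) * A ^ m := by gcongr
    linarith

/-! ### Kernels, tail weights and Gagliardo energies -/

instance : (volume : Measure (RN N × RN N)).IsAddHaarMeasure := by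
  rw [Measure.volume_eq_prod]
  infer_instance

/-- The kernel `|w|^{-(N+σ)}`. -/
noncomputable def kern (σ : ℝ) (w : RN N) : ℝ≥0∞ :=
  ENNReal.ofReal (1 / ‖w‖ ^ ((N : ℝ) + σ))

/-- The weight `(1+|y|)^{-(N+σ)}`. -/
noncomputable def weight (σ : ℝ) (y : RN N) : ℝ≥0∞ :=
  ENNReal.ofReal (1 / (1 + ‖y‖) ^ ((N : ℝ) + σ))

/-- The density of the Gagliardo energy. -/
noncomputable def gdens (s q : ℝ) (u : RN N → ℝ) (z : RN N × RN N) : ℝ≥0∞ :=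
  ENNReal.ofReal (|u z.1 - u z.2| ^ q / ‖z.1 - z.2‖ ^ ((N : ℝ) + s * q))

/-- The Gagliardo energy, that is, the `q`-th power of the seminorm. -/
noncomputable def genergy (s q : ℝ) (V : Set (RN N)) (u : RN N → ℝ) : ℝ≥0∞ :=
  ∫⁻ z in V ×ˢ V, gdens s q u z

/-- The density of the tail integral. -/
noncomputable def tdens (s p : ℝ) (u : RN N → ℝ) (y : RN N) : ℝ≥0∞ :=
  ENNReal.ofReal (|u y| ^ (p - 1) / (1 + ‖y‖) ^ ((N : ℝ) + s * p))

/-- Translation differences. -/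
def diff (h : RN N) (u : RN N → ℝ) (x : RN N) : ℝ := u (x + h) - u x

lemma measurable_kern (σ : ℝ) : Measurable (kern (N := N) σ) := by
  unfold kern; fun_prop

lemma measurable_weight (σ : ℝ) : Measurable (weight (N := N) σ) := by
  unfold weight; fun_prop

lemma measurable_gdens {s q : ℝ} {u : RN N → ℝ} (hu : Measurable u) :
    Measurable (gdens s q u) := by
  unfold gdens; fun_prop

lemma measurable_tdens {s p : ℝ} {u : RN N → ℝ} (hu : Measurable u) :
    Measurable (tdens s p u) := by
  unfold tdens; fun_prop

lemma measurable_diff {h : RN N} {u : RN N → ℝ} (hu : Measurable u) : Measurable (diff h u) := by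
  unfold diff; fun_prop

/-- In polar coordinates the radial density is r^(-1-σ), integrable at zero because σ < 0. -/
lemma lintegral_kern_lt_top (hN : 0 < N) {σ : ℝ} (hσ : σ < 0) :
    ∫⁻ w in Metric.ball (0 : RN N) 1, kern σ w < ∞ := by
  have : Nonempty (Fin N) := ⟨⟨0, hN⟩⟩
  have : Nontrivial (RN N) := by
    refine ⟨⟨EuclideanSpace.single ⟨0, hN⟩ 1, 0, ?_⟩⟩
    intro h
    have := congrArg (fun v : RN N => v ⟨0, hN⟩) h
    simp at this
  set f : ℝ → ℝ := (Iio 1).indicator (fun r => 1 / r ^ ((N : ℝ) + σ)) with hf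
  have hint : Integrable (fun w : RN N => f ‖w‖) := by
    rw [integrable_fun_norm_addHaar (μ := (volume : Measure (RN N)))]
    have h1 : IntegrableOn (fun r : ℝ => r ^ (-1 - σ)) (Ioo 0 1) := by
      rw [intervalIntegral.integrableOn_Ioo_rpow_iff (by norm_num)]
      linarith
    have h2 : IntegrableOn (fun r : ℝ => (Iio 1).indicator (fun r => r ^ (-1 - σ)) r) (Ioi 0) := by
      rw [integrableOn_indicator_iff measurableSet_Iio]
      rwa [Iio_inter_Ioi]
    refine h2.congr_fun ?_ measurableSet_Ioi
    intro r hr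
    simp only [mem_Ioi] at hr
    simp only [hf, indicator, finrank_euclideanSpace, Fintype.card_fin, smul_eq_mul]
    split_ifs
    · rw [one_div, ← Real.rpow_neg hr.le, ← Real.rpow_natCast, ← Real.rpow_add hr]
      congr 1
      rw [Nat.cast_sub hN]
      push_cast
      ring
    · simp
  have h3 := hint.lintegral_lt_top
  refine lt_of_le_of_lt ?_ h3
  rw [← lintegral_indicator Metric.isOpen_ball.measurableSet]
  refine lintegral_mono fun w => ?_
  by_cases hw : w ∈ Metric.ball (0 : RN N) 1
  · have : ‖w‖ < 1 := by simpa using hw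
    simp [hw, hf, this, kern]
  · simp [hw]

lemma lintegral_weight_lt_top {σ : ℝ} (hσ : 0 < σ) :
    ∫⁻ y : RN N, weight σ y < ∞ := by
  have := (integrable_one_add_norm (E := RN N) (μ := volume) (r := (N : ℝ) + σ)
    (by simpa using hσ)).lintegral_lt_top
  refine lt_of_le_of_lt (le_of_eq ?_) this
  refine lintegral_congr fun y => ?_
  rw [weight, Real.rpow_neg (by positivity), one_div]

lemma lintegral_mul_conv {f k : RN N → ℝ≥0∞} (hf : Measurable f) (hk : Measurable k) :
    ∫⁻ z : RN N × RN N, f z.1 * k (z.1 - z.2) = (∫⁻ x, f x) * ∫⁻ w, k w := by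
  rw [Measure.volume_eq_prod, lintegral_prod _ (by fun_prop)]
  simp only
  have : ∀ x, ∫⁻ y, f x * k (x - y) = f x * ∫⁻ w, k w := fun x => by
    rw [lintegral_const_mul _ (by fun_prop), lintegral_sub_left_eq_self]
  simp_rw [this]
  rw [lintegral_mul_const _ hf]

lemma lintegral_mul_conv' {f k : RN N → ℝ≥0∞} (hf : Measurable f) (hk : Measurable k) :
    ∫⁻ z : RN N × RN N, f z.2 * k (z.1 - z.2) = (∫⁻ x, f x) * ∫⁻ w, k w := by
  rw [Measure.volume_eq_prod, lintegral_prod_symm _ (by fun_prop)]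
  simp only
  have : ∀ x, ∫⁻ y, f x * k (y - x) = f x * ∫⁻ w, k w := fun x => by
    rw [lintegral_const_mul _ (by fun_prop), lintegral_sub_right_eq_self]
  simp_rw [this]
  rw [lintegral_mul_const _ hf]

lemma lintegral_tensor {f g : RN N → ℝ≥0∞} (hf : Measurable f) (hg : Measurable g) :
    ∫⁻ z : RN N × RN N, f z.1 * g z.2 = (∫⁻ x, f x) * ∫⁻ y, g y := by
  rw [Measure.volume_eq_prod, lintegral_prod_mul hf.aemeasurable hg.aemeasurable]

lemma lintegral_tensor' {f g : RN N → ℝ≥0∞} (hf : Measurable f) (hg : Measurable g) :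
    ∫⁻ z : RN N × RN N, f z.2 * g z.1 = (∫⁻ x, f x) * ∫⁻ y, g y := by
  rw [mul_comm (∫⁻ x, f x), ← lintegral_tensor hg hf]
  simp_rw [mul_comm]

/-- Comparison of the kernel far from the diagonal with the weight. -/
lemma one_div_kern_far {σ d : ℝ} (hσ : 0 ≤ σ) (hd : 0 < d) (hd1 : d ≤ 1) {x y : RN N}
    (hx : ‖x‖ ≤ 1) (hxy : d ≤ ‖x - y‖) :
    1 / ‖x - y‖ ^ ((N : ℝ) + σ) ≤ (3 / d) ^ ((N : ℝ) + σ) * (1 / (1 + ‖y‖) ^ ((N : ℝ) + σ)) := by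
  have h0 : 0 < ‖x - y‖ := hd.trans_le hxy
  have h1 : 1 + ‖y‖ ≤ 3 / d * ‖x - y‖ := by
    have : ‖y‖ ≤ ‖x‖ + ‖x - y‖ := by
      have := norm_sub_le x (x - y)
      simpa using this
    have h2 : 1 ≤ ‖x - y‖ / d := by rwa [le_div_iff₀ hd, one_mul]
    have h3 : ‖x - y‖ ≤ ‖x - y‖ / d := by
      rw [le_div_iff₀ hd]; nlinarith
    have : 3 / d * ‖x - y‖ = 3 * (‖x - y‖ / d) := by ring
    linarith
  have h2 : (1 + ‖y‖) ^ ((N : ℝ) + σ) ≤ (3 / d) ^ ((N : ℝ) + σ) * ‖x - y‖ ^ ((N : ℝ) + σ) := by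
    rw [← Real.mul_rpow (by positivity) h0.le]
    exact Real.rpow_le_rpow (by positivity) h1 (by positivity)
  rw [mul_one_div, div_le_div_iff₀ (by positivity) (by positivity)]
  linarith

lemma add_rpow_le_two {a b t : ℝ} (ha : 0 ≤ a) (hb : 0 ≤ b) (ht : 0 ≤ t) :
    (a + b) ^ t ≤ 2 ^ t * (a ^ t + b ^ t) := by
  have h : (a + b) ^ t ≤ (2 * max a b) ^ t := by
    refine Real.rpow_le_rpow (by positivity) ?_ ht
    linarith [le_max_left a b, le_max_right a b]
  refine h.trans ?_
  rw [Real.mul_rpow (by norm_num) (le_max_of_le_left ha)]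
  have : (max a b) ^ t ≤ a ^ t + b ^ t := by
    have h1 := Real.rpow_nonneg ha t
    have h2 := Real.rpow_nonneg hb t
    rcases max_choice a b with h | h <;> rw [h] <;> linarith
  gcongr

lemma abs_sub_rpow_le (a b : ℝ) {t : ℝ} (ht : 0 ≤ t) :
    |a - b| ^ t ≤ 2 ^ t * (|a| ^ t + |b| ^ t) :=
  (Real.rpow_le_rpow (abs_nonneg _) (abs_sub a b) ht).trans
    (add_rpow_le_two (abs_nonneg _) (abs_nonneg _) ht)

/-- Pointwise bound for the nonlocal interaction far from the diagonal. -/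
lemma far_interaction_le {s p d : ℝ} (hs : 0 ≤ s) (hp : 2 ≤ p) (hd : 0 < d) (hd1 : d ≤ 1)
    {w : RN N → ℝ} {x y : RN N} (hx : ‖x‖ ≤ 1) (hwx : |w x| ≤ 1) (hxy : d ≤ ‖x - y‖) :
    ENNReal.ofReal (|w x - w y| ^ (p - 1) / ‖x - y‖ ^ ((N : ℝ) + s * p)) ≤
      ENNReal.ofReal (2 ^ (p - 1) * (3 / d) ^ ((N : ℝ) + s * p)) *
        (weight (s * p) y + tdens s p w y) := by
  have hsp : 0 ≤ s * p := mul_nonneg hs (by linarith)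
  rw [weight, tdens, ← ENNReal.ofReal_add (by positivity) (by positivity),
    ← ENNReal.ofReal_mul (by positivity)]
  apply ENNReal.ofReal_le_ofReal
  have h1 := one_div_kern_far (N := N) hsp hd hd1 hx hxy
  have h2 := abs_sub_rpow_le (w x) (w y) (t := p - 1) (by linarith)
  have h3 : |w x| ^ (p - 1) ≤ 1 := Real.rpow_le_one (abs_nonneg _) hwx (by linarith)
  have h4 : |w x - w y| ^ (p - 1) ≤ 2 ^ (p - 1) * (1 + |w y| ^ (p - 1)) :=
    h2.trans (by gcongr)
  calc |w x - w y| ^ (p - 1) / ‖x - y‖ ^ ((N : ℝ) + s * p)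
      = |w x - w y| ^ (p - 1) * (1 / ‖x - y‖ ^ ((N : ℝ) + s * p)) := by ring
    _ ≤ (2 ^ (p - 1) * (1 + |w y| ^ (p - 1))) *
        ((3 / d) ^ ((N : ℝ) + s * p) * (1 / (1 + ‖y‖) ^ ((N : ℝ) + s * p))) := by gcongr
    _ = _ := by ring

lemma genergy_mono {s q : ℝ} {V W : Set (RN N)} (h : V ⊆ W) (u : RN N → ℝ) :
    genergy s q V u ≤ genergy s q W u :=
  lintegral_mono_set (prod_mono h h)

lemma gagliardo_eq {s q : ℝ} {V : Set (RN N)} {u : RN N → ℝ}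
    (hu : AEMeasurable u (volume.restrict V)) :
    gagliardo s q V u = genergy s q V u ^ (1 / q) := by
  rw [gagliardo, genergy, Measure.volume_eq_prod, ← Measure.prod_restrict, lintegral_prod]
  · rfl
  · unfold gdens
    have h1 : AEMeasurable (fun z : RN N × RN N => u z.1)
        ((volume.restrict V).prod (volume.restrict V)) := hu.comp_fst
    have h2 : AEMeasurable (fun z : RN N × RN N => u z.2)
        ((volume.restrict V).prod (volume.restrict V)) := hu.comp_snd
    fun_prop

/-- Translation invariance of the energy. -/
lemma genergy_translate {s q : ℝ} {V W : Set (RN N)} (hV : MeasurableSet V)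
    (hW : MeasurableSet W) {h : RN N} (hVW : ∀ x ∈ V, x + h ∈ W) (u : RN N → ℝ) :
    genergy s q V (fun x => u (x + h)) ≤ genergy s q W u := by
  rw [genergy, genergy, ← lintegral_indicator (hV.prod hV), ← lintegral_indicator (hW.prod hW),
    ← lintegral_add_right_eq_self ((W ×ˢ W).indicator (gdens s q u)) (h, h)]
  refine lintegral_mono fun z => ?_
  by_cases hz : z ∈ V ×ˢ V
  · have : z + (h, h) ∈ W ×ˢ W := ⟨hVW _ hz.1, hVW _ hz.2⟩
    rw [indicator_of_mem hz, indicator_of_mem this]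
    simp [gdens]
  · simp [hz]

lemma genergy_sub_le {s q : ℝ} (hq : 0 ≤ q) {V : Set (RN N)} {u w : RN N → ℝ}
    (hu : Measurable u) :
    genergy s q V (fun x => u x - w x) ≤
      ENNReal.ofReal (2 ^ q) * (genergy s q V u + genergy s q V w) := by
  rw [genergy, genergy, genergy, ← lintegral_add_left (measurable_gdens hu),
    ← lintegral_const_mul' _ _ ENNReal.ofReal_ne_top]
  refine lintegral_mono fun z => ?_
  simp only [gdens]
  rw [← ENNReal.ofReal_add (by positivity) (by positivity),
    ← ENNReal.ofReal_mul (by positivity), ← add_div, ← mul_div_assoc]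
  apply ENNReal.ofReal_le_ofReal
  gcongr
  rw [show u z.1 - w z.1 - (u z.2 - w z.2) = (u z.1 - u z.2) - (w z.1 - w z.2) by ring]
  exact abs_sub_rpow_le _ _ hq

/-! ### Cutoffs, normalised solutions and absolute convergence -/

/-- Radial Lipschitz cutoff: `1` on `B_{r-d}`, `0` outside `B_r`. -/
noncomputable def cutoff (r d : ℝ) (x : RN N) : ℝ := max 0 (min 1 ((r - ‖x‖) / d))

lemma cutoff_nonneg (r d : ℝ) (x : RN N) : 0 ≤ cutoff r d x := le_max_left _ _

lemma cutoff_le_one (r d : ℝ) (x : RN N) : cutoff r d x ≤ 1 :=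
  max_le zero_le_one (min_le_left _ _)

lemma cutoff_eq_one {r d : ℝ} (hd : 0 < d) {x : RN N} (hx : ‖x‖ ≤ r - d) :
    cutoff r d x = 1 := by
  have : 1 ≤ (r - ‖x‖) / d := by rw [le_div_iff₀ hd]; linarith
  simp [cutoff, min_eq_left this]

lemma cutoff_eq_zero {r d : ℝ} (hd : 0 < d) {x : RN N} (hx : x ∉ Metric.ball (0 : RN N) r) :
    cutoff r d x = 0 := by
  have h1 : r ≤ ‖x‖ := by simpa using hx
  have : (r - ‖x‖) / d ≤ 0 := div_nonpos_of_nonpos_of_nonneg (by linarith) hd.le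
  simp [cutoff, min_eq_right (this.trans zero_le_one), this]

lemma abs_cutoff_sub_le {r d : ℝ} (hd : 0 < d) (x y : RN N) :
    |cutoff r d x - cutoff r d y| ≤ ‖x - y‖ / d := by
  unfold cutoff
  have h1 : |(r - ‖x‖) / d - (r - ‖y‖) / d| ≤ ‖x - y‖ / d := by
    rw [← sub_div, abs_div, abs_of_pos hd]
    gcongr
    rw [show r - ‖x‖ - (r - ‖y‖) = -(‖x‖ - ‖y‖) by ring, abs_neg]
    exact abs_norm_sub_norm_le x y
  refine le_trans ?_ h1
  refine (abs_max_sub_max_le_max _ _ _ _).trans ?_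
  simp only [sub_self, abs_zero]
  refine max_le (abs_nonneg _) ((abs_min_sub_min_le_max _ _ _ _).trans ?_)
  simp

lemma measurable_cutoff (r d : ℝ) : Measurable (cutoff (N := N) r d) := by
  unfold cutoff; fun_prop

lemma abs_cutoff_sq_sub_le {r d : ℝ} (hd : 0 < d) (x y : RN N) :
    |cutoff r d x ^ 2 - cutoff r d y ^ 2| ≤ 2 / d * ‖x - y‖ := by
  rw [sq_sub_sq, abs_mul]
  have h1 := abs_cutoff_sub_le (r := r) hd x y
  have h2 : |cutoff r d x + cutoff r d y| ≤ 2 := by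
    rw [abs_of_nonneg (add_nonneg (cutoff_nonneg _ _ _) (cutoff_nonneg _ _ _))]
    linarith [cutoff_le_one r d x, cutoff_le_one r d y]
  calc _ ≤ 2 * (‖x - y‖ / d) := by gcongr
    _ = _ := by ring

/-- Weak solutions on the unit ball of the equation `μ (-Δ₁)^{s₁} v + (-Δ_p)^s v = 0`, normalised
by `|v| ≤ 1` on the ball, and by unit bounds for the tail and the Gagliardo energy. -/
structure IsUnitSolution (s₁ s p μ : ℝ) (v : RN N → ℝ) (Z : RN N × RN N → ℝ) : Prop where
  measurable : Measurable v
  abs_le_one : ∀ x ∈ Metric.ball (0 : RN N) 1, |v x| ≤ 1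
  tail_le : ∫⁻ x, tdens s p v x ≤ 1
  genergy_one : genergy s₁ 1 (Metric.ball 0 1) v < ∞
  genergy_le : genergy s p (Metric.ball 0 1) v ≤ 1
  aemeasurable_sign : AEMeasurable Z
  sign : ∀ᵐ z : RN N × RN N, Z z ∈ sgn (v z.1 - v z.2)
  weak_eq : ∀ φ : RN N → ℝ, Measurable φ → (∃ M, ∀ x, |φ x| ≤ M) →
    (∃ ρ < 1, ∀ x ∉ Metric.ball (0 : RN N) ρ, φ x = 0) →
    genergy s₁ 1 univ φ < ∞ → genergy s p univ φ < ∞ →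
    μ * (∫ z : RN N × RN N, Z z * (φ z.1 - φ z.2) / ‖z.1 - z.2‖ ^ ((N : ℝ) + s₁)) +
      (∫ z : RN N × RN N, jpow (p - 2) (v z.1 - v z.2) * (φ z.1 - φ z.2) /
        ‖z.1 - z.2‖ ^ ((N : ℝ) + s * p)) = 0

lemma lintegral_indicator_one_ball_lt_top (r : ℝ) :
    ∫⁻ x, (Metric.ball (0 : RN N) r).indicator (1 : RN N → ℝ≥0∞) x < ∞ := by
  rw [lintegral_indicator_one Metric.isOpen_ball.measurableSet]
  exact measure_ball_lt_top

lemma measurable_ball_indicator_one (r : ℝ) :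
    Measurable ((Metric.ball (0 : RN N) r).indicator (1 : RN N → ℝ≥0∞)) :=
  measurable_one.indicator Metric.isOpen_ball.measurableSet

lemma lintegral_near_kern_lt_top (hN : 0 < N) {σ : ℝ} (hσ : σ < 0) :
    ∫⁻ w, (Metric.ball (0 : RN N) 1).indicator (kern σ) w < ∞ := by
  rw [lintegral_indicator Metric.isOpen_ball.measurableSet]
  exact lintegral_kern_lt_top hN hσ

lemma measurable_near_kern (σ : ℝ) :
    Measurable ((Metric.ball (0 : RN N) 1).indicator (kern σ)) :=
  (measurable_kern σ).indicator Metric.isOpen_ball.measurableSet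

/-- A factor t^τ gained from a Lipschitz bound lowers the order of the kernel by τ. Only an
inequality is claimed so that t = 0 is covered, where the left side vanishes. -/
lemma one_div_rpow_sub {n t τ : ℝ} (ht : 0 ≤ t) (hτ : 0 < τ) (a : ℝ) :
    t ^ τ / t ^ (n + a) ≤ 1 / t ^ (n + (a - τ)) := by
  rcases ht.eq_or_lt with rfl | h
  · rw [Real.zero_rpow hτ.ne']; simp [Real.rpow_nonneg]
  · rw [show n + (a - τ) = n + a - τ by ring, Real.rpow_sub h]
    apply le_of_eq
    have := Real.rpow_pos_of_pos h (n + a)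
    have := Real.rpow_pos_of_pos h τ
    field_simp

lemma mem_ball_add {r d : ℝ} {x y : RN N} (hx : x ∈ Metric.ball (0 : RN N) r)
    (hxy : ‖x - y‖ < d) : y ∈ Metric.ball (0 : RN N) (r + d) := by
  rw [mem_ball_zero_iff] at hx ⊢
  have := norm_sub_le x (x - y)
  rw [sub_sub_cancel] at this
  linarith

/-- Products with a cutoff stay in the fractional Sobolev space. -/
lemma genergy_mul_cutoff_lt_top (hN : 0 < N) {σ t r d M L : ℝ} (hσ : σ ∈ Ioo (0 : ℝ) 1)
    (ht : 1 ≤ t) (hr : r ≤ 1) (hd : 0 < d) (hd1 : d ≤ 1) {ψ χ : RN N → ℝ} (hψm : Measurable ψ)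
    (hM : 0 ≤ M) (hL : 0 ≤ L) (hψ : ∀ x ∈ Metric.ball (0 : RN N) (r + d), |ψ x| ≤ M)
    (hχ0 : ∀ x, 0 ≤ χ x) (hχ1 : ∀ x, χ x ≤ 1) (hχ : ∀ x ∉ Metric.ball (0 : RN N) r, χ x = 0)
    (hlip : ∀ x y, |χ x - χ y| ≤ L * ‖x - y‖)
    (hψg : genergy σ t (Metric.ball 0 (r + d)) ψ < ∞) :
    genergy σ t univ (fun x => ψ x * χ x) < ∞ := by
  obtain ⟨hσ0, hσ1⟩ := hσ
  set B := Metric.ball (0 : RN N) r with hB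
  set B' := Metric.ball (0 : RN N) (r + d) with hB'
  have hmB' : MeasurableSet (B' ×ˢ B') :=
    Metric.isOpen_ball.measurableSet.prod Metric.isOpen_ball.measurableSet
  set c₂ := 2 ^ t * (M * L) ^ t
  set c₃ := 2 ^ t * M ^ t * (3 / d) ^ ((N : ℝ) + σ * t)
  -- Near the diagonal the product rule leaves the energy of ψ (T₁) and a Lipschitz term of the
  -- cutoff, whose kernel has order σt - t < 0 (T₂). At distance at least d the values at x and y
  -- are treated separately, against the integrable weight in the other variable (T₃, T₄).
  set T₁ : RN N × RN N → ℝ≥0∞ := fun z =>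
    ENNReal.ofReal (2 ^ t) * (B' ×ˢ B').indicator (gdens σ t ψ) z with hT₁
  set T₂ : RN N × RN N → ℝ≥0∞ := fun z => ENNReal.ofReal c₂ *
    (B'.indicator 1 z.1 * (Metric.ball (0 : RN N) 1).indicator (kern (σ * t - t)) (z.1 - z.2))
    with hT₂
  set T₃ : RN N × RN N → ℝ≥0∞ := fun z => ENNReal.ofReal c₃ *
    (B.indicator 1 z.1 * weight (σ * t) z.2) with hT₃
  set T₄ : RN N × RN N → ℝ≥0∞ := fun z => ENNReal.ofReal c₃ *
    (B.indicator 1 z.2 * weight (σ * t) z.1) with hT₄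
  have ht0 : 0 < t := by linarith
  have hσt : 0 < σ * t := by positivity
  have hfar : ∀ x y : RN N, x ∈ B → d ≤ ‖x - y‖ →
      2 ^ t * |ψ x * χ x| ^ t / ‖x - y‖ ^ ((N : ℝ) + σ * t) ≤
        c₃ * (1 / (1 + ‖y‖) ^ ((N : ℝ) + σ * t)) := by
    intro x y hx hxy
    have hx' : ‖x‖ < r := by simpa [hB] using hx
    have h1 := one_div_kern_far (N := N) hσt.le hd hd1 (hx'.le.trans hr) hxy
    have h2 : |ψ x * χ x| ^ t ≤ M ^ t := by
      refine Real.rpow_le_rpow (abs_nonneg _) ?_ ht0.le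
      rw [abs_mul, abs_of_nonneg (hχ0 x)]
      have h3 : |ψ x| ≤ M := hψ x (Metric.ball_subset_ball (by linarith) hx)
      nlinarith [hχ0 x, hχ1 x, abs_nonneg (ψ x)]
    calc 2 ^ t * |ψ x * χ x| ^ t / ‖x - y‖ ^ ((N : ℝ) + σ * t)
        = 2 ^ t * |ψ x * χ x| ^ t * (1 / ‖x - y‖ ^ ((N : ℝ) + σ * t)) := by ring
      _ ≤ 2 ^ t * M ^ t * ((3 / d) ^ ((N : ℝ) + σ * t) *
          (1 / (1 + ‖y‖) ^ ((N : ℝ) + σ * t))) := by gcongr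
      _ = _ := by ring
  have hpt : ∀ z, gdens σ t (fun x => ψ x * χ x) z ≤ T₁ z + (T₂ z + (T₃ z + T₄ z)) := by
    rintro ⟨x, y⟩
    rcases lt_or_ge ‖x - y‖ d with hn | hf
    · by_cases hxy : x ∈ B ∨ y ∈ B
      · have hx : x ∈ B' := by
          rcases hxy with h | h
          · exact Metric.ball_subset_ball (by linarith) h
          · exact mem_ball_add h (by rwa [norm_sub_rev])
        have hy : y ∈ B' := by
          rcases hxy with h | h
          · exact mem_ball_add h hn
          · exact Metric.ball_subset_ball (by linarith) h
        refine le_trans ?_ (add_le_add le_rfl (le_self_add (a := T₂ (x, y))))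
        have hz : (x, y) ∈ B' ×ˢ B' := ⟨hx, hy⟩
        have hw : x - y ∈ Metric.ball (0 : RN N) 1 := by
          rw [mem_ball_zero_iff]; linarith
        simp only [hT₁, hT₂, indicator_of_mem hz, indicator_of_mem hx, indicator_of_mem hw,
          Pi.one_apply, one_mul, gdens, kern]
        rw [← ENNReal.ofReal_mul (by positivity), ← ENNReal.ofReal_mul (by positivity),
          ← ENNReal.ofReal_add (by positivity) (by positivity)]
        apply ENNReal.ofReal_le_ofReal
        have e1 : |ψ x * χ x - ψ y * χ y| ≤ |ψ x - ψ y| + M * L * ‖x - y‖ := by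
          have : ψ x * χ x - ψ y * χ y = (ψ x - ψ y) * χ x + ψ y * (χ x - χ y) := by ring
          rw [this]
          refine (abs_add_le _ _).trans ?_
          rw [abs_mul, abs_mul, abs_of_nonneg (hχ0 x)]
          have h1 : |ψ x - ψ y| * χ x ≤ |ψ x - ψ y| :=
            mul_le_of_le_one_right (abs_nonneg _) (hχ1 x)
          have h2 : |ψ y| * |χ x - χ y| ≤ M * (L * ‖x - y‖) :=
            mul_le_mul (hψ y hy) (hlip x y) (abs_nonneg _) hM
          linarith
        have e2 : |ψ x * χ x - ψ y * χ y| ^ t ≤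
            2 ^ t * (|ψ x - ψ y| ^ t + (M * L) ^ t * ‖x - y‖ ^ t) := by
          refine (Real.rpow_le_rpow (abs_nonneg _) e1 ht0.le).trans ?_
          refine (add_rpow_le_two (abs_nonneg _) (by positivity) ht0.le).trans ?_
          rw [Real.mul_rpow (by positivity) (norm_nonneg _)]
        have e3 := one_div_rpow_sub (n := N) (norm_nonneg (x - y)) ht0 (σ * t)
        calc |ψ x * χ x - ψ y * χ y| ^ t / ‖x - y‖ ^ ((N : ℝ) + σ * t)
            ≤ 2 ^ t * (|ψ x - ψ y| ^ t + (M * L) ^ t * ‖x - y‖ ^ t) /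
              ‖x - y‖ ^ ((N : ℝ) + σ * t) := by gcongr
          _ = 2 ^ t * (|ψ x - ψ y| ^ t / ‖x - y‖ ^ ((N : ℝ) + σ * t)) +
              c₂ * (‖x - y‖ ^ t / ‖x - y‖ ^ ((N : ℝ) + σ * t)) := by ring
          _ ≤ _ := by gcongr
      · push Not at hxy
        simp [gdens, hχ x hxy.1, hχ y hxy.2, Real.zero_rpow ht0.ne']
    · refine le_trans ?_ ((le_add_self (a := T₃ (x, y) + T₄ (x, y)) (b := T₂ (x, y))).trans
        le_add_self)
      have h1 : ENNReal.ofReal (2 ^ t * |ψ x * χ x| ^ t / ‖x - y‖ ^ ((N : ℝ) + σ * t)) ≤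
          T₃ (x, y) := by
        by_cases hx : x ∈ B
        · simp only [hT₃, indicator_of_mem hx, Pi.one_apply, one_mul, weight]
          rw [← ENNReal.ofReal_mul (by positivity)]
          exact ENNReal.ofReal_le_ofReal (hfar x y hx hf)
        · simp [hχ x hx, Real.zero_rpow ht0.ne']
      have h2 : ENNReal.ofReal (2 ^ t * |ψ y * χ y| ^ t / ‖x - y‖ ^ ((N : ℝ) + σ * t)) ≤
          T₄ (x, y) := by
        by_cases hy : y ∈ B
        · simp only [hT₄, indicator_of_mem hy, Pi.one_apply, one_mul, weight]
          rw [← ENNReal.ofReal_mul (by positivity), norm_sub_rev]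
          exact ENNReal.ofReal_le_ofReal (hfar y x hy (by rwa [norm_sub_rev]))
        · simp [hχ y hy, Real.zero_rpow ht0.ne']
      refine le_trans ?_ (add_le_add h1 h2)
      rw [← ENNReal.ofReal_add (by positivity) (by positivity), gdens]
      apply ENNReal.ofReal_le_ofReal
      rw [← add_div, ← mul_add]
      gcongr
      exact abs_sub_rpow_le _ _ ht0.le
  have hmB : Measurable (B.indicator (1 : RN N → ℝ≥0∞)) := measurable_ball_indicator_one r
  have hmBp : Measurable (B'.indicator (1 : RN N → ℝ≥0∞)) := measurable_ball_indicator_one _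
  have hmw : Measurable (weight (N := N) (σ * t)) := measurable_weight _
  have hmk := measurable_near_kern (N := N) (σ * t - t)
  have hm1 : Measurable T₁ := ((measurable_gdens hψm).indicator hmB').const_mul _
  have hm2 : Measurable T₂ := by
    refine Measurable.const_mul ?_ _
    exact (hmBp.comp measurable_fst).mul (hmk.comp (measurable_fst.sub measurable_snd))
  have hm3 : Measurable T₃ :=
    ((hmB.comp measurable_fst).mul (hmw.comp measurable_snd)).const_mul _
  rw [genergy, univ_prod_univ, Measure.restrict_univ]
  refine (lintegral_mono hpt).trans_lt ?_
  rw [lintegral_add_left hm1, lintegral_add_left hm2, lintegral_add_left hm3]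
  simp only [hT₁, hT₂, hT₃, hT₄]
  rw [lintegral_const_mul' _ _ ENNReal.ofReal_ne_top,
    lintegral_const_mul' _ _ ENNReal.ofReal_ne_top,
    lintegral_const_mul' _ _ ENNReal.ofReal_ne_top, lintegral_const_mul' _ _ ENNReal.ofReal_ne_top,
    lintegral_mul_conv hmBp hmk, lintegral_tensor hmB hmw, lintegral_tensor' hmB hmw,
    lintegral_indicator hmB']
  have i1 := lintegral_indicator_one_ball_lt_top (N := N) r
  have i2 := lintegral_indicator_one_ball_lt_top (N := N) (r + d)
  have i3 := lintegral_weight_lt_top (N := N) hσt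
  have i4 := lintegral_near_kern_lt_top hN (σ := σ * t - t) (by nlinarith)
  have i34 := ENNReal.mul_lt_top ENNReal.ofReal_lt_top (ENNReal.mul_lt_top i1 i3)
    (a := ENNReal.ofReal c₃)
  exact ENNReal.add_lt_top.2 ⟨ENNReal.mul_lt_top ENNReal.ofReal_lt_top hψg,
    ENNReal.add_lt_top.2 ⟨ENNReal.mul_lt_top ENNReal.ofReal_lt_top (ENNReal.mul_lt_top i2 i4),
      ENNReal.add_lt_top.2 ⟨i34, i34⟩⟩⟩

/-- Integrability of the `p`-Laplacian integrand for locally bounded functions with finite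
energy and tail. -/
lemma integrable_interaction {s p r d M : ℝ} (hs : 0 < s)
    (hp : 2 ≤ p) (hr : r ≤ 1) (hd : 0 < d) (hd1 : d ≤ 1) {w φ : RN N → ℝ} (hw : Measurable w)
    (hφ : Measurable φ) (hM : ∀ x, |φ x| ≤ M)
    (hw1 : ∀ x ∈ Metric.ball (0 : RN N) r, |w x| ≤ 1)
    (hφ0 : ∀ x ∉ Metric.ball (0 : RN N) r, φ x = 0)
    (hwg : genergy s p (Metric.ball 0 (r + d)) w < ∞) (hwt : ∫⁻ x, tdens s p w x < ∞)
    (hφg : genergy s p univ φ < ∞) :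
    Integrable (fun z : RN N × RN N => jpow (p - 2) (w z.1 - w z.2) * (φ z.1 - φ z.2) /
      ‖z.1 - z.2‖ ^ ((N : ℝ) + s * p)) := by
  have hmeas : Measurable (fun z : RN N × RN N => jpow (p - 2) (w z.1 - w z.2) *
      (φ z.1 - φ z.2) / ‖z.1 - z.2‖ ^ ((N : ℝ) + s * p)) := by
    unfold jpow; fun_prop
  refine ⟨hmeas.aestronglyMeasurable, ?_⟩
  have hM0 : 0 ≤ M := (abs_nonneg _).trans (hM 0)
  set B := Metric.ball (0 : RN N) r with hB
  set B' := Metric.ball (0 : RN N) (r + d) with hB'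
  have hmB' : MeasurableSet (B' ×ˢ B') :=
    Metric.isOpen_ball.measurableSet.prod Metric.isOpen_ball.measurableSet
  set c := ENNReal.ofReal M * ENNReal.ofReal (2 ^ (p - 1) * (3 / d) ^ ((N : ℝ) + s * p))
  have hc : c < ∞ := ENNReal.mul_lt_top ENNReal.ofReal_lt_top ENNReal.ofReal_lt_top
  set g : RN N → ℝ≥0∞ := fun y => weight (s * p) y + tdens s p w y with hg
  have hgm : Measurable g := (measurable_weight _).add (measurable_tdens hw)
  have hsp : 0 < s * p := mul_pos hs (by linarith)
  have hgi : ∫⁻ y, g y < ∞ := by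
    rw [hg, lintegral_add_left (measurable_weight _)]
    exact ENNReal.add_lt_top.2 ⟨lintegral_weight_lt_top hsp, hwt⟩
  -- Near the diagonal a^(p-1) b ≤ a^p + b^p splits the integrand into the densities of w and φ. Far
  -- from it φ is bounded and the interaction is dominated by the weight and the tail density.
  set T₁ : RN N × RN N → ℝ≥0∞ := (B' ×ˢ B').indicator (gdens s p w) with hT₁
  set T₂ : RN N × RN N → ℝ≥0∞ := gdens s p φ with hT₂
  set T₃ : RN N × RN N → ℝ≥0∞ := fun z => c * (B.indicator 1 z.1 * g z.2) with hT₃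
  set T₄ : RN N × RN N → ℝ≥0∞ := fun z => c * (B.indicator 1 z.2 * g z.1) with hT₄
  have hfar : ∀ x y : RN N, x ∈ B → d ≤ ‖x - y‖ →
      ENNReal.ofReal (|w x - w y| ^ (p - 1) * |φ x| / ‖x - y‖ ^ ((N : ℝ) + s * p)) ≤ c * g y := by
    intro x y hx hxy
    have hx' : ‖x‖ < r := by simpa [hB] using hx
    have h1 := far_interaction_le (N := N) (w := w) hs.le hp hd hd1 (hx'.le.trans hr) (hw1 x hx)
      hxy
    rw [show |w x - w y| ^ (p - 1) * |φ x| / ‖x - y‖ ^ ((N : ℝ) + s * p) =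
      |φ x| * (|w x - w y| ^ (p - 1) / ‖x - y‖ ^ ((N : ℝ) + s * p)) by ring,
      ENNReal.ofReal_mul (abs_nonneg _), mul_assoc]
    exact mul_le_mul' (ENNReal.ofReal_le_ofReal (hM x)) h1
  have habs : ∀ z : RN N × RN N, |jpow (p - 2) (w z.1 - w z.2) * (φ z.1 - φ z.2) /
      ‖z.1 - z.2‖ ^ ((N : ℝ) + s * p)| = |w z.1 - w z.2| ^ (p - 1) * |φ z.1 - φ z.2| /
      ‖z.1 - z.2‖ ^ ((N : ℝ) + s * p) := by
    intro z
    rw [abs_div, abs_mul, abs_jpow (by linarith), abs_of_nonneg (a := ‖z.1 - z.2‖ ^ _)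
      (by positivity), show p - 2 + 1 = p - 1 by ring]
  have hpt : ∀ z : RN N × RN N, ‖jpow (p - 2) (w z.1 - w z.2) * (φ z.1 - φ z.2) /
      ‖z.1 - z.2‖ ^ ((N : ℝ) + s * p)‖ₑ ≤ T₁ z + (T₂ z + (T₃ z + T₄ z)) := by
    rintro ⟨x, y⟩
    rw [Real.enorm_eq_ofReal_abs, habs]
    rcases lt_or_ge ‖x - y‖ d with hn | hf
    · by_cases hxy : x ∈ B ∨ y ∈ B
      · have hx : x ∈ B' := by
          rcases hxy with h | h
          · exact Metric.ball_subset_ball (by linarith) h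
          · exact mem_ball_add h (by rwa [norm_sub_rev])
        have hy : y ∈ B' := by
          rcases hxy with h | h
          · exact mem_ball_add h hn
          · exact Metric.ball_subset_ball (by linarith) h
        refine le_trans ?_ (add_le_add le_rfl (le_self_add (a := T₂ (x, y))))
        have hz : (x, y) ∈ B' ×ˢ B' := ⟨hx, hy⟩
        simp only [hT₁, hT₂, indicator_of_mem hz, gdens]
        rw [← ENNReal.ofReal_add (by positivity) (by positivity)]
        apply ENNReal.ofReal_le_ofReal
        rw [← add_div]
        gcongr
        set a := |w x - w y|
        set b := |φ x - φ y|
        have ha : 0 ≤ a := abs_nonneg _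
        have hb : 0 ≤ b := abs_nonneg _
        have hp1 : p - 1 + 1 = p := by ring
        rcases le_total a b with h | h
        · have h1 : a ^ (p - 1) ≤ b ^ (p - 1) := Real.rpow_le_rpow ha h (by linarith)
          have h2 : b ^ (p - 1) * b = b ^ p := by
            rw [← Real.rpow_add_one' hb (by linarith), hp1]
          have h3 := Real.rpow_nonneg ha p
          nlinarith
        · have h2 : a ^ (p - 1) * a = a ^ p := by
            rw [← Real.rpow_add_one' ha (by linarith), hp1]
          have h3 := Real.rpow_nonneg hb p
          have h4 := Real.rpow_nonneg ha (p - 1)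
          nlinarith
      · push Not at hxy
        simp [hφ0 x hxy.1, hφ0 y hxy.2]
    · refine le_trans ?_ ((le_add_self (a := T₃ (x, y) + T₄ (x, y)) (b := T₂ (x, y))).trans
        le_add_self)
      have h1 : ENNReal.ofReal (|w x - w y| ^ (p - 1) * |φ x| / ‖x - y‖ ^ ((N : ℝ) + s * p)) ≤
          T₃ (x, y) := by
        by_cases hx : x ∈ B
        · simp only [hT₃, indicator_of_mem hx, Pi.one_apply, one_mul]
          exact hfar x y hx hf
        · simp [hφ0 x hx]
      have h2 : ENNReal.ofReal (|w x - w y| ^ (p - 1) * |φ y| / ‖x - y‖ ^ ((N : ℝ) + s * p)) ≤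
          T₄ (x, y) := by
        by_cases hy : y ∈ B
        · simp only [hT₄, indicator_of_mem hy, Pi.one_apply, one_mul]
          rw [norm_sub_rev, abs_sub_comm]
          exact hfar y x hy (by rwa [norm_sub_rev])
        · simp [hφ0 y hy]
      refine le_trans ?_ (add_le_add h1 h2)
      rw [← ENNReal.ofReal_add (by positivity) (by positivity)]
      apply ENNReal.ofReal_le_ofReal
      rw [← add_div, ← mul_add]
      gcongr
      exact abs_sub _ _
  have hmB : Measurable (B.indicator (1 : RN N → ℝ≥0∞)) := measurable_ball_indicator_one r
  have hm1 : Measurable T₁ := (measurable_gdens hw).indicator hmB'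
  have hm2 : Measurable T₂ := measurable_gdens hφ
  have hm3 : Measurable T₃ :=
    ((hmB.comp measurable_fst).mul (hgm.comp measurable_snd)).const_mul _
  rw [HasFiniteIntegral]
  refine (lintegral_mono hpt).trans_lt ?_
  rw [lintegral_add_left hm1, lintegral_add_left hm2, lintegral_add_left hm3]
  simp only [hT₁, hT₂, hT₃, hT₄]
  rw [lintegral_const_mul' _ _ hc.ne, lintegral_const_mul' _ _ hc.ne,
    lintegral_tensor hmB hgm, lintegral_tensor' hmB hgm, lintegral_indicator hmB']
  have i1 := lintegral_indicator_one_ball_lt_top (N := N) r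
  have i34 := ENNReal.mul_lt_top hc (ENNReal.mul_lt_top i1 hgi)
  rw [genergy, univ_prod_univ, Measure.restrict_univ] at hφg
  exact ENNReal.add_lt_top.2 ⟨hwg, ENNReal.add_lt_top.2 ⟨hφg, ENNReal.add_lt_top.2 ⟨i34, i34⟩⟩⟩

lemma abs_le_one_of_mem_sgn {t z : ℝ} (h : z ∈ sgn t) : |z| ≤ 1 := by
  obtain ⟨h1, h2, h3⟩ := h
  rcases lt_trichotomy t 0 with ht | ht | ht
  · simp [h2 ht]
  · exact abs_le.2 (h3 ht)
  · simp [h1 ht]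

/-- Of two strictly ordered arguments, either the larger is positive or the smaller is negative, and
there the selection takes an extreme value. This is the only structural property of the 1-Laplacian
that the energy estimate uses, and it is independent of the choice made at zero. -/
lemma sgn_mono {a b y z : ℝ} (hy : y ∈ sgn a) (hz : z ∈ sgn b) (hab : b < a) : z ≤ y := by
  have hy1 := abs_le.1 (abs_le_one_of_mem_sgn hy)
  have hz1 := abs_le.1 (abs_le_one_of_mem_sgn hz)
  rcases lt_or_ge 0 a with h | h
  · rw [hy.1 h]; exact hz1.2
  · rw [hz.2.1 (by linarith)]; exact hy1.1

lemma integrable_sign_interaction {s₁ : ℝ} {Z : RN N × RN N → ℝ} {φ : RN N → ℝ}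
    (hZ : AEMeasurable Z) (hZ1 : ∀ᵐ z, |Z z| ≤ 1) (hφ : Measurable φ)
    (hφg : genergy s₁ 1 univ φ < ∞) :
    Integrable (fun z : RN N × RN N => Z z * (φ z.1 - φ z.2) /
      ‖z.1 - z.2‖ ^ ((N : ℝ) + s₁)) := by
  have hmeas : Measurable (fun z : RN N × RN N => (φ z.1 - φ z.2) /
      ‖z.1 - z.2‖ ^ ((N : ℝ) + s₁)) := by fun_prop
  have hi : Integrable (fun z : RN N × RN N => (φ z.1 - φ z.2) /
      ‖z.1 - z.2‖ ^ ((N : ℝ) + s₁)) := by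
    refine ⟨hmeas.aestronglyMeasurable, ?_⟩
    rw [genergy, univ_prod_univ, Measure.restrict_univ] at hφg
    refine lt_of_le_of_lt (lintegral_mono fun z => ?_) hφg
    rw [Real.enorm_eq_ofReal_abs, abs_div, gdens, Real.rpow_one, mul_one,
      abs_of_nonneg (a := ‖z.1 - z.2‖ ^ _) (by positivity)]
  have := hi.bdd_mul (c := 1) hZ.aestronglyMeasurable (by simpa using hZ1)
  simpa [mul_div_assoc] using this

lemma genergy_le_of_abs_sub_le {s q L : ℝ} (hq : 0 ≤ q) (hL : 0 ≤ L) {V : Set (RN N)}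
    (hV : MeasurableSet V) {ψ A : RN N → ℝ}
    (h : ∀ x ∈ V, ∀ y ∈ V, |ψ x - ψ y| ≤ L * |A x - A y|) :
    genergy s q V ψ ≤ ENNReal.ofReal (L ^ q) * genergy s q V A := by
  rw [genergy, genergy, ← lintegral_const_mul' _ _ ENNReal.ofReal_ne_top]
  refine setLIntegral_mono' (hV.prod hV) fun z hz => ?_
  rw [gdens, gdens, ← ENNReal.ofReal_mul (by positivity), ← mul_div_assoc,
    ← Real.mul_rpow hL (abs_nonneg _)]
  apply ENNReal.ofReal_le_ofReal
  gcongr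
  exact h _ hz.1 _ hz.2

lemma abs_diff_le_two {v : RN N → ℝ} (hv : ∀ x ∈ Metric.ball (0 : RN N) 1, |v x| ≤ 1)
    {h x : RN N} {ρ : ℝ} (hx : x ∈ Metric.ball (0 : RN N) ρ) (hh : ρ + ‖h‖ ≤ 1) :
    |diff h v x| ≤ 2 := by
  have hx' : ‖x‖ < ρ := by simpa using hx
  have h1 : |v (x + h)| ≤ 1 := hv _ (by
    rw [mem_ball_zero_iff]; linarith [norm_add_le x h])
  have h2 : |v x| ≤ 1 := hv _ (by
    rw [mem_ball_zero_iff]; linarith [norm_nonneg h])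
  exact (abs_sub _ _).trans (by linarith)

lemma mem_ball_translate {x h : RN N} {r d : ℝ} (hx : x ∈ Metric.ball (0 : RN N) r)
    (hh : ‖h‖ < d) : x + h ∈ Metric.ball (0 : RN N) (r + d) := by
  rw [mem_ball_zero_iff] at hx ⊢
  linarith [norm_add_le x h]

/-! ### The test function and the differenced equation -/

/-- The test function for the difference quotient method. -/
noncomputable def testFun (a r d : ℝ) (A : RN N → ℝ) (x : RN N) : ℝ :=
  jpow a (A x) * cutoff r d x ^ 2

lemma measurable_testFun (a r d : ℝ) {A : RN N → ℝ} (hA : Measurable A) :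
    Measurable (testFun a r d A) :=
  ((measurable_jpow a).comp hA).mul ((measurable_cutoff r d).pow_const 2)

lemma testFun_eq_zero {a r d : ℝ} (hd : 0 < d) (A : RN N → ℝ) {x : RN N}
    (hx : x ∉ Metric.ball (0 : RN N) r) : testFun a r d A x = 0 := by
  simp [testFun, cutoff_eq_zero hd hx]

lemma abs_testFun_le {a r d : ℝ} (ha : 0 ≤ a) (A : RN N → ℝ) (x : RN N) :
    |testFun a r d A x| ≤ |A x| ^ (a + 1) := by
  rw [testFun, abs_mul, abs_jpow ha, abs_of_nonneg (sq_nonneg (cutoff r d x))]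
  have h0 := cutoff_nonneg r d x
  have h1 := cutoff_le_one r d x
  exact mul_le_of_le_one_right (by positivity) (by nlinarith)

lemma abs_testFun_le_const {a r d : ℝ} (ha : 0 ≤ a) (hd : 0 < d) {A : RN N → ℝ}
    (hA : ∀ x ∈ Metric.ball (0 : RN N) r, |A x| ≤ 2) (x : RN N) :
    |testFun a r d A x| ≤ 2 ^ (a + 1) := by
  by_cases hx : x ∈ Metric.ball (0 : RN N) r
  · exact (abs_testFun_le ha A x).trans
      (Real.rpow_le_rpow (abs_nonneg _) (hA x hx) (by linarith))
  · rw [testFun_eq_zero hd A hx, abs_zero]; positivity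

/-- On B_{r+d} the translation difference is bounded by 2, and the odd power is Lipschitz there. The
energy of its composition is therefore controlled by those of v and of its translate, and
multiplication by the squared cutoff preserves finiteness. It is used only to make the test function
admissible. -/
lemma genergy_testFun_lt_top (hN : 0 < N) {σ t a r d : ℝ} (hσ : σ ∈ Ioo (0 : ℝ) 1)
    (ht : 1 ≤ t) (ha : 0 ≤ a) (hd : 0 < d) (hd1 : d ≤ 1) (hr : r + 2 * d ≤ 1) {v : RN N → ℝ}
    (hv : Measurable v) (hv1 : ∀ x ∈ Metric.ball (0 : RN N) 1, |v x| ≤ 1)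
    (hvg : genergy σ t (Metric.ball 0 1) v < ∞) {h : RN N} (hh : ‖h‖ < d) :
    genergy σ t univ (testFun a r d (diff h v)) < ∞ := by
  have hA : ∀ x ∈ Metric.ball (0 : RN N) (r + d), |diff h v x| ≤ 2 := fun x hx =>
    abs_diff_le_two hv1 hx (by linarith)
  refine genergy_mul_cutoff_lt_top hN hσ ht (r := r) (d := d) (M := 2 ^ (a + 1)) (L := 2 / d)
    (by linarith) hd hd1 ((measurable_jpow a).comp (measurable_diff hv)) (by positivity)
    (by positivity) ?_ (fun x => sq_nonneg _) ?_ ?_ (abs_cutoff_sq_sub_le hd) ?_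
  · intro x hx
    rw [abs_jpow ha]
    exact Real.rpow_le_rpow (abs_nonneg _) (hA x hx) (by linarith)
  · intro x
    have h0 := cutoff_nonneg r d x
    have h1 := cutoff_le_one r d x
    nlinarith
  · intro x hx
    simp [cutoff_eq_zero hd hx]
  · refine (genergy_le_of_abs_sub_le (L := (a + 1) * 4 ^ a) (by linarith) (by positivity)
      Metric.isOpen_ball.measurableSet (A := diff h v) ?_).trans_lt ?_
    · intro x hx y hy
      refine (jpow_upper ha _ _).trans ?_
      rw [mul_assoc]
      gcongr
      linarith [hA x hx, hA y hy]
    · refine ENNReal.mul_lt_top ENNReal.ofReal_lt_top ?_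
      refine (genergy_sub_le (u := fun x => v (x + h)) (w := v) (by linarith)
        (hv.comp (measurable_id.add_const h))).trans_lt ?_
      refine ENNReal.mul_lt_top ENNReal.ofReal_lt_top (ENNReal.add_lt_top.2 ⟨?_, ?_⟩)
      · refine (genergy_translate (W := Metric.ball (0 : RN N) 1)
          Metric.isOpen_ball.measurableSet Metric.isOpen_ball.measurableSet ?_ v).trans_lt hvg
        intro x hx
        exact Metric.ball_subset_ball (by linarith) (mem_ball_translate hx hh)
      · exact (genergy_mono (Metric.ball_subset_ball (by linarith)) v).trans_lt hvg

lemma lintegral_tdens_translate {s p : ℝ} (hs : 0 ≤ s) (hp : 0 ≤ p) {h : RN N} (hh : ‖h‖ ≤ 1)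
    (v : RN N → ℝ) :
    ∫⁻ x, tdens s p (fun x => v (x + h)) x ≤
      ENNReal.ofReal (2 ^ ((N : ℝ) + s * p)) * ∫⁻ x, tdens s p v x := by
  rw [← lintegral_add_right_eq_self (tdens s p v) h,
    ← lintegral_const_mul' _ _ ENNReal.ofReal_ne_top]
  refine lintegral_mono fun x => ?_
  have hsp : 0 ≤ s * p := mul_nonneg hs hp
  rw [tdens, tdens, ← ENNReal.ofReal_mul (by positivity)]
  apply ENNReal.ofReal_le_ofReal
  rw [← mul_div_assoc, div_le_div_iff₀ (by positivity) (by positivity)]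
  have : (1 + ‖x + h‖) ^ ((N : ℝ) + s * p) ≤
      2 ^ ((N : ℝ) + s * p) * (1 + ‖x‖) ^ ((N : ℝ) + s * p) := by
    rw [← Real.mul_rpow (by norm_num) (by positivity)]
    exact Real.rpow_le_rpow (by positivity)
      (by linarith [norm_add_le x h, norm_nonneg x]) (by positivity)
  calc _ ≤ |v (x + h)| ^ (p - 1) * (2 ^ ((N : ℝ) + s * p) * (1 + ‖x‖) ^ ((N : ℝ) + s * p)) := by
        gcongr
    _ = _ := by ring

/-- The integrand of the differenced equation. -/
noncomputable def diffIntegrand (s₁ s p μ : ℝ) (v : RN N → ℝ) (Z : RN N × RN N → ℝ) (h : RN N)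
    (φ : RN N → ℝ) (z : RN N × RN N) : ℝ :=
  μ * ((Z (z + (h, h)) - Z z) * (φ z.1 - φ z.2) / ‖z.1 - z.2‖ ^ ((N : ℝ) + s₁)) +
    (jpow (p - 2) (v (z.1 + h) - v (z.2 + h)) - jpow (p - 2) (v z.1 - v z.2)) *
      (φ z.1 - φ z.2) / ‖z.1 - z.2‖ ^ ((N : ℝ) + s * p)

namespace IsUnitSolution

variable {s₁ s p μ : ℝ} {v : RN N → ℝ} {Z : RN N × RN N → ℝ}

lemma ae_sign_translate (hv : IsUnitSolution s₁ s p μ v Z) (h : RN N) :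
    ∀ᵐ z : RN N × RN N, Z (z + (h, h)) ∈ sgn (v (z.1 + h) - v (z.2 + h)) := by
  have := (measurePreserving_add_right (volume : Measure (RN N × RN N)) (h, h)
    ).quasiMeasurePreserving.ae hv.sign
  simpa using this

/-- The equation is tested with φ(· - h) and with φ. Translating both variables by h in the first
identity moves the shift onto v and Z and leaves the kernels unchanged; subtraction gives the claim.
The margin 2d keeps φ(· - h) supported inside the unit ball. -/
lemma integrable_diffIntegrand (hv : IsUnitSolution s₁ s p μ v Z) (hs : 0 < s) (hp : 2 ≤ p)
    {r d M : ℝ} (hd : 0 < d) (hd1 : d ≤ 1) (hr : r + 2 * d ≤ 1) {h : RN N} (hh : ‖h‖ < d)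
    {φ : RN N → ℝ} (hφ : Measurable φ) (hM : ∀ x, |φ x| ≤ M)
    (hφ0 : ∀ x ∉ Metric.ball (0 : RN N) r, φ x = 0)
    (hφ1 : genergy s₁ 1 univ φ < ∞) (hφp : genergy s p univ φ < ∞) :
    Integrable (diffIntegrand s₁ s p μ v Z h φ) ∧
      ∫ z, diffIntegrand s₁ s p μ v Z h φ z = 0 := by
  set τ := (h, h) with hτ
  have hZ1 : ∀ᵐ z, |Z z| ≤ 1 := hv.sign.mono fun z hz => abs_le_one_of_mem_sgn hz
  have hZ1' : ∀ᵐ z : RN N × RN N, |Z (z + τ)| ≤ 1 :=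
    (hv.ae_sign_translate h).mono fun z hz => abs_le_one_of_mem_sgn hz
  have hZm' : AEMeasurable (fun z : RN N × RN N => Z (z + τ)) :=
    hv.aemeasurable_sign.comp_quasiMeasurePreserving
      (measurePreserving_add_right (volume : Measure (RN N × RN N)) τ).quasiMeasurePreserving
  have i1 := integrable_sign_interaction hv.aemeasurable_sign hZ1 hφ hφ1
  have i2 := integrable_sign_interaction hZm' hZ1' hφ hφ1
  have i3 := integrable_interaction (w := v) (r := r) (d := d) hs hp (by linarith) hd hd1
    hv.measurable hφ hM
    (fun x hx => hv.abs_le_one x (Metric.ball_subset_ball (by linarith) hx)) hφ0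
    ((genergy_mono (Metric.ball_subset_ball (by linarith)) v).trans_lt
      (hv.genergy_le.trans_lt ENNReal.one_lt_top)) (hv.tail_le.trans_lt ENNReal.one_lt_top) hφp
  have i4 := integrable_interaction (w := fun x => v (x + h)) (r := r) (d := d) hs hp
    (by linarith) hd hd1 (hv.measurable.comp (measurable_id.add_const h)) hφ hM
    (fun x hx => hv.abs_le_one _ (Metric.ball_subset_ball (by linarith)
      (mem_ball_translate hx hh))) hφ0
    ((genergy_translate (W := Metric.ball (0 : RN N) 1) Metric.isOpen_ball.measurableSet
      Metric.isOpen_ball.measurableSet (fun x hx => Metric.ball_subset_ball (by linarith)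
        (mem_ball_translate hx hh)) v).trans_lt (hv.genergy_le.trans_lt ENNReal.one_lt_top))
    ((lintegral_tdens_translate hs.le (by linarith) (by linarith) v).trans_lt
      (ENNReal.mul_lt_top ENNReal.ofReal_lt_top (hv.tail_le.trans_lt ENNReal.one_lt_top))) hφp
  have e0 := hv.weak_eq φ hφ ⟨M, hM⟩ ⟨r, by linarith, hφ0⟩ hφ1 hφp
  have e1 := hv.weak_eq (fun x => φ (x - h)) (hφ.comp (measurable_id.sub_const h))
    ⟨M, fun x => hM _⟩ ⟨r + d, by linarith, fun x hx => hφ0 _ fun hx' => hx (by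
      simpa using mem_ball_translate hx' hh)⟩
    (lt_of_le_of_lt (by
      simpa [sub_eq_add_neg] using genergy_translate (h := -h) MeasurableSet.univ
        MeasurableSet.univ (fun x _ => mem_univ _) φ) hφ1)
    (lt_of_le_of_lt (by
      simpa [sub_eq_add_neg] using genergy_translate (h := -h) MeasurableSet.univ
        MeasurableSet.univ (fun x _ => mem_univ _) φ) hφp)
  rw [← integral_add_right_eq_self _ τ,
    ← integral_add_right_eq_self (fun z : RN N × RN N => jpow (p - 2) (v z.1 - v z.2) *
      (φ (z.1 - h) - φ (z.2 - h)) / ‖z.1 - z.2‖ ^ ((N : ℝ) + s * p)) τ] at e1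
  simp only [hτ, Prod.fst_add, Prod.snd_add, add_sub_cancel_right, add_sub_add_right_eq_sub]
    at e1
  have hdec : diffIntegrand s₁ s p μ v Z h φ = fun z =>
      (μ * (Z (z + τ) * (φ z.1 - φ z.2) / ‖z.1 - z.2‖ ^ ((N : ℝ) + s₁)) -
        μ * (Z z * (φ z.1 - φ z.2) / ‖z.1 - z.2‖ ^ ((N : ℝ) + s₁))) +
      (jpow (p - 2) (v (z.1 + h) - v (z.2 + h)) * (φ z.1 - φ z.2) /
          ‖z.1 - z.2‖ ^ ((N : ℝ) + s * p) -
        jpow (p - 2) (v z.1 - v z.2) * (φ z.1 - φ z.2) /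
          ‖z.1 - z.2‖ ^ ((N : ℝ) + s * p)) := by
    funext z
    simp only [diffIntegrand, hτ]
    ring
  have j1 := (i2.const_mul μ).sub (i1.const_mul μ)
  have j2 := i4.sub i3
  rw [hdec]
  refine ⟨j1.add j2, ?_⟩
  have k1 := integral_add j1 j2
  have k2 := integral_sub (i2.const_mul μ) (i1.const_mul μ)
  have k3 := integral_sub i4 i3
  simp only [Pi.sub_apply] at k1
  beta_reduce
  rw [k1, k2, k3, integral_const_mul, integral_const_mul]
  linarith

end IsUnitSolution

/-! ### The energy estimate for translation differences -/

/-- The positive and negative parts of I have equal finite integrals and cancel. Stating the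
pointwise bound with these parts in [0,∞] avoids assuming that G is integrable: finiteness of the
energy of the differences is a conclusion. -/
lemma lintegral_le_of_integral_eq_zero {α : Type*} [MeasurableSpace α] {ν : Measure α}
    {I : α → ℝ} (hI : Integrable I ν) (h0 : ∫ z, I z ∂ν = 0) {G E : α → ℝ≥0∞}
    (h : ∀ᵐ z ∂ν, G z + ENNReal.ofReal (-I z) ≤ ENNReal.ofReal (I z) + E z) :
    ∫⁻ z, G z ∂ν ≤ ∫⁻ z, E z ∂ν := by
  have hp : ∫⁻ z, ENNReal.ofReal (I z) ∂ν < ∞ := hI.lintegral_lt_top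
  have hn : ∫⁻ z, ENNReal.ofReal (-I z) ∂ν < ∞ := hI.neg.lintegral_lt_top
  have heq : ∫⁻ z, ENNReal.ofReal (I z) ∂ν = ∫⁻ z, ENNReal.ofReal (-I z) ∂ν := by
    rw [integral_eq_lintegral_pos_part_sub_lintegral_neg_part hI, sub_eq_zero] at h0
    exact (ENNReal.toReal_eq_toReal_iff' hp.ne hn.ne).1 h0
  have hm : AEMeasurable (fun z => ENNReal.ofReal (-I z)) ν :=
    hI.aemeasurable.neg.ennreal_ofReal
  have := lintegral_mono_ae h
  rw [lintegral_add_right' _ hm,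
    lintegral_add_left' hI.aemeasurable.ennreal_ofReal, heq, add_comm (∫⁻ z, G z ∂ν)] at this
  exact (ENNReal.add_le_add_iff_left hn.ne).1 this

lemma ofReal_add_ofReal_neg_le {a I R : ℝ} (ha : 0 ≤ a) (hR : 0 ≤ R) (h : a ≤ I + R) :
    ENNReal.ofReal a + ENNReal.ofReal (-I) ≤ ENNReal.ofReal I + ENNReal.ofReal R := by
  rcases le_total 0 I with hI | hI
  · rw [ENNReal.ofReal_of_nonpos (by linarith : -I ≤ 0), add_zero, ← ENNReal.ofReal_add hI hR]
    exact ENNReal.ofReal_le_ofReal h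
  · rw [ENNReal.ofReal_of_nonpos hI, zero_add, ← ENNReal.ofReal_add ha (by linarith)]
    exact ENNReal.ofReal_le_ofReal (by linarith)

lemma jpow_mono {a : ℝ} (ha : 0 ≤ a) {x y : ℝ} (h : x ≤ y) : jpow a x ≤ jpow a y := by
  rcases h.eq_or_lt with rfl | hlt
  · exact le_rfl
  have h1 := jpow_lower ha y x
  have h2 : 0 ≤ (|y| + |x|) ^ a * (y - x) ^ 2 := by positivity
  have h3 := h2.trans h1
  have h4 : 0 ≤ (jpow a y - jpow a x) * (y - x) := nonneg_of_mul_nonneg_right h3 (by positivity)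
  have h5 := nonneg_of_mul_nonneg_left h4 (by linarith : 0 < y - x)
  linarith

/-- The `1`-Laplacian part is monotone up to a cutoff error. -/
lemma sign_term_lower {q A B a b Y Z e f : ℝ} (hq : 0 ≤ q) (hY : Y ∈ sgn a) (hZ : Z ∈ sgn b)
    (hAB : A - B = a - b) (he : 0 ≤ e) (hf : 0 ≤ f) (he1 : e ≤ 1) (hf1 : f ≤ 1) :
    0 ≤ (Y - Z) * (jpow q A * e ^ 2 - jpow q B * f ^ 2) +
      2 * ((|A| ^ (q + 1) + |B| ^ (q + 1)) * |e - f|) := by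
  -- A - B has the sign of a - b, so both factors have the same sign. For A = B the second factor is
  -- zero and nothing is needed about the selections.
  have hmono : 0 ≤ (Y - Z) * (jpow q A - jpow q B) := by
    rcases lt_trichotomy A B with h | h | h
    · have h1 := sgn_mono hZ hY (by linarith)
      have h2 := jpow_mono hq h.le
      exact mul_nonneg_of_nonpos_of_nonpos (by linarith) (by linarith)
    · simp [h]
    · have h1 := sgn_mono hY hZ (by linarith)
      have h2 := jpow_mono hq h.le
      exact mul_nonneg (by linarith) (by linarith)
  have hYZ : |Y - Z| ≤ 2 := (abs_sub _ _).trans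
    (by linarith [abs_le_one_of_mem_sgn hY, abs_le_one_of_mem_sgn hZ])
  have hsplit : (Y - Z) * (jpow q A * e ^ 2 - jpow q B * f ^ 2) =
      (Y - Z) * (jpow q A - jpow q B) * ((e ^ 2 + f ^ 2) / 2) +
      (Y - Z) * (jpow q A + jpow q B) * ((e - f) * (e + f)) / 2 := by ring
  have h1 : 0 ≤ (Y - Z) * (jpow q A - jpow q B) * ((e ^ 2 + f ^ 2) / 2) := by positivity
  have h2 : |(Y - Z) * (jpow q A + jpow q B) * ((e - f) * (e + f)) / 2| ≤
      2 * ((|A| ^ (q + 1) + |B| ^ (q + 1)) * |e - f|) := by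
    rw [abs_div, abs_mul, abs_mul, abs_mul, abs_two]
    have h3 : |jpow q A + jpow q B| ≤ |A| ^ (q + 1) + |B| ^ (q + 1) := by
      rw [← abs_jpow hq, ← abs_jpow hq]; exact abs_add_le _ _
    have h4 : |e + f| ≤ 2 := by rw [abs_of_nonneg (by positivity)]; linarith
    calc |Y - Z| * |jpow q A + jpow q B| * (|e - f| * |e + f|) / 2
        ≤ 2 * (|A| ^ (q + 1) + |B| ^ (q + 1)) * (|e - f| * 2) / 2 := by gcongr
      _ = _ := by ring
  have h3 := neg_abs_le ((Y - Z) * (jpow q A + jpow q B) * ((e - f) * (e + f)) / 2)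
  rw [hsplit]
  linarith

/-- Combined lower bound near the diagonal for the differenced integrand. -/
lemma exists_near_lower {s₁ s p m₀ m γ d : ℝ} (hs : s ∈ Ioo (0 : ℝ) 1)
    (hp : 2 ≤ p) (hm₀ : p ≤ m₀) (hm : m₀ ≤ m) (hmm : m * (p - 2) ≤ m₀ * (p - 1))
    (hγ : 0 ≤ γ) (hd : 0 < d) (N : ℕ) :
    ∃ c C : ℝ, 0 < c ∧ 0 < C ∧ ∀ a b A B e f Y Z t H μ : ℝ, A - B = a - b →
      0 ≤ e → e ≤ 1 → 0 ≤ f → f ≤ 1 → |e - f| ≤ t / d → |A| ≤ 2 → |B| ≤ 2 → 0 < t → t ≤ 1 →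
      0 < H → H ≤ 1 → 0 ≤ μ → μ ≤ 1 → Y ∈ sgn a → Z ∈ sgn b →
      c * (|A - B| ^ m * (e ^ 2 + f ^ 2) / t ^ ((N : ℝ) + s * p)) ≤
        (μ * ((Y - Z) * (jpow (m - p) A * e ^ 2 - jpow (m - p) B * f ^ 2) / t ^ ((N : ℝ) + s₁)) +
          (jpow (p - 2) a - jpow (p - 2) b) *
            (jpow (m - p) A * e ^ 2 - jpow (m - p) B * f ^ 2) / t ^ ((N : ℝ) + s * p)) +
        (C * ((|A| ^ (m - p + 1) + |B| ^ (m - p + 1)) * (1 / t ^ ((N : ℝ) + (s₁ - 1)))) +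
          (C * (H ^ (γ * (m - p + 1)) * ((|a| ^ m₀ + |b| ^ m₀) / t ^ ((N : ℝ) + s * m₀))) +
          C * (H ^ (-(γ * (p - 1))) * ((|A| ^ m + |B| ^ m) *
            (1 / t ^ ((N : ℝ) + (2 * s - 2))))))) := by
  obtain ⟨c, K, hc, hK, hmain⟩ := exists_caccioppoli_pointwise hp (hm₀.trans hm)
  -- K comes from the pointwise Caccioppoli inequality, d⁻² from the Lipschitz bound on the cutoff,
  -- squared, and the power of 4 from Young's inequality.
  set K' := K / d ^ 2 * 4 ^ (m - p + 2) with hK'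
  have hK'0 : 0 < K' := by positivity
  refine ⟨c, 2 / d + K' * 2 ^ m₀ + K' * 2 ^ m, hc, by positivity, ?_⟩
  intro a b A B e f Y Z t H μ hAB he he1 hf hf1 hef hA hB ht ht1 hH hH1 hμ hμ1 hY hZ
  set C := 2 / d + K' * 2 ^ m₀ + K' * 2 ^ m with hC
  have h2d : 0 < 2 / d := by positivity
  have hKm₀ : 0 < K' * 2 ^ m₀ := by positivity
  have hKm : 0 < K' * 2 ^ m := by positivity
  set S := |A| + |B|
  set X := |a| + |b|
  have hm₀0 : 0 ≤ m₀ := by linarith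
  have hm0 : 0 ≤ m := by linarith
  -- the sign term
  have h1 := sign_term_lower (q := m - p) (by linarith) hY hZ hAB he hf he1 hf1
  set F := jpow (m - p) A * e ^ 2 - jpow (m - p) B * f ^ 2 with hF
  set P := |A| ^ (m - p + 1) + |B| ^ (m - p + 1) with hP
  have hP0 : 0 ≤ P := by positivity
  have ht1' : t / t ^ ((N : ℝ) + s₁) ≤ 1 / t ^ ((N : ℝ) + (s₁ - 1)) := by
    have := one_div_rpow_sub (n := N) ht.le one_pos s₁
    rwa [Real.rpow_one] at this
  have g1 : 0 ≤ μ * ((Y - Z) * F / t ^ ((N : ℝ) + s₁)) +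
      C * (P * (1 / t ^ ((N : ℝ) + (s₁ - 1)))) := by
    have h2 : 0 ≤ (Y - Z) * F + 2 / d * (P * t) := by
      have : 2 * (P * |e - f|) ≤ 2 / d * (P * t) := by
        calc 2 * (P * |e - f|) ≤ 2 * (P * (t / d)) := by gcongr
          _ = _ := by ring
      linarith
    have h3 : 0 ≤ μ * ((Y - Z) * F + 2 / d * (P * t)) / t ^ ((N : ℝ) + s₁) := by positivity
    have h4 : μ * (2 / d * (P * t)) / t ^ ((N : ℝ) + s₁) ≤
        C * (P * (1 / t ^ ((N : ℝ) + (s₁ - 1)))) := by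
      calc μ * (2 / d * (P * t)) / t ^ ((N : ℝ) + s₁)
          = μ * ((2 / d) * (P * (t / t ^ ((N : ℝ) + s₁)))) := by ring
        _ ≤ 1 * ((2 / d) * (P * (t / t ^ ((N : ℝ) + s₁)))) := by gcongr
        _ = (2 / d) * (P * (t / t ^ ((N : ℝ) + s₁))) := one_mul _
        _ ≤ C * (P * (1 / t ^ ((N : ℝ) + (s₁ - 1)))) := by
            gcongr
            rw [hC]; linarith
    have h5 : μ * ((Y - Z) * F + 2 / d * (P * t)) / t ^ ((N : ℝ) + s₁) =
        μ * ((Y - Z) * F / t ^ ((N : ℝ) + s₁)) + μ * (2 / d * (P * t)) / t ^ ((N : ℝ) + s₁) := by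
      ring
    linarith
  -- the `p`-term
  have h2 := hmain a b A B e f hAB he hf
  have hy := young_error_term (n := N) (s := s) hs hp hm₀ hm hmm hγ
    (X := X) (S := S) (by positivity) (by positivity) (by linarith) ht ht1 hH hH1
  have hXs : X ^ m₀ ≤ 2 ^ m₀ * (|a| ^ m₀ + |b| ^ m₀) :=
    add_rpow_le_two (abs_nonneg _) (abs_nonneg _) hm₀0
  have hSs : S ^ m ≤ 2 ^ m * (|A| ^ m + |B| ^ m) :=
    add_rpow_le_two (abs_nonneg _) (abs_nonneg _) hm0
  have hexp : (N : ℝ) - (2 - 2 * s) = N + (2 * s - 2) := by ring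
  rw [hexp] at hy
  have g2 : K * (X ^ (p - 2) * S ^ (m - p + 2) * (e - f) ^ 2) / t ^ ((N : ℝ) + s * p) ≤
      C * (H ^ (γ * (m - p + 1)) * ((|a| ^ m₀ + |b| ^ m₀) / t ^ ((N : ℝ) + s * m₀))) +
      C * (H ^ (-(γ * (p - 1))) * ((|A| ^ m + |B| ^ m) *
        (1 / t ^ ((N : ℝ) + (2 * s - 2))))) := by
    have e1 : (e - f) ^ 2 ≤ t ^ 2 / d ^ 2 := by
      rw [← sq_abs, ← div_pow]
      gcongr
    have e2 : t ^ 2 / t ^ ((N : ℝ) + s * p) = 1 / t ^ ((N : ℝ) + s * p - 2) := by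
      rw [Real.rpow_sub ht, Real.rpow_two, one_div_div]
    calc K * (X ^ (p - 2) * S ^ (m - p + 2) * (e - f) ^ 2) / t ^ ((N : ℝ) + s * p)
        ≤ K * (X ^ (p - 2) * S ^ (m - p + 2) * (t ^ 2 / d ^ 2)) / t ^ ((N : ℝ) + s * p) := by
          gcongr
      _ = K / d ^ 2 * (X ^ (p - 2) * S ^ (m - p + 2) * (t ^ 2 / t ^ ((N : ℝ) + s * p))) := by
          ring
      _ = K / d ^ 2 * (X ^ (p - 2) * S ^ (m - p + 2) / t ^ ((N : ℝ) + s * p - 2)) := by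
          rw [e2, mul_one_div]
      _ ≤ K / d ^ 2 * (4 ^ (m - p + 2) *
          (H ^ (γ * (m - p + 1)) * ((2 ^ m₀ * (|a| ^ m₀ + |b| ^ m₀)) / t ^ ((N : ℝ) + s * m₀)) +
          H ^ (-(γ * (p - 1))) * ((2 ^ m * (|A| ^ m + |B| ^ m)) /
            t ^ ((N : ℝ) + (2 * s - 2))))) := by
          refine mul_le_mul_of_nonneg_left (hy.trans ?_) (by positivity)
          gcongr
      _ = (K' * 2 ^ m₀) * (H ^ (γ * (m - p + 1)) *
            ((|a| ^ m₀ + |b| ^ m₀) / t ^ ((N : ℝ) + s * m₀))) +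
          (K' * 2 ^ m) * (H ^ (-(γ * (p - 1))) * ((|A| ^ m + |B| ^ m) *
            (1 / t ^ ((N : ℝ) + (2 * s - 2))))) := by
          rw [hK']; ring
      _ ≤ _ := by
          gcongr
          · rw [hC]; linarith
          · rw [hC]; linarith
  have g3 : c * (|A - B| ^ m * (e ^ 2 + f ^ 2) / t ^ ((N : ℝ) + s * p)) ≤
      (jpow (p - 2) a - jpow (p - 2) b) * F / t ^ ((N : ℝ) + s * p) +
        K * (X ^ (p - 2) * S ^ (m - p + 2) * (e - f) ^ 2) / t ^ ((N : ℝ) + s * p) := by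
    rw [← add_div, ← mul_div_assoc]
    gcongr
  linarith

/-- Bound for the differenced integrand far from the diagonal. -/
lemma ofReal_neg_diffIntegrand_far_le {s₁ s p μ d : ℝ} (hs₁ : 0 < s₁) (hs : 0 < s) (hp : 2 ≤ p)
    (hμ : μ ∈ Icc (0 : ℝ) 1) (hd : 0 < d) (hd1 : d ≤ 1) {v : RN N → ℝ} {Z : RN N × RN N → ℝ}
    {h : RN N} {φ : RN N → ℝ} {f : RN N → ℝ≥0∞} {x y : RN N}
    (hf : ∀ x, ENNReal.ofReal |φ x| ≤ f x)
    (hφ : ∀ x, φ x ≠ 0 → ‖x‖ ≤ 1 ∧ |v x| ≤ 1 ∧ |v (x + h)| ≤ 1)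
    (hZ : |Z ((x, y) + (h, h)) - Z (x, y)| ≤ 2) (hxy : d ≤ ‖x - y‖) :
    ENNReal.ofReal (-diffIntegrand s₁ s p μ v Z h φ (x, y)) ≤
      ENNReal.ofReal (2 * (3 / d) ^ ((N : ℝ) + s₁) + 2 ^ (p - 1) * (3 / d) ^ ((N : ℝ) + s * p)) *
        (f x * (weight s₁ y + ((weight (s * p) y + tdens s p v y) +
            (weight (s * p) y + tdens s p (fun y => v (y + h)) y))) +
          f y * (weight s₁ x + ((weight (s * p) x + tdens s p v x) +
            (weight (s * p) x + tdens s p (fun y => v (y + h)) x)))) := by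
  set κ₁ := 2 * (3 / d) ^ ((N : ℝ) + s₁)
  set κ₂ := 2 ^ (p - 1) * (3 / d) ^ ((N : ℝ) + s * p)
  have hκ₁ : 0 ≤ κ₁ := by positivity
  have hκ₂ : 0 ≤ κ₂ := by positivity
  -- By |φ(x) - φ(y)| ≤ |φ(x)| + |φ(y)| one point is treated at a time. Where φ(x) ≠ 0 the solution
  -- and its translate are bounded at x, so the interaction depends on y only through weights and
  -- tail densities.
  have hone : ∀ x y : RN N, d ≤ ‖x - y‖ →
      ENNReal.ofReal (|φ x| * (2 / ‖x - y‖ ^ ((N : ℝ) + s₁) +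
        (|v (x + h) - v (y + h)| ^ (p - 1) / ‖x - y‖ ^ ((N : ℝ) + s * p) +
          |v x - v y| ^ (p - 1) / ‖x - y‖ ^ ((N : ℝ) + s * p)))) ≤
      ENNReal.ofReal (κ₁ + κ₂) * (f x * (weight s₁ y + ((weight (s * p) y + tdens s p v y) +
            (weight (s * p) y + tdens s p (fun y => v (y + h)) y)))) := by
    intro x y hxy
    by_cases h0 : φ x = 0
    · simp [h0]
    obtain ⟨hx, hvx, hvx'⟩ := hφ x h0
    have h1 := far_interaction_le (N := N) (w := v) hs.le hp hd hd1 hx hvx hxy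
    have h2 := far_interaction_le (N := N) (w := fun y => v (y + h)) hs.le hp hd hd1 hx hvx' hxy
    have h3 : ENNReal.ofReal (2 / ‖x - y‖ ^ ((N : ℝ) + s₁)) ≤
        ENNReal.ofReal κ₁ * weight s₁ y := by
      rw [weight, ← ENNReal.ofReal_mul (by positivity)]
      apply ENNReal.ofReal_le_ofReal
      have := one_div_kern_far (N := N) hs₁.le hd hd1 hx hxy
      calc 2 / ‖x - y‖ ^ ((N : ℝ) + s₁) = 2 * (1 / ‖x - y‖ ^ ((N : ℝ) + s₁)) := by ring
        _ ≤ 2 * ((3 / d) ^ ((N : ℝ) + s₁) * (1 / (1 + ‖y‖) ^ ((N : ℝ) + s₁))) := by gcongr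
        _ = _ := by ring
    rw [ENNReal.ofReal_mul (abs_nonneg _), ENNReal.ofReal_add (by positivity) (by positivity),
      ENNReal.ofReal_add (by positivity) (by positivity), mul_left_comm]
    refine mul_le_mul' (hf x) ?_
    rw [mul_add, mul_add]
    have k1 : ENNReal.ofReal κ₁ ≤ ENNReal.ofReal (κ₁ + κ₂) :=
      ENNReal.ofReal_le_ofReal (by linarith)
    have k2 : ENNReal.ofReal κ₂ ≤ ENNReal.ofReal (κ₁ + κ₂) :=
      ENNReal.ofReal_le_ofReal (by linarith)
    refine add_le_add (h3.trans (mul_le_mul' k1 le_rfl)) ?_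
    rw [add_comm]
    exact add_le_add (h1.trans (mul_le_mul' k2 le_rfl)) (h2.trans (mul_le_mul' k2 le_rfl))
  rw [mul_add]
  refine le_trans ?_ (add_le_add (hone x y hxy) (hone y x (by rwa [norm_sub_rev])))
  rw [← ENNReal.ofReal_add (by positivity) (by positivity)]
  apply ENNReal.ofReal_le_ofReal
  rw [norm_sub_rev y x, abs_sub_comm (v (y + h)), abs_sub_comm (v y), ← add_mul]
  refine (neg_le_abs _).trans ((abs_add_le _ _).trans ?_)
  have hφxy := abs_sub (φ x) (φ y)
  have hp1 : p - 2 + 1 = p - 1 := by ring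
  have hJ : |jpow (p - 2) (v (x + h) - v (y + h)) - jpow (p - 2) (v x - v y)| ≤
      |v (x + h) - v (y + h)| ^ (p - 1) + |v x - v y| ^ (p - 1) := by
    rw [← hp1, ← abs_jpow (by linarith), ← abs_jpow (by linarith)]
    exact abs_sub _ _
  rw [mul_add]
  refine add_le_add ?_ ?_
  · rw [abs_mul, abs_of_nonneg hμ.1, abs_div, abs_mul,
      abs_of_nonneg (a := ‖(x, y).1 - (x, y).2‖ ^ _) (by positivity)]
    calc μ * (|Z ((x, y) + (h, h)) - Z (x, y)| * |φ x - φ y| / ‖x - y‖ ^ ((N : ℝ) + s₁))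
        ≤ 1 * (2 * (|φ x| + |φ y|) / ‖x - y‖ ^ ((N : ℝ) + s₁)) := by
          gcongr
          exact hμ.2
      _ = _ := by ring
  · rw [abs_div, abs_mul, abs_of_nonneg (a := ‖(x, y).1 - (x, y).2‖ ^ _) (by positivity)]
    calc |jpow (p - 2) (v (x + h) - v (y + h)) - jpow (p - 2) (v x - v y)| * |φ x - φ y| /
          ‖x - y‖ ^ ((N : ℝ) + s * p)
        ≤ (|v (x + h) - v (y + h)| ^ (p - 1) + |v x - v y| ^ (p - 1)) * (|φ x| + |φ y|) /
          ‖x - y‖ ^ ((N : ℝ) + s * p) := by gcongr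
      _ = _ := by ring

/-- The part near the diagonal of the energy of a translation difference. -/
noncomputable def nearEnergy (s p m r d : ℝ) (A : RN N → ℝ) : ℝ≥0∞ :=
  ∫⁻ z : RN N × RN N, {z : RN N × RN N | z.1 ∈ Metric.ball (0 : RN N) r ∧ ‖z.1 - z.2‖ < d}.indicator
    (fun z => ENNReal.ofReal (|A z.1 - A z.2| ^ m / ‖z.1 - z.2‖ ^ ((N : ℝ) + s * p))) z

lemma lintegral_mul_conv_add {f k : RN N → ℝ≥0∞} (hf : Measurable f) (hk : Measurable k) :
    ∫⁻ z : RN N × RN N, (f z.1 * k (z.1 - z.2) + f z.2 * k (z.1 - z.2)) =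
      (∫⁻ x, f x) * (∫⁻ w, k w) + (∫⁻ x, f x) * ∫⁻ w, k w := by
  rw [lintegral_add_left (by fun_prop), lintegral_mul_conv hf hk, lintegral_mul_conv' hf hk]

lemma lintegral_tensor_add {f g : RN N → ℝ≥0∞} (hf : Measurable f) (hg : Measurable g) :
    ∫⁻ z : RN N × RN N, (f z.1 * g z.2 + f z.2 * g z.1) =
      (∫⁻ x, f x) * (∫⁻ y, g y) + (∫⁻ x, f x) * ∫⁻ y, g y := by
  rw [lintegral_add_left (by fun_prop), lintegral_tensor hf hg, lintegral_tensor' hf hg]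

set_option maxHeartbeats 1000000 in
/-- The energy estimate for translation differences. -/
theorem exists_nearEnergy_le (hN : 0 < N) {s₁ s p m₀ m γ ρ d : ℝ} (hs₁ : s₁ ∈ Ioo (0 : ℝ) 1)
    (hs : s ∈ Ioo (0 : ℝ) 1) (hp : 2 ≤ p) (hm₀ : p ≤ m₀) (hm : m₀ ≤ m)
    (hmm : m * (p - 2) ≤ m₀ * (p - 1)) (hγ : 0 ≤ γ) (hd : 0 < d)
    (hρd : ρ + 5 * d ≤ 1) (hρ : 0 < ρ) {Cg Cd : ℝ≥0∞} (hCg : Cg < ∞) (hCd : Cd < ∞) :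
    ∃ C : ℝ≥0∞, C < ∞ ∧ ∀ μ ∈ Icc (0 : ℝ) 1, ∀ (v : RN N → ℝ) (Z : RN N × RN N → ℝ),
      IsUnitSolution s₁ s p μ v Z → genergy s m₀ (Metric.ball 0 (ρ + 5 * d)) v ≤ Cg →
      ∀ h : RN N, 0 < ‖h‖ → ‖h‖ < d →
      ∫⁻ x in Metric.ball (0 : RN N) (ρ + 4 * d), ENNReal.ofReal (|diff h v x| ^ m) ≤
        Cd * ENNReal.ofReal (‖h‖ ^ (γ * m)) →
      nearEnergy s p m (ρ + 2 * d) d (diff h v) ≤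
        C * ENNReal.ofReal (‖h‖ ^ (γ * (m - p + 1))) := by
  obtain ⟨c, C, hc, hC, hnear⟩ := exists_near_lower (s₁ := s₁) hs hp hm₀ hm hmm hγ hd N
  have hd1 : d ≤ 1 := by linarith
  have hsp : 0 < s * p := mul_pos hs.1 (by linarith)
  set κ := 2 * (3 / d) ^ ((N : ℝ) + s₁) + 2 ^ (p - 1) * (3 / d) ^ ((N : ℝ) + s * p) with hκ
  -- Nested radii: the cutoff equals one on the ball of radius ρ+2d, where the energy is measured,
  -- and vanishes outside radius ρ+3d. Pairs closer than d that touch this support lie in radius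
  -- ρ+4d, and translating by h stays in radius ρ+5d.
  set r := ρ + 3 * d with hr
  set B' := Metric.ball (0 : RN N) (ρ + 4 * d) with hB'
  have hmB : MeasurableSet B' := Metric.isOpen_ball.measurableSet
  have hmBB : MeasurableSet (B' ×ˢ B') := hmB.prod hmB
  set nk₁ := (Metric.ball (0 : RN N) 1).indicator (kern (s₁ - 1)) with hnk₁
  set nk₂ := (Metric.ball (0 : RN N) 1).indicator (kern (2 * s - 2)) with hnk₂
  have hmk₁ : Measurable nk₁ := measurable_near_kern _
  have hmk₂ : Measurable nk₂ := measurable_near_kern _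
  set k₁ := ∫⁻ w, nk₁ w with hk₁
  set k₂ := ∫⁻ w, nk₂ w with hk₂
  have hk₁' : k₁ < ∞ := lintegral_near_kern_lt_top hN (by linarith [hs₁.2])
  have hk₂' : k₂ < ∞ := lintegral_near_kern_lt_top hN (by linarith [hs.2])
  set W₁ := ∫⁻ y : RN N, weight s₁ y with hW₁
  set W₂ := ∫⁻ y : RN N, weight (s * p) y with hW₂
  have hW₁' : W₁ < ∞ := lintegral_weight_lt_top hs₁.1
  have hW₂' : W₂ < ∞ := lintegral_weight_lt_top hsp
  set V := volume B' with hV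
  have hV' : V < ∞ := measure_ball_lt_top
  set G₀ := W₁ + ((W₂ + 1) + (W₂ + ENNReal.ofReal (2 ^ ((N : ℝ) + s * p)))) with hG₀
  have hG₀' : G₀ < ∞ := by
    simp only [hG₀, ENNReal.add_lt_top]
    exact ⟨hW₁', ⟨hW₂', ENNReal.one_lt_top⟩, hW₂', ENNReal.ofReal_lt_top⟩
  set Ct := ENNReal.ofReal C * ((V + Cd) * k₁ + (V + Cd) * k₁) +
    (ENNReal.ofReal C * (Cg + Cg) + (ENNReal.ofReal C * (Cd * k₂ + Cd * k₂) +
      ENNReal.ofReal κ * ((V + Cd) * G₀ + (V + Cd) * G₀))) with hCt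
  have hCt' : Ct < ∞ := by
    have h1 : V + Cd < ∞ := ENNReal.add_lt_top.2 ⟨hV', hCd⟩
    have h2 := ENNReal.mul_lt_top h1 hk₁'
    have h3 := ENNReal.mul_lt_top h1 hG₀'
    have h4 := ENNReal.mul_lt_top hCd hk₂'
    simp only [hCt, ENNReal.add_lt_top]
    exact ⟨ENNReal.mul_lt_top ENNReal.ofReal_lt_top (ENNReal.add_lt_top.2 ⟨h2, h2⟩),
      ENNReal.mul_lt_top ENNReal.ofReal_lt_top (ENNReal.add_lt_top.2 ⟨hCg, hCg⟩),
      ENNReal.mul_lt_top ENNReal.ofReal_lt_top (ENNReal.add_lt_top.2 ⟨h4, h4⟩),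
      ENNReal.mul_lt_top ENNReal.ofReal_lt_top (ENNReal.add_lt_top.2 ⟨h3, h3⟩)⟩
  refine ⟨ENNReal.ofReal (1 / c) * Ct, ENNReal.mul_lt_top ENNReal.ofReal_lt_top hCt', ?_⟩
  intro μ hμ v Z hv hvg h hh0 hhd hvd
  set H := ‖h‖ with hH
  have hH1 : H ≤ 1 := by linarith
  set A := diff h v with hA
  have hAm : Measurable A := measurable_diff hv.measurable
  set vh : RN N → ℝ := fun x => v (x + h) with hvh
  have hvhm : Measurable vh := hv.measurable.comp (measurable_id.add_const h)
  set φ := testFun (m - p) r d A with hφ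
  have hmp : 0 ≤ m - p := by linarith
  have hA2 : ∀ x ∈ B', |A x| ≤ 2 := fun x hx => abs_diff_le_two hv.abs_le_one hx (by linarith)
  have hrB : Metric.ball (0 : RN N) r ⊆ B' := Metric.ball_subset_ball (by linarith)
  obtain ⟨hI, hI0⟩ := hv.integrable_diffIntegrand hs.1 hp (r := r) (d := d)
    (M := 2 ^ (m - p + 1)) hd hd1 (by linarith) hhd (φ := φ)
    (measurable_testFun _ _ _ hAm)
    (abs_testFun_le_const hmp hd fun x hx => hA2 x (hrB hx))
    (fun x hx => testFun_eq_zero hd A hx)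
    (genergy_testFun_lt_top hN hs₁ le_rfl hmp hd hd1 (by linarith) hv.measurable hv.abs_le_one
      hv.genergy_one hhd)
    (genergy_testFun_lt_top hN hs (by linarith) hmp hd hd1 (by linarith) hv.measurable
      hv.abs_le_one (hv.genergy_le.trans_lt ENNReal.one_lt_top) hhd)
  set f : RN N → ℝ≥0∞ := B'.indicator (fun x => ENNReal.ofReal (|A x| ^ (m - p + 1))) with hf
  set F : RN N → ℝ≥0∞ := B'.indicator (fun x => ENNReal.ofReal (|A x| ^ m)) with hF
  have hfm : Measurable f := Measurable.indicator (by fun_prop) hmB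
  have hFm : Measurable F := Measurable.indicator (by fun_prop) hmB
  set g : RN N → ℝ≥0∞ := fun y => weight s₁ y + ((weight (s * p) y + tdens s p v y) +
            (weight (s * p) y + tdens s p vh y)) with hg
  have hgm : Measurable g := (measurable_weight _).add
    (((measurable_weight _).add (measurable_tdens hv.measurable)).add
      ((measurable_weight _).add (measurable_tdens hvhm)))
  set Hp := ENNReal.ofReal (H ^ (γ * (m - p + 1))) with hHp
  set Hn := ENNReal.ofReal (H ^ (-(γ * (p - 1)))) with hHn
  -- E₁ is the cutoff error of the sign term, E₂ and E₃ are the two sides of Young's inequality in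
  -- the p-term, and E₄ is the interaction far from the diagonal.
  set E₁ : RN N × RN N → ℝ≥0∞ := fun z => ENNReal.ofReal C *
    (f z.1 * nk₁ (z.1 - z.2) + f z.2 * nk₁ (z.1 - z.2)) with hE₁
  set E₂ : RN N × RN N → ℝ≥0∞ := fun z => ENNReal.ofReal C *
    (Hp * (B' ×ˢ B').indicator (fun z => gdens s m₀ vh z + gdens s m₀ v z) z) with hE₂
  set E₃ : RN N × RN N → ℝ≥0∞ := fun z => ENNReal.ofReal C *
    (Hn * (F z.1 * nk₂ (z.1 - z.2) + F z.2 * nk₂ (z.1 - z.2))) with hE₃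
  set E₄ : RN N × RN N → ℝ≥0∞ := fun z => ENNReal.ofReal κ *
    (f z.1 * g z.2 + f z.2 * g z.1) with hE₄
  set D : Set (RN N × RN N) :=
    {z | z.1 ∈ Metric.ball (0 : RN N) (ρ + 2 * d) ∧ ‖z.1 - z.2‖ < d} with hD
  set G : RN N × RN N → ℝ≥0∞ := fun z => ENNReal.ofReal c * D.indicator
    (fun z => ENNReal.ofReal (|A z.1 - A z.2| ^ m / ‖z.1 - z.2‖ ^ ((N : ℝ) + s * p))) z with hG
  -- pointwise estimate
  have hpt : ∀ᵐ z : RN N × RN N, G z + ENNReal.ofReal (-diffIntegrand s₁ s p μ v Z h φ z) ≤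
      ENNReal.ofReal (diffIntegrand s₁ s p μ v Z h φ z) + (E₁ z + (E₂ z + (E₃ z + E₄ z))) := by
    filter_upwards [hv.sign, hv.ae_sign_translate h] with z hz1 hz2
    obtain ⟨x, y⟩ := z
    rcases lt_or_ge ‖x - y‖ d with hn | hfar
    · rcases eq_or_ne x y with rfl | hxy
      · have : G (x, x) = 0 := by
          simp [hG, Real.zero_rpow (by linarith : m ≠ 0)]
        rw [this, zero_add]
        simp [diffIntegrand]
      by_cases hxyB : x ∈ Metric.ball (0 : RN N) r ∨ y ∈ Metric.ball (0 : RN N) r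
      · have hr4 : r + d = ρ + 4 * d := by rw [hr]; ring
        have hx : x ∈ B' := by
          rcases hxyB with h | h
          · exact hrB h
          · have := mem_ball_add h (by rwa [norm_sub_rev] : ‖y - x‖ < d)
            rwa [hr4] at this
        have hy : y ∈ B' := by
          rcases hxyB with h | h
          · have := mem_ball_add h hn
            rwa [hr4] at this
          · exact hrB h
        set t := ‖x - y‖ with ht
        have ht0 : 0 < t := norm_pos_iff.2 (sub_ne_zero.2 hxy)
        set e := cutoff r d x with he
        set e' := cutoff r d y with he'
        have key := hnear (v (x + h) - v (y + h)) (v x - v y) (A x) (A y) e e'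
          (Z ((x, y) + (h, h))) (Z (x, y)) t H μ (by simp only [hA, diff]; ring)
          (cutoff_nonneg _ _ _) (cutoff_le_one _ _ _) (cutoff_nonneg _ _ _) (cutoff_le_one _ _ _)
          (abs_cutoff_sub_le hd x y) (hA2 x hx) (hA2 y hy) ht0 (by linarith) hh0 hH1 hμ.1 hμ.2
          hz2 hz1
        set R₁ := C * ((|A x| ^ (m - p + 1) + |A y| ^ (m - p + 1)) *
          (1 / t ^ ((N : ℝ) + (s₁ - 1)))) with hR₁
        set R₂ := C * (H ^ (γ * (m - p + 1)) * ((|v (x + h) - v (y + h)| ^ m₀ +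
          |v x - v y| ^ m₀) / t ^ ((N : ℝ) + s * m₀))) with hR₂
        set R₃ := C * (H ^ (-(γ * (p - 1))) * ((|A x| ^ m + |A y| ^ m) *
            (1 / t ^ ((N : ℝ) + (2 * s - 2))))) with hR₃
        have hR₁0 : 0 ≤ R₁ := by positivity
        have hR₂0 : 0 ≤ R₂ := by positivity
        have hR₃0 : 0 ≤ R₃ := by positivity
        have hIe : diffIntegrand s₁ s p μ v Z h φ (x, y) =
          μ * ((Z ((x, y) + (h, h)) - Z (x, y)) *
            (jpow (m - p) (A x) * e ^ 2 - jpow (m - p) (A y) * e' ^ 2) / t ^ ((N : ℝ) + s₁)) +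
          (jpow (p - 2) (v (x + h) - v (y + h)) - jpow (p - 2) (v x - v y)) *
            (jpow (m - p) (A x) * e ^ 2 - jpow (m - p) (A y) * e' ^ 2) /
              t ^ ((N : ℝ) + s * p) := rfl
        rw [← hIe] at key
        have hGle : G (x, y) ≤ ENNReal.ofReal (c * (|A x - A y| ^ m * (e ^ 2 + e' ^ 2) /
            t ^ ((N : ℝ) + s * p))) := by
          by_cases hD' : (x, y) ∈ D
          · simp only [hG, indicator_of_mem hD']
            rw [← ENNReal.ofReal_mul hc.le]
            apply ENNReal.ofReal_le_ofReal
            have hx2 : ‖x‖ < ρ + 2 * d := by simpa using hD'.1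
            have he1 : e = 1 := cutoff_eq_one hd (by rw [hr]; linarith)
            rw [he1]
            gcongr
            have : 0 ≤ |A x - A y| ^ m := by positivity
            nlinarith [sq_nonneg e']
          · simp [hG, hD']
        have hw : x - y ∈ Metric.ball (0 : RN N) 1 := by
          rw [mem_ball_zero_iff]; linarith
        have hz : (x, y) ∈ B' ×ˢ B' := ⟨hx, hy⟩
        have e₁ : ENNReal.ofReal R₁ = E₁ (x, y) := by
          simp only [hE₁, hf, hnk₁, indicator_of_mem hx, indicator_of_mem hy, indicator_of_mem hw,
            kern]
          rw [hR₁, ENNReal.ofReal_mul hC.le, ENNReal.ofReal_mul (by positivity),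
            ENNReal.ofReal_add (by positivity) (by positivity), add_mul]
        have e₂ : ENNReal.ofReal R₂ = E₂ (x, y) := by
          simp only [hE₂, indicator_of_mem hz, gdens]
          rw [hR₂, ENNReal.ofReal_mul hC.le, ENNReal.ofReal_mul (by positivity), add_div,
            ENNReal.ofReal_add (by positivity) (by positivity)]
        have e₃ : ENNReal.ofReal R₃ = E₃ (x, y) := by
          simp only [hE₃, hF, hnk₂, indicator_of_mem hx, indicator_of_mem hy, indicator_of_mem hw,
            kern]
          rw [hR₃, ENNReal.ofReal_mul hC.le, ENNReal.ofReal_mul (by positivity),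
            ENNReal.ofReal_mul (by positivity),
            ENNReal.ofReal_add (by positivity) (by positivity), add_mul]
        refine (add_le_add hGle le_rfl).trans ((ofReal_add_ofReal_neg_le (by positivity)
          (by positivity) key).trans (add_le_add le_rfl ?_))
        rw [ENNReal.ofReal_add hR₁0 (by positivity), ENNReal.ofReal_add hR₂0 hR₃0, e₁, e₂, e₃]
        exact add_le_add le_rfl (add_le_add le_rfl le_self_add)
      · push Not at hxyB
        have hD' : (x, y) ∉ D := fun hD' => hxyB.1 (Metric.ball_subset_ball (by linarith) hD'.1)
        have h1 : φ x = 0 := testFun_eq_zero hd A hxyB.1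
        have h2 : φ y = 0 := testFun_eq_zero hd A hxyB.2
        simp [hG, hD', diffIntegrand, h1, h2]
    · have hD' : (x, y) ∉ D := fun hD' => absurd hD'.2 (not_lt.2 hfar)
      have hG0 : G (x, y) = 0 := by simp [hG, hD']
      rw [hG0, zero_add]
      suffices hsuff : ENNReal.ofReal (-diffIntegrand s₁ s p μ v Z h φ (x, y)) ≤ E₄ (x, y) from
        hsuff.trans (le_add_self.trans (le_add_self.trans (le_add_self.trans le_add_self)))
      refine ofReal_neg_diffIntegrand_far_le hs₁.1 hs.1 hp hμ hd hd1 (f := f) ?_ ?_ ?_ hfar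
      · intro x
        by_cases hx : x ∈ B'
        · rw [hf, indicator_of_mem hx]
          exact ENNReal.ofReal_le_ofReal (abs_testFun_le hmp A x)
        · rw [hφ, testFun_eq_zero hd A (fun h => hx (hrB h))]
          simp
      · intro x hx
        have hx' : x ∈ Metric.ball (0 : RN N) r := by
          by_contra hx'
          exact hx (testFun_eq_zero hd A hx')
        have hx1 : ‖x‖ < r := by simpa using hx'
        exact ⟨by linarith, hv.abs_le_one x (Metric.ball_subset_ball (by linarith) hx'),
          hv.abs_le_one _ (Metric.ball_subset_ball (by linarith) (mem_ball_translate hx' hhd))⟩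
      · exact (abs_sub _ _).trans (by
          linarith [abs_le_one_of_mem_sgn hz1, abs_le_one_of_mem_sgn hz2])
  have hint := lintegral_le_of_integral_eq_zero hI hI0 hpt
  -- integrals of the error terms
  have hpow : H ^ (-(γ * (p - 1))) * H ^ (γ * m) = H ^ (γ * (m - p + 1)) := by
    rw [← Real.rpow_add hh0]; congr 1; ring
  have hFi : ∫⁻ x, F x ≤ Cd * ENNReal.ofReal (H ^ (γ * m)) := by
    rw [hF, lintegral_indicator hmB]; exact hvd
  -- The loss H^(-γ(p-1)) in Young's inequality, set against the assumed order H^(γm), leaves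
  -- exactly the power H^(γ(m-p+1)) of the conclusion.
  have hHF : Hn * ∫⁻ x, F x ≤ Cd * Hp := by
    calc Hn * ∫⁻ x, F x ≤ Hn * (Cd * ENNReal.ofReal (H ^ (γ * m))) := by gcongr
      _ = Cd * (Hn * ENNReal.ofReal (H ^ (γ * m))) := by ring
      _ = Cd * Hp := by rw [hHn, ← ENNReal.ofReal_mul (by positivity), hpow]
  have hfi : ∫⁻ x, f x ≤ (V + Cd) * Hp := by
    have h1 : ∀ x, f x ≤ B'.indicator (fun _ => Hp) x + Hn * F x := by
      intro x
      by_cases hx : x ∈ B'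
      · simp only [hf, hF, indicator_of_mem hx]
        rw [hHp, hHn, ← ENNReal.ofReal_mul (by positivity),
          ← ENNReal.ofReal_add (by positivity) (by positivity)]
        apply ENNReal.ofReal_le_ofReal
        have := rpow_le_split (A := |A x|) (H := H) (γ := γ) (m := m) (k := p - 1)
          (abs_nonneg _) hh0 (by linarith) (by linarith)
        rwa [show m - (p - 1) = m - p + 1 by ring] at this
      · simp [hf, hx]
    refine (lintegral_mono h1).trans ?_
    rw [lintegral_add_left (measurable_const.indicator hmB), lintegral_indicator hmB,
      lintegral_const, Measure.restrict_apply_univ,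
      lintegral_const_mul' _ _ ENNReal.ofReal_ne_top, add_mul, mul_comm Hp]
    exact add_le_add le_rfl hHF
  have hgi : ∫⁻ y, g y ≤ G₀ := by
    have hmv : Measurable (fun y => weight (s * p) y + tdens s p v y) :=
      (measurable_weight _).add (measurable_tdens hv.measurable)
    rw [hg, lintegral_add_left (measurable_weight _), lintegral_add_left hmv,
      lintegral_add_left (measurable_weight _), lintegral_add_left (measurable_weight _)]
    refine add_le_add le_rfl (add_le_add (add_le_add le_rfl hv.tail_le) (add_le_add le_rfl ?_))
    refine (lintegral_tdens_translate hs.1.le (by linarith) (by linarith) v).trans ?_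
    exact mul_le_of_le_one_right' hv.tail_le
  have hm1 : Measurable E₁ := by
    refine Measurable.const_mul ?_ _
    exact ((hfm.comp measurable_fst).mul (hmk₁.comp (measurable_fst.sub measurable_snd))).add
      ((hfm.comp measurable_snd).mul (hmk₁.comp (measurable_fst.sub measurable_snd)))
  have hm2 : Measurable E₂ := by
    refine Measurable.const_mul (Measurable.const_mul ?_ _) _
    exact ((measurable_gdens hvhm).add (measurable_gdens hv.measurable)).indicator hmBB
  have hm3 : Measurable E₃ := by
    refine Measurable.const_mul (Measurable.const_mul ?_ _) _
    exact ((hFm.comp measurable_fst).mul (hmk₂.comp (measurable_fst.sub measurable_snd))).add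
      ((hFm.comp measurable_snd).mul (hmk₂.comp (measurable_fst.sub measurable_snd)))
  have hi1 : ∫⁻ z, E₁ z ≤ ENNReal.ofReal C * ((V + Cd) * k₁ + (V + Cd) * k₁) * Hp := by
    rw [hE₁, lintegral_const_mul' _ _ ENNReal.ofReal_ne_top, lintegral_mul_conv_add hfm hmk₁]
    calc _ ≤ ENNReal.ofReal C * ((V + Cd) * Hp * k₁ + (V + Cd) * Hp * k₁) := by gcongr
      _ = _ := by ring
  have hi2 : ∫⁻ z, E₂ z ≤ ENNReal.ofReal C * (Cg + Cg) * Hp := by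
    rw [hE₂, lintegral_const_mul' _ _ ENNReal.ofReal_ne_top,
      lintegral_const_mul' _ _ ENNReal.ofReal_ne_top, lintegral_indicator hmBB,
      lintegral_add_left (measurable_gdens hvhm), mul_assoc, mul_comm Hp]
    refine mul_le_mul' le_rfl (mul_le_mul' (add_le_add ?_ ?_) le_rfl)
    · refine (genergy_translate hmB (Metric.isOpen_ball.measurableSet) ?_ v).trans hvg
      intro x hx
      have := mem_ball_translate hx hhd
      rwa [show ρ + 4 * d + d = ρ + 5 * d by ring] at this
    · exact (genergy_mono (Metric.ball_subset_ball (by linarith)) v).trans hvg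
  have hi3 : ∫⁻ z, E₃ z ≤ ENNReal.ofReal C * (Cd * k₂ + Cd * k₂) * Hp := by
    rw [hE₃, lintegral_const_mul' _ _ ENNReal.ofReal_ne_top,
      lintegral_const_mul' _ _ ENNReal.ofReal_ne_top, lintegral_mul_conv_add hFm hmk₂]
    calc ENNReal.ofReal C * (Hn * ((∫⁻ x, F x) * k₂ + (∫⁻ x, F x) * k₂))
        = ENNReal.ofReal C * ((Hn * ∫⁻ x, F x) * k₂ + (Hn * ∫⁻ x, F x) * k₂) := by ring
      _ ≤ ENNReal.ofReal C * (Cd * Hp * k₂ + Cd * Hp * k₂) := by gcongr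
      _ = _ := by ring
  have hi4 : ∫⁻ z, E₄ z ≤ ENNReal.ofReal κ * ((V + Cd) * G₀ + (V + Cd) * G₀) * Hp := by
    rw [hE₄, lintegral_const_mul' _ _ ENNReal.ofReal_ne_top, lintegral_tensor_add hfm hgm]
    calc _ ≤ ENNReal.ofReal κ * ((V + Cd) * Hp * G₀ + (V + Cd) * Hp * G₀) := by gcongr
      _ = _ := by ring
  have htot : ∫⁻ z, (E₁ z + (E₂ z + (E₃ z + E₄ z))) ≤ Ct * Hp := by
    rw [lintegral_add_left hm1, lintegral_add_left hm2, lintegral_add_left hm3]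
    refine (add_le_add hi1 (add_le_add hi2 (add_le_add hi3 hi4))).trans (le_of_eq ?_)
    rw [hCt]
    ring
  have hGi : ∫⁻ z, G z = ENNReal.ofReal c * nearEnergy s p m (ρ + 2 * d) d A := by
    rw [hG, lintegral_const_mul' _ _ ENNReal.ofReal_ne_top]; rfl
  calc nearEnergy s p m (ρ + 2 * d) d A
      = ENNReal.ofReal (1 / c) * (ENNReal.ofReal c * nearEnergy s p m (ρ + 2 * d) d A) := by
        rw [← mul_assoc, ← ENNReal.ofReal_mul (by positivity), one_div_mul_cancel hc.ne',
          ENNReal.ofReal_one, one_mul]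
    _ ≤ ENNReal.ofReal (1 / c) * (Ct * Hp) := by
        rw [← hGi]
        exact mul_le_mul' le_rfl (hint.trans htot)
    _ = _ := by rw [mul_assoc]

/-! ### From energies of differences to second and first differences -/

lemma volume_ball_zero (hN : 0 < N) {H : ℝ} (hH : 0 ≤ H) :
    volume (Metric.ball (0 : RN N) H) =
      ENNReal.ofReal (H ^ (N : ℝ)) * volume (Metric.ball (0 : RN N) 1) := by
  have : Nonempty (Fin N) := ⟨⟨0, hN⟩⟩
  rw [Measure.addHaar_ball _ _ hH, finrank_euclideanSpace, Fintype.card_fin, Real.rpow_natCast]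

/-- Differences in the direction `h` are controlled by the near-diagonal energy. -/
lemma exists_lintegral_diff_le (hN : 0 < N) {s p m ρ d : ℝ} (hsp : 0 < s * p) (hm : 0 < m) :
    ∃ C : ℝ≥0∞, C < ∞ ∧ ∀ A : RN N → ℝ, Measurable A → ∀ h : RN N, 0 < ‖h‖ → 2 * ‖h‖ < d →
      ∫⁻ x in Metric.ball (0 : RN N) ρ, ENNReal.ofReal (|diff h A x| ^ m) ≤
        C * (ENNReal.ofReal (‖h‖ ^ (s * p)) * nearEnergy s p m (ρ + 2 * d) d A) := by
  set V := volume (Metric.ball (0 : RN N) 1) with hV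
  have hV0 : V ≠ 0 := (Metric.measure_ball_pos volume _ one_pos).ne'
  have hVt : V ≠ ∞ := measure_ball_lt_top.ne
  set K : ℝ := 2 ^ m * (2 ^ ((N : ℝ) + s * p) + 1) with hK
  refine ⟨V⁻¹ * ENNReal.ofReal K,
    ENNReal.mul_lt_top (ENNReal.inv_lt_top.2 (pos_iff_ne_zero.2 hV0)) ENNReal.ofReal_lt_top, ?_⟩
  intro A hA h hh0 hhd
  set H := ‖h‖ with hH
  set B := Metric.ball (0 : RN N) ρ with hB
  have hmB : MeasurableSet B := Metric.isOpen_ball.measurableSet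
  set f : RN N → ℝ≥0∞ := B.indicator (fun x => ENNReal.ofReal (|diff h A x| ^ m)) with hf
  -- A(x+h) - A(x) is split through A(y) and averaged over y with |x-y| < H. Both distances are at
  -- most 2H < d, so each part costs a factor of order H^(N+sp) against the energy density. The
  -- volume of the averaging ball removes H^N and leaves H^(sp).
  set k : RN N → ℝ≥0∞ := (Metric.ball (0 : RN N) H).indicator 1 with hk
  set D : Set (RN N × RN N) :=
    {z | z.1 ∈ Metric.ball (0 : RN N) (ρ + 2 * d) ∧ ‖z.1 - z.2‖ < d} with hD
  set P : RN N × RN N → ℝ≥0∞ := D.indicator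
    (fun z => ENNReal.ofReal (|A z.1 - A z.2| ^ m / ‖z.1 - z.2‖ ^ ((N : ℝ) + s * p))) with hP
  have hDm : MeasurableSet D := by
    refine (measurable_fst Metric.isOpen_ball.measurableSet).inter ?_
    exact measurableSet_lt (f := fun z : RN N × RN N => ‖z.1 - z.2‖) (by fun_prop)
      measurable_const
  have hPm : Measurable P := Measurable.indicator (by fun_prop) hDm
  have hfm : Measurable f := by
    refine Measurable.indicator ?_ hmB
    have := measurable_diff (h := h) hA
    fun_prop
  have hkm : Measurable k := measurable_ball_indicator_one _
  have hPle : ∀ x y : RN N, ∀ t : ℝ, (x, y) ∈ D → ‖x - y‖ ≤ t →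
      ENNReal.ofReal (|A x - A y| ^ m) ≤ ENNReal.ofReal (t ^ ((N : ℝ) + s * p)) * P (x, y) := by
    intro x y t hxy ht
    rcases eq_or_ne x y with rfl | hne
    · simp [Real.zero_rpow hm.ne']
    have h0 : 0 < ‖x - y‖ := norm_pos_iff.2 (sub_ne_zero.2 hne)
    rw [hP, indicator_of_mem hxy, ← ENNReal.ofReal_mul (Real.rpow_nonneg (h0.le.trans ht) _)]
    apply ENNReal.ofReal_le_ofReal
    have h1 : ‖x - y‖ ^ ((N : ℝ) + s * p) ≤ t ^ ((N : ℝ) + s * p) :=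
      Real.rpow_le_rpow h0.le ht (by positivity)
    rw [← mul_div_assoc, le_div_iff₀ (by positivity), mul_comm]
    gcongr
  have hpt : ∀ z : RN N × RN N, f z.1 * k (z.1 - z.2) ≤
      ENNReal.ofReal (2 ^ m * (2 * H) ^ ((N : ℝ) + s * p)) * P (z + (h, 0)) +
        ENNReal.ofReal (2 ^ m * H ^ ((N : ℝ) + s * p)) * P z := by
    rintro ⟨x, y⟩
    by_cases hx : x ∈ B
    swap
    · simp [hf, hx]
    by_cases hy : x - y ∈ Metric.ball (0 : RN N) H
    swap
    · simp [hk, hy]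
    have hx' : ‖x‖ < ρ := by simpa [hB] using hx
    have hy' : ‖x - y‖ < H := by simpa using hy
    have h1 : (x, y) ∈ D := by
      refine ⟨?_, by simp only; linarith⟩
      rw [mem_ball_zero_iff]; simp only; linarith
    have hnorm : ‖x + h - y‖ ≤ 2 * H := by
      rw [show x + h - y = (x - y) + h by abel]
      exact (norm_add_le _ _).trans (by linarith)
    have h2 : (x + h, y) ∈ D := by
      refine ⟨?_, by simp only; linarith⟩
      rw [mem_ball_zero_iff]; simp only
      linarith [norm_add_le x h]
    simp only [hf, hk, indicator_of_mem hx, indicator_of_mem hy, Pi.one_apply, mul_one]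
    have e1 := hPle _ _ _ h2 hnorm
    have e2 := hPle _ _ _ h1 hy'.le
    rw [ENNReal.ofReal_mul (by positivity), ENNReal.ofReal_mul (by positivity), mul_assoc,
      mul_assoc, ← mul_add]
    simp only [Prod.mk_add_mk, add_zero]
    refine le_trans ?_ (mul_le_mul' le_rfl (add_le_add e1 e2))
    rw [← ENNReal.ofReal_add (by positivity) (by positivity),
      ← ENNReal.ofReal_mul (by positivity)]
    apply ENNReal.ofReal_le_ofReal
    have := abs_sub_rpow_le (A (x + h) - A y) (A x - A y) hm.le
    rwa [sub_sub_sub_cancel_right] at this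
  have hint := lintegral_mono (μ := volume) hpt
  rw [lintegral_mul_conv hfm hkm, lintegral_add_right _ (hPm.const_mul _),
    lintegral_const_mul' _ _ ENNReal.ofReal_ne_top,
    lintegral_const_mul' _ _ ENNReal.ofReal_ne_top,
    lintegral_add_right_eq_self P (h, (0 : RN N)), hf, lintegral_indicator hmB, hk,
    lintegral_indicator_one Metric.isOpen_ball.measurableSet, volume_ball_zero hN hh0.le,
    ← add_mul, ← ENNReal.ofReal_add (by positivity) (by positivity)] at hint
  have hconst : 2 ^ m * (2 * H) ^ ((N : ℝ) + s * p) + 2 ^ m * H ^ ((N : ℝ) + s * p) =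
      K * (H ^ (N : ℝ) * H ^ (s * p)) := by
    rw [Real.mul_rpow (by norm_num) hh0.le, Real.rpow_add hh0, hK]
    ring
  rw [hconst] at hint
  set J := ∫⁻ x in B, ENNReal.ofReal (|diff h A x| ^ m) with hJ
  have hHN : (0 : ℝ) < H ^ (N : ℝ) := by positivity
  set a := ENNReal.ofReal (H ^ (N : ℝ)) with ha
  have ha0 : a ≠ 0 := by simpa [ha] using hHN
  have hat : a ≠ ∞ := ENNReal.ofReal_ne_top
  have hK0 : 0 ≤ K := by positivity
  rw [ENNReal.ofReal_mul hK0, ENNReal.ofReal_mul hHN.le] at hint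
  calc J = (V⁻¹ * V) * (a⁻¹ * a) * J := by
        rw [ENNReal.inv_mul_cancel hV0 hVt, ENNReal.inv_mul_cancel ha0 hat, one_mul, one_mul]
    _ = V⁻¹ * a⁻¹ * (J * (a * V)) := by ring
    _ ≤ V⁻¹ * a⁻¹ * (ENNReal.ofReal K * (a * ENNReal.ofReal (H ^ (s * p))) * ∫⁻ z, P z) := by
        gcongr
    _ = (a⁻¹ * a) * (V⁻¹ * ENNReal.ofReal K * (ENNReal.ofReal (H ^ (s * p)) * ∫⁻ z, P z)) := by
        ring
    _ = _ := by rw [ENNReal.inv_mul_cancel ha0 hat, one_mul]; rfl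

/-- Dyadic iteration from second to first differences. -/
lemma dyadic_induction {E : Type*} [NormedAddCommGroup E] [NormedSpace ℝ E]
    {h₀ : ℝ} (hh₀ : 0 < h₀) {P : E → Prop} (hbase : ∀ h : E, h₀ ≤ ‖h‖ → ‖h‖ < 2 * h₀ → P h)
    (hstep : ∀ h : E, 0 < ‖h‖ → ‖h‖ < h₀ → P ((2 : ℝ) • h) → P h) (h : E) (hpos : 0 < ‖h‖)
    (hlt : ‖h‖ < 2 * h₀) : P h := by
  have key : ∀ n : ℕ, ∀ h : E, h₀ ≤ 2 ^ n * ‖h‖ → ‖h‖ < 2 * h₀ → P h := by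
    intro n
    induction n with
    | zero => intro h h1 h2; exact hbase h (by simpa using h1) h2
    | succ n ih =>
      intro h h1 h2
      rcases le_or_gt h₀ ‖h‖ with h3 | h3
      · exact hbase h h3 h2
      · have h4 : 0 < ‖h‖ := by
          by_contra h5
          have : ‖h‖ = 0 := le_antisymm (not_lt.1 h5) (norm_nonneg _)
          rw [this, mul_zero] at h1
          linarith
        refine hstep h h4 h3 (ih _ ?_ ?_)
        · rw [norm_smul, Real.norm_two, ← mul_assoc, ← pow_succ]; exact h1
        · rw [norm_smul, Real.norm_two]; linarith
  obtain ⟨n, hn⟩ := pow_unbounded_of_one_lt (h₀ / ‖h‖) (one_lt_two (α := ℝ))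
  refine key n h ?_ hlt
  rw [div_lt_iff₀ hpos] at hn
  exact hn.le

/-- Each halving of h multiplies the constant by 2^(γ-1) < 1 and adds K. The chosen C satisfies C
2^(γ-1) + K ≤ C and dominates the trivial bound at scale h₀. -/
lemma exists_first_difference_lt_one {h₀ M K γ : ℝ} (hh₀ : 0 < h₀) (hM : 0 ≤ M) (hK : 0 ≤ K)
    (hγ0 : 0 ≤ γ) (hγ : γ < 1) :
    ∃ C : ℝ, 0 ≤ C ∧ ∀ f : RN N → ℝ, (∀ h, ‖h‖ < 2 * h₀ → f h ≤ M) →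
      (∀ h, 0 < ‖h‖ → ‖h‖ < h₀ → f h ≤ f ((2 : ℝ) • h) / 2 + K * ‖h‖ ^ γ) →
      ∀ h, 0 < ‖h‖ → ‖h‖ < 2 * h₀ → f h ≤ C * ‖h‖ ^ γ := by
  have h2 : (2 : ℝ) ^ (γ - 1) < 1 := Real.rpow_lt_one_of_one_lt_of_neg (by norm_num) (by linarith)
  have h3 : 0 < 1 - (2 : ℝ) ^ (γ - 1) := by linarith
  refine ⟨M / h₀ ^ γ + K / (1 - 2 ^ (γ - 1)), by positivity, ?_⟩
  intro f hf hs h hpos hlt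
  set C := M / h₀ ^ γ + K / (1 - 2 ^ (γ - 1)) with hC
  refine dyadic_induction (P := fun h => f h ≤ C * ‖h‖ ^ γ) hh₀ ?_ ?_ h hpos hlt
  · intro h h1 h2
    refine (hf h h2).trans ?_
    have e1 : h₀ ^ γ ≤ ‖h‖ ^ γ := Real.rpow_le_rpow hh₀.le h1 hγ0
    have e2 : M / h₀ ^ γ ≤ C := by
      have : 0 ≤ K / (1 - 2 ^ (γ - 1)) := by positivity
      linarith
    calc M = M / h₀ ^ γ * h₀ ^ γ := by field_simp
      _ ≤ C * ‖h‖ ^ γ := by gcongr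
  · intro h h1 h2 ih
    refine (hs h h1 h2).trans ?_
    rw [norm_smul, Real.norm_two, Real.mul_rpow (by norm_num) h1.le] at ih
    have e1 : (2 : ℝ) ^ γ = 2 ^ (γ - 1) * 2 := by
      rw [← Real.rpow_add_one (by norm_num)]; congr 1; ring
    have e2 : K ≤ C * (1 - 2 ^ (γ - 1)) := by
      have : 0 ≤ M / h₀ ^ γ * (1 - 2 ^ (γ - 1)) := by positivity
      rw [hC, add_mul, div_mul_cancel₀ _ h3.ne']
      linarith
    have e3 : 0 ≤ ‖h‖ ^ γ := by positivity
    rw [e1] at ih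
    nlinarith

/-- The bound C|h| alone is not preserved under halving, as it leaves no room for K|h|^γ. The
stronger claim C|h| - L|h|^γ reproduces itself exactly when L(2^(γ-1) - 1) = K. -/
lemma exists_first_difference_gt_one {h₀ M K γ : ℝ} (hh₀ : 0 < h₀) (hM : 0 ≤ M) (hK : 0 ≤ K)
    (hγ : 1 < γ) :
    ∃ C : ℝ, 0 ≤ C ∧ ∀ f : RN N → ℝ, (∀ h, ‖h‖ < 2 * h₀ → f h ≤ M) →
      (∀ h, 0 < ‖h‖ → ‖h‖ < h₀ → f h ≤ f ((2 : ℝ) • h) / 2 + K * ‖h‖ ^ γ) →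
      ∀ h, 0 < ‖h‖ → ‖h‖ < 2 * h₀ → f h ≤ C * ‖h‖ := by
  have h2 : 1 < (2 : ℝ) ^ (γ - 1) := Real.one_lt_rpow (by norm_num) (by linarith)
  have h3 : 0 < (2 : ℝ) ^ (γ - 1) - 1 := by linarith
  set L := K / (2 ^ (γ - 1) - 1) with hL
  have hL0 : 0 ≤ L := by positivity
  set C := (M + L * (2 * h₀) ^ γ) / h₀ with hC
  have hC0 : 0 ≤ C := by positivity
  refine ⟨C, hC0, ?_⟩
  intro f hf hs h hpos hlt
  have : f h ≤ C * ‖h‖ - L * ‖h‖ ^ γ := by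
    refine dyadic_induction (P := fun h => f h ≤ C * ‖h‖ - L * ‖h‖ ^ γ) hh₀ ?_ ?_ h
      hpos hlt
    · intro h h1 h2
      refine (hf h h2).trans ?_
      have e1 : ‖h‖ ^ γ ≤ (2 * h₀) ^ γ :=
        Real.rpow_le_rpow (norm_nonneg _) h2.le (by linarith)
      have e2 : C * h₀ ≤ C * ‖h‖ := by gcongr
      have e3 : C * h₀ = M + L * (2 * h₀) ^ γ := by rw [hC]; field_simp
      have e4 : L * ‖h‖ ^ γ ≤ L * (2 * h₀) ^ γ := by gcongr
      linarith
    · intro h h1 h2 ih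
      refine (hs h h1 h2).trans ?_
      rw [norm_smul, Real.norm_two, Real.mul_rpow (by norm_num) h1.le] at ih
      have e1 : (2 : ℝ) ^ γ = 2 ^ (γ - 1) * 2 := by
        rw [← Real.rpow_add_one (by norm_num)]; congr 1; ring
      have e2 : K = L * (2 ^ (γ - 1) - 1) := by rw [hL]; field_simp
      rw [e1] at ih
      have e3 : K * ‖h‖ ^ γ = L * (2 ^ (γ - 1) - 1) * ‖h‖ ^ γ := by rw [← e2]
      linarith
  have : 0 ≤ L * ‖h‖ ^ γ := by positivity
  linarith

/-! ### Iteration in the order of differentiability and in the exponent -/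

/-- Uniform `L^m` bound of order `|h|^γ` for translation differences of unit solutions. -/
def DiffBound (N : ℕ) (s₁ s p m γ : ℝ) : Prop :=
  ∀ ρ ∈ Ioo (0 : ℝ) 1, ∃ C : ℝ≥0∞, C < ∞ ∧ ∀ μ ∈ Icc (0 : ℝ) 1, ∀ (v : RN N → ℝ)
    (Z : RN N × RN N → ℝ), IsUnitSolution s₁ s p μ v Z → ∀ h : RN N, 0 < ‖h‖ → ‖h‖ < 1 - ρ →
    ∫⁻ x in Metric.ball (0 : RN N) ρ, ENNReal.ofReal (|diff h v x| ^ m) ≤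
      C * ENNReal.ofReal (‖h‖ ^ (γ * m))

/-- Uniform interior bound of the `W^{s,m}` energy of unit solutions. -/
def EnergyBound (N : ℕ) (s₁ s p m : ℝ) : Prop :=
  ∀ ρ ∈ Ioo (0 : ℝ) 1, ∃ C : ℝ≥0∞, C < ∞ ∧ ∀ μ ∈ Icc (0 : ℝ) 1, ∀ (v : RN N → ℝ)
    (Z : RN N × RN N → ℝ), IsUnitSolution s₁ s p μ v Z →
    genergy s m (Metric.ball (0 : RN N) ρ) v ≤ C

lemma lintegral_diff_le_const {m ρ : ℝ} (hm : 0 ≤ m) (hρ : ρ ≤ 1) {v : RN N → ℝ}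
    (hv : ∀ x ∈ Metric.ball (0 : RN N) 1, |v x| ≤ 1) {h : RN N} (hh : ‖h‖ ≤ 1 - ρ) :
    ∫⁻ x in Metric.ball (0 : RN N) ρ, ENNReal.ofReal (|diff h v x| ^ m) ≤
      ENNReal.ofReal (2 ^ m) * volume (Metric.ball (0 : RN N) 1) := by
  calc _ ≤ ∫⁻ _ in Metric.ball (0 : RN N) ρ, ENNReal.ofReal (2 ^ m) := by
        refine setLIntegral_mono' Metric.isOpen_ball.measurableSet fun x hx => ?_
        apply ENNReal.ofReal_le_ofReal
        exact Real.rpow_le_rpow (abs_nonneg _) (abs_diff_le_two hv hx (by linarith)) hm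
    _ ≤ _ := by
        rw [lintegral_const, Measure.restrict_apply_univ]
        gcongr

lemma lintegral_ofReal_abs_rpow {α : Type*} [MeasurableSpace α] {ν : Measure α} {m : ℝ}
    (hm : 0 < m) (g : α → ℝ) :
    ∫⁻ x, ENNReal.ofReal (|g x| ^ m) ∂ν = eLpNorm g (ENNReal.ofReal m) ν ^ m := by
  rw [eLpNorm_eq_lintegral_rpow_enorm_toReal (by simpa using hm) ENNReal.ofReal_ne_top,
    ENNReal.toReal_ofReal hm.le, ← ENNReal.rpow_mul, one_div_mul_cancel hm.ne', ENNReal.rpow_one]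
  refine lintegral_congr fun x => ?_
  rw [Real.enorm_eq_ofReal_abs, ENNReal.ofReal_rpow_of_nonneg (abs_nonneg _) hm.le]

/-- At γ = 1 the dyadic sum would produce a logarithm. Hence the two alternatives: settle for an
order strictly below one, or start strictly above one and obtain order exactly one. -/
lemma exists_first_difference {h₀ M K γ γ' : ℝ} (hh₀ : 0 < h₀) (hh₁ : h₀ ≤ 1) (hM : 0 ≤ M)
    (hK : 0 ≤ K) (hcase : (0 ≤ γ' ∧ γ' < 1 ∧ γ' ≤ γ) ∨ (γ' = 1 ∧ 1 < γ)) :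
    ∃ C : ℝ, 0 ≤ C ∧ ∀ f : RN N → ℝ, (∀ h, ‖h‖ < 2 * h₀ → f h ≤ M) →
      (∀ h, 0 < ‖h‖ → ‖h‖ < h₀ → f h ≤ f ((2 : ℝ) • h) / 2 + K * ‖h‖ ^ γ) →
      ∀ h, 0 < ‖h‖ → ‖h‖ < 2 * h₀ → f h ≤ C * ‖h‖ ^ γ' := by
  rcases hcase with ⟨h1, h2, h3⟩ | ⟨rfl, h2⟩
  · obtain ⟨C, hC, hf⟩ := exists_first_difference_lt_one (N := N) hh₀ hM hK h1 h2
    refine ⟨C, hC, fun f hfM hs => hf f hfM fun h hpos hlt => (hs h hpos hlt).trans ?_⟩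
    have : ‖h‖ ^ γ ≤ ‖h‖ ^ γ' :=
      Real.rpow_le_rpow_of_exponent_ge hpos (by linarith) h3
    gcongr
  · obtain ⟨C, hC, hf⟩ := exists_first_difference_gt_one (N := N) hh₀ hM hK h2
    exact ⟨C, hC, fun f hfM hs h hpos hlt => by
      rw [Real.rpow_one]; exact hf f hfM hs h hpos hlt⟩

/-- From second differences to first differences in `L^m`. -/
lemma exists_lintegral_diff_le_of_second {m ρ d γ γ' : ℝ} (hm : 1 ≤ m) (hd : 0 < d)
    (hρ : 0 < ρ) (hρd : ρ + d ≤ 1) (hcase : (0 ≤ γ' ∧ γ' < 1 ∧ γ' ≤ γ) ∨ (γ' = 1 ∧ 1 < γ))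
    {K : ℝ≥0∞} (hK : K < ∞) :
    ∃ C : ℝ≥0∞, C < ∞ ∧ ∀ v : RN N → ℝ, Measurable v →
      (∀ x ∈ Metric.ball (0 : RN N) 1, |v x| ≤ 1) →
      (∀ h : RN N, 0 < ‖h‖ → 2 * ‖h‖ < d →
        ∫⁻ x in Metric.ball (0 : RN N) ρ, ENNReal.ofReal (|diff h (diff h v) x| ^ m) ≤
          K * ENNReal.ofReal (‖h‖ ^ (γ * m))) →
      ∀ h : RN N, 0 < ‖h‖ → ‖h‖ < 1 - ρ →
        ∫⁻ x in Metric.ball (0 : RN N) ρ, ENNReal.ofReal (|diff h v x| ^ m) ≤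
          C * ENNReal.ofReal (‖h‖ ^ (γ' * m)) := by
  have hm0 : 0 < m := by linarith
  have hγ'0 : 0 ≤ γ' := by
    rcases hcase with h | h
    · exact h.1
    · linarith [h.1]
  set M₀ : ℝ≥0∞ := ENNReal.ofReal (2 ^ m) * volume (Metric.ball (0 : RN N) 1) with hM₀
  have hM₀t : M₀ < ∞ := ENNReal.mul_lt_top ENNReal.ofReal_lt_top measure_ball_lt_top
  obtain ⟨C, hC, hf⟩ := exists_first_difference (N := N) (h₀ := d / 2)
    (M := (M₀ ^ (1 / m)).toReal) (K := (K ^ (1 / m)).toReal / 2) (by linarith) (by linarith)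
    ENNReal.toReal_nonneg (by positivity) hcase
  refine ⟨ENNReal.ofReal (C ^ m) + M₀ * ENNReal.ofReal (1 / d ^ (γ' * m)), ENNReal.add_lt_top.2
    ⟨ENNReal.ofReal_lt_top, ENNReal.mul_lt_top hM₀t ENNReal.ofReal_lt_top⟩, ?_⟩
  intro v hv hv1 hsec h hpos hlt
  set ν := volume.restrict (Metric.ball (0 : RN N) ρ)
  set P := ENNReal.ofReal m
  have hP1 : 1 ≤ P := by simpa [P] using hm
  have hle : ∀ h : RN N, ‖h‖ ≤ 1 - ρ → eLpNorm (diff h v) P ν ≤ M₀ ^ (1 / m) := by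
    intro h hh
    have := lintegral_diff_le_const hm0.le (by linarith) hv1 hh
    rw [lintegral_ofReal_abs_rpow hm0] at this
    rwa [one_div, ENNReal.le_rpow_inv_iff hm0]
  have hMt : M₀ ^ (1 / m) < ∞ := ENNReal.rpow_lt_top_of_nonneg (by positivity) hM₀t.ne
  have hKt : K ^ (1 / m) < ∞ := ENNReal.rpow_lt_top_of_nonneg (by positivity) hK.ne
  rcases lt_or_ge ‖h‖ d with hhd | hhd
  · have key := hf (fun h => (eLpNorm (diff h v) P ν).toReal) ?_ ?_ h hpos (by linarith)
    · have hfin : eLpNorm (diff h v) P ν ≠ ∞ := ((hle h hlt.le).trans_lt hMt).ne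
      rw [lintegral_ofReal_abs_rpow hm0]
      refine le_trans ?_ (mul_le_mul' le_self_add le_rfl)
      rw [← ENNReal.ofReal_mul (by positivity), Real.rpow_mul hpos.le,
        ← Real.mul_rpow hC (by positivity), ← ENNReal.ofReal_rpow_of_nonneg (by positivity) hm0.le]
      refine ENNReal.rpow_le_rpow ?_ hm0.le
      exact (ENNReal.le_ofReal_iff_toReal_le hfin (by positivity)).2 key
    · intro h hh
      exact ENNReal.toReal_mono hMt.ne (hle h (by linarith))
    · intro h hpos hh
      have h2 : ‖(2 : ℝ) • h‖ ≤ 1 - ρ := by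
        rw [norm_smul, Real.norm_two]; linarith
      -- The second difference is δ_{2h} v - 2 δ_h v. Taking L^m norms gives the doubling inequality
      -- required by the dyadic lemma.
      have hdec : diff h v = (2⁻¹ : ℝ) • (diff ((2 : ℝ) • h) v - diff h (diff h v)) := by
        funext x
        simp only [diff, Pi.smul_apply, Pi.sub_apply, smul_eq_mul, two_smul, ← add_assoc]
        ring
      have hs := hsec h hpos (by linarith)
      rw [lintegral_ofReal_abs_rpow hm0] at hs
      have hs' : eLpNorm (diff h (diff h v)) P ν ≤ K ^ (1 / m) * ENNReal.ofReal (‖h‖ ^ γ) := by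
        rw [← ENNReal.rpow_le_rpow_iff hm0]
        refine hs.trans (le_of_eq ?_)
        rw [ENNReal.mul_rpow_of_nonneg _ _ hm0.le, ← ENNReal.rpow_mul,
          one_div_mul_cancel hm0.ne', ENNReal.rpow_one,
          ENNReal.ofReal_rpow_of_nonneg (by positivity) hm0.le, Real.rpow_mul hpos.le]
      have h3 : eLpNorm (diff h v) P ν ≤ ENNReal.ofReal 2⁻¹ *
          (eLpNorm (diff ((2 : ℝ) • h) v) P ν + K ^ (1 / m) * ENNReal.ofReal (‖h‖ ^ γ)) := by
        conv_lhs => rw [hdec]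
        rw [eLpNorm_const_smul, Real.enorm_eq_ofReal (by norm_num)]
        gcongr
        refine (eLpNorm_sub_le ?_ ?_ hP1).trans (add_le_add le_rfl hs')
        · exact (measurable_diff hv).aestronglyMeasurable
        · exact (measurable_diff (measurable_diff hv)).aestronglyMeasurable
      have t1 : eLpNorm (diff ((2 : ℝ) • h) v) P ν ≠ ∞ := ((hle _ h2).trans_lt hMt).ne
      have t2 : K ^ (1 / m) * ENNReal.ofReal (‖h‖ ^ γ) ≠ ∞ :=
        (ENNReal.mul_lt_top hKt ENNReal.ofReal_lt_top).ne
      have h4 := ENNReal.toReal_mono (ENNReal.mul_lt_top ENNReal.ofReal_lt_top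
        (ENNReal.add_lt_top.2 ⟨t1.lt_top, t2.lt_top⟩)).ne h3
      rw [ENNReal.toReal_mul, ENNReal.toReal_add t1 t2, ENNReal.toReal_mul,
        ENNReal.toReal_ofReal (by norm_num), ENNReal.toReal_ofReal (by positivity)] at h4
      refine h4.trans (le_of_eq ?_)
      ring
  · refine (lintegral_diff_le_const hm0.le (by linarith) hv1 hlt.le).trans ?_
    refine le_trans ?_ (mul_le_mul' le_add_self le_rfl)
    rw [mul_assoc, ← ENNReal.ofReal_mul (by positivity)]
    refine le_mul_of_one_le_right' ?_
    rw [ENNReal.one_le_ofReal, one_div_mul_eq_div, one_le_div (by positivity)]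
    exact Real.rpow_le_rpow hd.le hhd (by positivity)

lemma diffBound_zero {s₁ s p m : ℝ} (hm : 0 ≤ m) : DiffBound N s₁ s p m 0 := by
  intro ρ hρ
  refine ⟨ENNReal.ofReal (2 ^ m) * volume (Metric.ball (0 : RN N) 1),
    ENNReal.mul_lt_top ENNReal.ofReal_lt_top measure_ball_lt_top, ?_⟩
  intro μ _ v Z hv h _ hh
  rw [zero_mul, Real.rpow_zero, ENNReal.ofReal_one, mul_one]
  exact lintegral_diff_le_const hm hρ.2.le hv.abs_le_one hh.le

/-- One step of the improvement of differentiability. -/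
lemma DiffBound.improve (hN : 0 < N) {s₁ s p m₀ m γ γ' : ℝ} (hs₁ : s₁ ∈ Ioo (0 : ℝ) 1)
    (hs : s ∈ Ioo (0 : ℝ) 1) (hp : 2 ≤ p) (hm₀ : p ≤ m₀) (hm : m₀ ≤ m)
    (hmm : m * (p - 2) ≤ m₀ * (p - 1)) (hγ : 0 ≤ γ) (hE : EnergyBound N s₁ s p m₀)
    (hD : DiffBound N s₁ s p m γ)
    (hcase : (0 ≤ γ' ∧ γ' < 1 ∧ γ' ≤ (s * p + γ * (m - p + 1)) / m) ∨
      (γ' = 1 ∧ 1 < (s * p + γ * (m - p + 1)) / m)) :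
    DiffBound N s₁ s p m γ' := by
  intro ρ hρ
  obtain ⟨hρ0, hρ1⟩ := hρ
  -- This leaves room for the radius ρ+5d of the energy bound, and makes every |h| < d admissible in
  -- the difference bound at radius ρ+4d.
  set d := (1 - ρ) / 8 with hd
  have hd0 : 0 < d := by rw [hd]; linarith
  have hd8 : ρ + 8 * d = 1 := by rw [hd]; ring
  have hm0 : 0 < m := by linarith
  have hsp : 0 < s * p := mul_pos hs.1 (by linarith)
  obtain ⟨Cg, hCg, hg⟩ := hE (ρ + 5 * d) ⟨by linarith, by linarith⟩
  obtain ⟨Cd, hCd, hdb⟩ := hD (ρ + 4 * d) ⟨by linarith, by linarith⟩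
  obtain ⟨C₁, hC₁, h₁⟩ := exists_nearEnergy_le hN hs₁ hs hp hm₀ hm hmm hγ hd0
    (by linarith : ρ + 5 * d ≤ 1) hρ0 hCg hCd
  obtain ⟨C₂, hC₂, h₂⟩ := exists_lintegral_diff_le (N := N) (ρ := ρ) (d := d) hN hsp hm0
  obtain ⟨C, hC, h₃⟩ := exists_lintegral_diff_le_of_second (N := N) (m := m)
    (by linarith) hd0 hρ0 (by linarith) hcase (ENNReal.mul_lt_top hC₂ hC₁)
  refine ⟨C, hC, fun μ hμ v Z hv => h₃ v hv.measurable hv.abs_le_one fun h hpos hh => ?_⟩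
  have hdh : ‖h‖ < d := by linarith
  have e := h₁ μ hμ v Z hv (hg μ hμ v Z hv) h hpos hdh (hdb μ hμ v Z hv h hpos (by linarith))
  calc _ ≤ C₂ * (ENNReal.ofReal (‖h‖ ^ (s * p)) * nearEnergy s p m (ρ + 2 * d) d (diff h v)) :=
        h₂ (diff h v) (measurable_diff hv.measurable) h hpos hh
    _ ≤ C₂ * (ENNReal.ofReal (‖h‖ ^ (s * p)) *
        (C₁ * ENNReal.ofReal (‖h‖ ^ (γ * (m - p + 1))))) := by gcongr
    _ = C₂ * C₁ * (ENNReal.ofReal (‖h‖ ^ (s * p)) * ENNReal.ofReal (‖h‖ ^ (γ * (m - p + 1)))) := by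
        ring
    _ = _ := by
        rw [← ENNReal.ofReal_mul (by positivity), ← Real.rpow_add hpos,
          div_mul_cancel₀ _ hm0.ne']

/-- Lipschitz order of the translation differences in `L^m`. -/
lemma EnergyBound.diffBound_one (hN : 0 < N) {s₁ s p m₀ m : ℝ} (hs₁ : s₁ ∈ Ioo (0 : ℝ) 1)
    (hs : s ∈ Ioo (0 : ℝ) 1) (hp : 2 ≤ p) (hsp : p - 1 < s * p) (hm₀ : p ≤ m₀) (hm : m₀ ≤ m)
    (hmm : m * (p - 2) ≤ m₀ * (p - 1)) (hE : EnergyBound N s₁ s p m₀) :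
    DiffBound N s₁ s p m 1 := by
  have hm0 : 0 < m := by linarith
  -- One step raises the order γ by (sp - γ(p-1))/m, which is at least δ as long as γ ≤ 1.
  -- Positivity of δ is the assumption s_p > (p-1)/p.
  set δ := (s * p - (p - 1)) / m with hδ
  have hδ0 : 0 < δ := div_pos (by linarith) hm0
  obtain ⟨n, hn⟩ := exists_nat_one_div_lt hδ0
  set k : ℝ := (n : ℝ) + 1 with hk
  have hk0 : 0 < k := by positivity
  have hgain : ∀ γ : ℝ, γ ≤ 1 → γ + 1 / k < (s * p + γ * (m - p + 1)) / m := by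
    intro γ hγ
    have : (s * p + γ * (m - p + 1)) / m = γ + (s * p - γ * (p - 1)) / m := by
      field_simp; ring
    rw [this]
    have h2 : δ ≤ (s * p - γ * (p - 1)) / m := by
      rw [hδ]
      gcongr
      nlinarith
    linarith
  -- With k = n+1 and 1/k < δ the order climbs along multiples of 1/k, staying below one. Since the
  -- gain is strictly larger than 1/k, the last step, from n/k, passes strictly above one and so
  -- avoids the critical case.
  have key : ∀ j : ℕ, j ≤ n → DiffBound N s₁ s p m (j / k) := by
    intro j
    induction j with
    | zero => intro _; simpa using diffBound_zero hm0.le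
    | succ j ih =>
      intro hj
      have hjn : (j : ℝ) + 1 ≤ n := by exact_mod_cast hj
      refine DiffBound.improve hN hs₁ hs hp hm₀ hm hmm (by positivity) hE (ih (by omega))
        (Or.inl ⟨by positivity, ?_, ?_⟩)
      · rw [div_lt_one hk0]; push_cast; linarith
      · have := hgain (j / k) (by rw [div_le_one hk0]; linarith)
        rw [← add_div] at this
        push_cast
        exact this.le
  refine DiffBound.improve hN hs₁ hs hp hm₀ hm hmm (by positivity) hE (key n le_rfl)
    (Or.inr ⟨rfl, ?_⟩)
  have := hgain (n / k) (by rw [div_le_one hk0]; linarith)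
  rwa [← add_div, ← hk, div_self hk0.ne'] at this

/-- Lipschitz order of the differences gives a bound of every fractional energy. -/
lemma DiffBound.energyBound (hN : 0 < N) {s₁ s p m : ℝ} (hs : s ∈ Ioo (0 : ℝ) 1) (hm : 1 ≤ m)
    (hD : DiffBound N s₁ s p m 1) : EnergyBound N s₁ s p m := by
  intro ρ hρ
  obtain ⟨hρ0, hρ1⟩ := hρ
  obtain ⟨C, hC, hdb⟩ := hD ρ ⟨hρ0, hρ1⟩
  have hm0 : 0 < m := by linarith
  set d := 1 - ρ with hd
  have hd0 : 0 < d := by rw [hd]; linarith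
  set B := Metric.ball (0 : RN N) ρ with hB
  have hmB : MeasurableSet B := Metric.isOpen_ball.measurableSet
  -- With h = y - x the order-one bound contributes |h|^m, which reduces the kernel to order sm - m
  -- < 0, integrable near zero. Pairs at distance at least d are bounded trivially by the constant
  -- c.
  set k := (Metric.ball (0 : RN N) 1).indicator (kern (s * m - m)) with hk
  have hkt : ∫⁻ w, k w < ∞ := lintegral_near_kern_lt_top hN (by nlinarith [hs.2])
  set c := ENNReal.ofReal (2 ^ m / d ^ ((N : ℝ) + s * m)) with hc
  have hBt : volume B < ∞ := measure_ball_lt_top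
  refine ⟨C * (∫⁻ w, k w) + c * (volume B * volume B), ENNReal.add_lt_top.2
    ⟨ENNReal.mul_lt_top hC hkt, ENNReal.mul_lt_top ENNReal.ofReal_lt_top
      (ENNReal.mul_lt_top hBt hBt)⟩, ?_⟩
  intro μ hμ v Z hv
  have hvm := hv.measurable
  set K := (Metric.ball (0 : RN N) d).indicator (kern (s * m)) with hK
  have hKm : Measurable K := (measurable_kern _).indicator Metric.isOpen_ball.measurableSet
  have hm1 : Measurable (B.indicator (1 : RN N → ℝ≥0∞)) := measurable_ball_indicator_one _
  set Q : RN N → RN N → ℝ≥0∞ := fun x h =>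
    B.indicator 1 x * (K h * ENNReal.ofReal (|diff h v x| ^ m)) with hQ
  have hQm : Measurable (fun z : RN N × RN N => Q z.1 z.2) := by
    simp only [hQ, diff]
    fun_prop
  have hpt : ∀ z : RN N × RN N, (B ×ˢ B).indicator (gdens s m v) z ≤
      Q z.1 (z.2 - z.1) + c * (B.indicator 1 z.1 * B.indicator 1 z.2) := by
    rintro ⟨x, y⟩
    by_cases hz : (x, y) ∈ B ×ˢ B
    swap
    · simp [hz]
    obtain ⟨hx, hy⟩ := hz
    simp only at hx hy
    rw [indicator_of_mem (show (x, y) ∈ B ×ˢ B from ⟨hx, hy⟩)]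
    by_cases hn : y - x ∈ Metric.ball (0 : RN N) d
    · refine le_trans (le_of_eq ?_) le_self_add
      simp only [hQ, hK, indicator_of_mem hx, indicator_of_mem hn, gdens, diff, kern,
        Pi.one_apply, one_mul]
      rw [← ENNReal.ofReal_mul (by positivity), one_div_mul_eq_div, add_sub_cancel, abs_sub_comm,
        norm_sub_rev]
    · refine le_trans ?_ le_add_self
      simp only [indicator_of_mem hx, indicator_of_mem hy, Pi.one_apply, mul_one, gdens, hc]
      apply ENNReal.ofReal_le_ofReal
      have h1 : d ≤ ‖x - y‖ := by rw [norm_sub_rev]; simpa using hn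
      have h2 : |v x - v y| ≤ 2 := (abs_sub _ _).trans (by
        linarith [hv.abs_le_one x (Metric.ball_subset_ball hρ1.le hx),
          hv.abs_le_one y (Metric.ball_subset_ball hρ1.le hy)])
      have h3 : 0 ≤ s * m := mul_nonneg hs.1.le hm0.le
      gcongr
  rw [genergy, ← lintegral_indicator (hmB.prod hmB)]
  refine (lintegral_mono hpt).trans ?_
  have hQm' : Measurable (fun z : RN N × RN N => Q z.1 (z.2 - z.1)) :=
    hQm.comp (measurable_fst.prodMk (measurable_snd.sub measurable_fst))
  rw [lintegral_add_left hQm', lintegral_const_mul' _ _ ENNReal.ofReal_ne_top,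
    lintegral_tensor hm1 hm1, lintegral_indicator_one hmB]
  refine add_le_add ?_ le_rfl
  have hfub : ∫⁻ z : RN N × RN N, Q z.1 (z.2 - z.1) = ∫⁻ h, ∫⁻ x, Q x h := by
    rw [Measure.volume_eq_prod, lintegral_prod _ hQm'.aemeasurable]
    simp only
    refine (lintegral_congr fun x => lintegral_sub_right_eq_self (fun h => Q x h) x).trans ?_
    exact lintegral_lintegral_swap hQm.aemeasurable
  rw [hfub, ← lintegral_const_mul' _ _ hC.ne]
  refine lintegral_mono fun h => ?_
  by_cases hh : h ∈ Metric.ball (0 : RN N) d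
  swap
  · simp [hQ, hK, hh]
  have hQi : ∫⁻ x, Q x h = K h * ∫⁻ x in B, ENNReal.ofReal (|diff h v x| ^ m) := by
    have hdm := measurable_diff (h := h) hvm
    rw [← lintegral_const_mul _ (by fun_prop), ← lintegral_indicator hmB]
    refine lintegral_congr fun x => ?_
    by_cases hx : x ∈ B <;> simp [hQ, hx]
  rw [hQi]
  rcases eq_or_ne h 0 with rfl | hne
  -- The difference bound says nothing at h = 0, but there the kernel is zero by the convention for
  -- division by zero.
  · have hNs : (N : ℝ) + s * m ≠ 0 := (add_pos (by exact_mod_cast hN) (mul_pos hs.1 hm0)).ne'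
    have : K 0 = 0 := by
      rw [hK, indicator_of_mem hh, kern, norm_zero, Real.zero_rpow hNs]; simp
    simp [this]
  have hpos : 0 < ‖h‖ := norm_pos_iff.2 hne
  have hhd : ‖h‖ < d := by simpa using hh
  have h1 : h ∈ Metric.ball (0 : RN N) 1 := by rw [mem_ball_zero_iff]; linarith
  simp only [hK, indicator_of_mem hh, hk, indicator_of_mem h1]
  calc kern (s * m) h * ∫⁻ x in B, ENNReal.ofReal (|diff h v x| ^ m)
      ≤ kern (s * m) h * (C * ENNReal.ofReal (‖h‖ ^ (1 * m))) := by
        gcongr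
        exact hdb μ hμ v Z hv h hpos hhd
    _ = C * (ENNReal.ofReal (‖h‖ ^ m) * kern (s * m) h) := by rw [one_mul]; ring
    _ ≤ C * kern (s * m - m) h := by
        rw [kern, ← ENNReal.ofReal_mul (by positivity), mul_one_div]
        exact mul_le_mul' le_rfl (ENNReal.ofReal_le_ofReal (one_div_rpow_sub hpos.le hm0 _))

/-- Interior difference bounds of Lipschitz order in every `L^q`, `q ≥ p`. -/
theorem diffBound_one_of_le (hN : 0 < N) {s₁ s p q : ℝ} (hs₁ : s₁ ∈ Ioo (0 : ℝ) 1)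
    (hs : s ∈ Ioo (0 : ℝ) 1) (hp : 2 ≤ p) (hsp : p - 1 < s * p) (hq : p ≤ q) :
    DiffBound N s₁ s p q 1 := by
  -- The case m = p is the normalisation of unit solutions. For larger m take m₀ = max(p, m-1): the
  -- condition m(p-2) ≤ m₀(p-1) follows from m ≤ m₀ + 1 and p - 2 ≤ m₀.
  have key : ∀ n : ℕ, ∀ m : ℝ, p ≤ m → m ≤ p + n → EnergyBound N s₁ s p m := by
    intro n
    induction n with
    | zero =>
      intro m h1 h2
      obtain rfl : m = p := le_antisymm (by simpa using h2) h1
      intro ρ hρ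
      exact ⟨1, ENNReal.one_lt_top, fun μ _ v Z hv =>
        (genergy_mono (Metric.ball_subset_ball hρ.2.le) v).trans hv.genergy_le⟩
    | succ n ih =>
      intro m h1 h2
      push_cast at h2
      have hE := ih (max p (m - 1)) (le_max_left _ _)
        (max_le (by have : (0 : ℝ) ≤ n := n.cast_nonneg
                    linarith) (by linarith))
      have h3 : p ≤ max p (m - 1) := le_max_left _ _
      have h4 : m - 1 ≤ max p (m - 1) := le_max_right _ _
      have h5 : max p (m - 1) ≤ m := max_le h1 (by linarith)
      exact (hE.diffBound_one hN hs₁ hs hp hsp h3 h5 (by nlinarith)).energyBound hN hs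
        (by linarith)
  obtain ⟨n, hn⟩ := exists_nat_ge (q - p)
  exact (key n q hq (by linarith)).diffBound_one hN hs₁ hs hp hsp hq le_rfl (by nlinarith)

/-! ### Affine changes of variables and normalisation -/

section Affine

variable {E : Type*} [NormedAddCommGroup E] [NormedSpace ℝ E] [MeasurableSpace E] [BorelSpace E]

lemma measurableEmbedding_affine (a : E) {ρ : ℝ} (hρ : 0 < ρ) :
    MeasurableEmbedding (fun x : E => a + ρ • x) :=
  ((Homeomorph.smulOfNeZero ρ hρ.ne').trans (Homeomorph.addLeft a)).measurableEmbedding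

variable [FiniteDimensional ℝ E] {ν : Measure E} [ν.IsAddHaarMeasure]

lemma map_affine (a : E) {ρ : ℝ} (hρ : 0 < ρ) :
    ν.map (fun x => a + ρ • x) = ENNReal.ofReal (ρ ^ Module.finrank ℝ E)⁻¹ • ν := by
  have h1 : (fun x : E => a + ρ • x) = (fun x => a + x) ∘ (fun x => ρ • x) := rfl
  rw [h1, ← Measure.map_map (measurable_const_add a) (measurable_const_smul ρ),
    Measure.map_addHaar_smul ν hρ.ne', Measure.map_smul, map_add_left_eq_self,
    abs_of_pos (by positivity)]

lemma lintegral_comp_affine (a : E) {ρ : ℝ} (hρ : 0 < ρ) (f : E → ℝ≥0∞) :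
    ∫⁻ x, f (a + ρ • x) ∂ν = ENNReal.ofReal (ρ ^ Module.finrank ℝ E)⁻¹ * ∫⁻ x, f x ∂ν := by
  rw [← (measurableEmbedding_affine a hρ).lintegral_map f, map_affine a hρ,
    lintegral_smul_measure, smul_eq_mul]

lemma integral_comp_affine (a : E) {ρ : ℝ} (hρ : 0 < ρ) (f : E → ℝ) :
    ∫ x, f (a + ρ • x) ∂ν = (ρ ^ Module.finrank ℝ E)⁻¹ * ∫ x, f x ∂ν := by
  rw [← (measurableEmbedding_affine a hρ).integral_map f, map_affine a hρ,
    integral_smul_measure, ENNReal.toReal_ofReal (by positivity), smul_eq_mul]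

lemma quasiMeasurePreserving_affine (a : E) {ρ : ℝ} (hρ : 0 < ρ) :
    Measure.QuasiMeasurePreserving (fun x : E => a + ρ • x) ν ν := by
  refine ⟨(measurableEmbedding_affine a hρ).measurable, ?_⟩
  rw [map_affine a hρ]
  exact Measure.smul_absolutelyContinuous

end Affine

lemma ae_prod_of_ae {P : RN N → Prop} (h : ∀ᵐ x, P x) :
    ∀ᵐ z : RN N × RN N, P z.1 ∧ P z.2 := by
  have h1 : ∀ᵐ z : RN N × RN N, P z.1 := Measure.quasiMeasurePreserving_fst.ae h
  have h2 : ∀ᵐ z : RN N × RN N, P z.2 := Measure.quasiMeasurePreserving_snd.ae h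
  exact h1.and h2

lemma genergy_congr {s q : ℝ} {V : Set (RN N)} {u w : RN N → ℝ} (h : u =ᵐ[volume] w) :
    genergy s q V u = genergy s q V w := by
  refine lintegral_congr_ae (ae_restrict_of_ae ?_)
  filter_upwards [ae_prod_of_ae h] with z hz
  rw [gdens, gdens, hz.1, hz.2]

lemma finrank_prod_RN : Module.finrank ℝ (RN N × RN N) = N + N := by
  rw [Module.finrank_prod, finrank_euclideanSpace, Fintype.card_fin]

/-- Scaling of the Gagliardo energy. -/
lemma genergy_affine {s q : ℝ} (z₀ : RN N) {ρ : ℝ} (hρ : 0 < ρ) {V W : Set (RN N)}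
    (hV : MeasurableSet V) (hW : MeasurableSet W) (hVW : ∀ x ∈ V, z₀ + ρ • x ∈ W)
    (u : RN N → ℝ) :
    genergy s q V (fun x => u (z₀ + ρ • x)) ≤
      ENNReal.ofReal (ρ ^ (s * q - N)) * genergy s q W u := by
  have hc := lintegral_comp_affine (ν := volume) (z₀, z₀) hρ ((W ×ˢ W).indicator (gdens s q u))
  rw [finrank_prod_RN, lintegral_indicator (hW.prod hW)] at hc
  have hpow : ρ ^ ((N : ℝ) + s * q) * (ρ ^ (N + N))⁻¹ = ρ ^ (s * q - N) := by
    rw [← Real.rpow_natCast, ← Real.rpow_neg hρ.le, ← Real.rpow_add hρ]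
    congr 1; push_cast; ring
  rw [genergy, genergy, ← lintegral_indicator (hV.prod hV), ← hpow,
    ENNReal.ofReal_mul (by positivity), mul_assoc, ← hc,
    ← lintegral_const_mul' _ _ ENNReal.ofReal_ne_top]
  refine lintegral_mono fun z => ?_
  by_cases hz : z ∈ V ×ˢ V
  · have : (z₀, z₀) + ρ • z ∈ W ×ˢ W := ⟨hVW _ hz.1, hVW _ hz.2⟩
    rw [indicator_of_mem hz, indicator_of_mem this, gdens, gdens,
      ← ENNReal.ofReal_mul (by positivity)]
    apply ENNReal.ofReal_le_ofReal
    apply le_of_eq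
    simp only [Prod.fst_add, Prod.snd_add, Prod.smul_fst, Prod.smul_snd, add_sub_add_left_eq_sub]
    rw [← smul_sub, norm_smul, Real.norm_of_nonneg hρ.le, Real.mul_rpow hρ.le (norm_nonneg _)]
    have : ρ ^ ((N : ℝ) + s * q) ≠ 0 := (Real.rpow_pos_of_pos hρ _).ne'
    field_simp
  · simp [hz]

lemma genergy_div {s q L : ℝ} (hL : 0 < L) (V : Set (RN N)) (u : RN N → ℝ) :
    genergy s q V (fun x => u x / L) = ENNReal.ofReal ((L ^ q)⁻¹) * genergy s q V u := by
  rw [genergy, genergy, ← lintegral_const_mul' _ _ ENNReal.ofReal_ne_top]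
  refine lintegral_congr fun z => ?_
  rw [gdens, gdens, ← ENNReal.ofReal_mul (by positivity), ← sub_div, abs_div, abs_of_pos hL,
    Real.div_rpow (abs_nonneg _) hL.le]
  congr 1
  ring

lemma aemeasurable_of_memTailSpace {q γ : ℝ} {u : RN N → ℝ} (hu : MemTailSpace q γ u) :
    AEMeasurable u := by
  have h1 : ∀ n : ℕ, AEMeasurable u (volume.restrict (Metric.closedBall (0 : RN N) n)) :=
    fun n => (hu.1 _ (isCompact_closedBall _ _)).aestronglyMeasurable.aemeasurable
  have := aemeasurable_iUnion_iff.2 h1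
  rwa [Metric.iUnion_closedBall_nat, Measure.restrict_univ] at this

lemma inv_affine_affine (z x : RN N) {ρ : ℝ} (hρ : 0 < ρ) :
    -(ρ⁻¹ • z) + ρ⁻¹ • (z + ρ • x) = x := by
  rw [smul_add, smul_smul, inv_mul_cancel₀ hρ.ne', one_smul]; abel

lemma affine_inv_affine (z y : RN N) {ρ : ℝ} (hρ : 0 < ρ) :
    z + ρ • (-(ρ⁻¹ • z) + ρ⁻¹ • y) = y := by
  rw [smul_add, smul_neg, smul_smul, smul_smul, mul_inv_cancel₀ hρ.ne', one_smul, one_smul]; abel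

lemma gagliardo_lt_top {s q : ℝ} (hq : 0 < q) {V : Set (RN N)} {u : RN N → ℝ}
    (hu : AEMeasurable u (volume.restrict V)) (h : genergy s q V u < ∞) :
    gagliardo s q V u < ∞ := by
  rw [gagliardo_eq hu]
  exact ENNReal.rpow_lt_top_of_nonneg (by positivity) h.ne

/-- Rescaled test functions are admissible. -/
lemma isTestFunction_comp_affine {s₁ s p : ℝ} (hp : 0 < p) {Ω : Set (RN N)} {z : RN N} {ρ : ℝ}
    (hρ : 0 < ρ) (hΩ : Metric.closedBall z ρ ⊆ Ω) {φ : RN N → ℝ} (hφ : Measurable φ)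
    (hb : ∃ M, ∀ x, |φ x| ≤ M) (hsupp : ∃ ρ < 1, ∀ x ∉ Metric.ball (0 : RN N) ρ, φ x = 0)
    (h1 : genergy s₁ 1 univ φ < ∞) (hs : genergy s p univ φ < ∞) :
    IsTestFunction s₁ s p Ω (fun y => φ (-(ρ⁻¹ • z) + ρ⁻¹ • y)) := by
  obtain ⟨M, hM⟩ := hb
  obtain ⟨r, hr, hr0⟩ := hsupp
  set ψ : RN N → ℝ := fun y => φ (-(ρ⁻¹ • z) + ρ⁻¹ • y) with hψ
  have hψm : Measurable ψ := by
    simp only [hψ]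
    fun_prop
  have hzero : ∀ y ∉ Metric.closedBall z ρ, ψ y = 0 := by
    intro y hy
    apply hr0
    intro hmem
    apply hy
    have h2 : ‖-(ρ⁻¹ • z) + ρ⁻¹ • y‖ < r := by simpa using hmem
    have h3 : y - z = ρ • (-(ρ⁻¹ • z) + ρ⁻¹ • y) := by
      have := affine_inv_affine z y hρ
      rw [eq_comm, ← sub_eq_iff_eq_add'] at this
      exact this
    rw [mem_closedBall_iff_norm, h3, norm_smul, Real.norm_of_nonneg hρ.le]
    nlinarith
  have hts : tsupport ψ ⊆ Metric.closedBall z ρ := by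
    refine closure_minimal ?_ Metric.isClosed_closedBall
    intro y hy
    by_contra h
    exact hy (hzero y h)
  have hLp : ∀ t : ℝ≥0∞, MemLp ψ t (volume.restrict univ) := by
    intro t
    rw [Measure.restrict_univ]
    have : MemLp ψ ∞ volume :=
      memLp_top_of_bound hψm.aestronglyMeasurable M (ae_of_all _ fun x => hM _)
    exact this.mono_exponent_of_measure_support_ne_top hzero
      measure_closedBall_lt_top.ne le_top
  have hen : ∀ {σ t : ℝ}, 0 < t → genergy σ t univ φ < ∞ → gagliardo σ t univ ψ < ∞ := by
    intro σ t ht h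
    refine gagliardo_lt_top ht hψm.aemeasurable ?_
    exact (genergy_affine (-(ρ⁻¹ • z)) (inv_pos.2 hρ) MeasurableSet.univ MeasurableSet.univ
      (fun _ _ => mem_univ _) φ).trans_lt (ENNReal.mul_lt_top ENNReal.ofReal_lt_top h)
  exact ⟨⟨hLp _, hen one_pos h1⟩, ⟨hLp _, hen hp hs⟩,
    (isCompact_closedBall z ρ).of_isClosed_subset (isClosed_tsupport _) hts, hts.trans hΩ⟩

/-- Change of variables in the weak formulation. -/
lemma integral_weak_affine (F : RN N × RN N → ℝ) (φ : RN N → ℝ) (z₀ : RN N) {ρ : ℝ} (hρ : 0 < ρ)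
    (a : ℝ) :
    ∫ z : RN N × RN N, F ((z₀, z₀) + ρ • z) * (φ z.1 - φ z.2) / ‖z.1 - z.2‖ ^ a =
      ρ ^ a * (ρ ^ (N + N))⁻¹ * ∫ z : RN N × RN N, F z *
        (φ (-(ρ⁻¹ • z₀) + ρ⁻¹ • z.1) - φ (-(ρ⁻¹ • z₀) + ρ⁻¹ • z.2)) / ‖z.1 - z.2‖ ^ a := by
  have h := integral_comp_affine (ν := (volume : Measure (RN N × RN N))) (z₀, z₀) hρ
    (fun z => F z * (φ (-(ρ⁻¹ • z₀) + ρ⁻¹ • z.1) - φ (-(ρ⁻¹ • z₀) + ρ⁻¹ • z.2)) /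
      ‖z.1 - z.2‖ ^ a)
  rw [finrank_prod_RN] at h
  rw [mul_assoc, ← h, ← integral_const_mul]
  refine integral_congr_ae (ae_of_all _ fun z => ?_)
  have hρa : ρ ^ a ≠ 0 := (Real.rpow_pos_of_pos hρ _).ne'
  simp only [Prod.fst_add, Prod.snd_add, Prod.smul_fst, Prod.smul_snd, inv_affine_affine _ _ hρ,
    add_sub_add_left_eq_sub]
  rw [← smul_sub, norm_smul, Real.norm_of_nonneg hρ.le, Real.mul_rpow hρ.le (norm_nonneg _)]
  field_simp

lemma jpow_div {a L : ℝ} (hL : 0 < L) (t : ℝ) : jpow a (t / L) = (L ^ (a + 1))⁻¹ * jpow a t := by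
  rw [jpow, jpow, abs_div, abs_of_pos hL, Real.div_rpow (abs_nonneg _) hL.le,
    Real.rpow_add_one hL.ne']
  field_simp

/-- The sign is homogeneous of degree zero, so dividing the solution by L changes only the p-term.
The imbalance is carried by the coefficient μ. -/
lemma sgn_div {L : ℝ} (hL : 0 < L) (t : ℝ) : sgn (t / L) = sgn t := by
  ext y
  simp only [sgn, mem_ofPred_eq, div_pos_iff_of_pos_right hL, div_lt_iff₀ hL, zero_mul,
    div_eq_zero_iff, hL.ne', or_false]

lemma le_ofReal_rpow_of_rpow_le {x : ℝ≥0∞} {K t : ℝ} (ht : 0 < t) (hK : 0 ≤ K)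
    (h : x ^ (1 / t) ≤ ENNReal.ofReal K) : x ≤ ENNReal.ofReal (K ^ t) := by
  have := ENNReal.rpow_le_rpow h ht.le
  rwa [← ENNReal.rpow_mul, one_div_mul_cancel ht.ne', ENNReal.rpow_one,
    ENNReal.ofReal_rpow_of_nonneg hK ht.le] at this

lemma ae_abs_le_of_eLpNorm_top_le {u : RN N → ℝ} {V : Set (RN N)} (hV : MeasurableSet V) {K : ℝ}
    (hK : 0 ≤ K) (h : eLpNorm u ∞ (volume.restrict V) ≤ ENNReal.ofReal K) :
    ∀ᵐ x, x ∈ V → |u x| ≤ K := by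
  rw [← ae_restrict_iff' hV]
  rw [eLpNorm_exponent_top] at h
  filter_upwards [ae_le_eLpNormEssSup (f := u) (μ := volume.restrict V)] with x hx
  have := hx.trans h
  rwa [Real.enorm_eq_ofReal_abs, ENNReal.ofReal_le_ofReal_iff hK] at this

/-- The weighted tail of a rescaled function. -/
lemma lintegral_tdens_affine_le (hN : 0 < N) {s p : ℝ} (hs : s ∈ Ioo (0 : ℝ) 1) (hp : 2 ≤ p)
    {u : RN N → ℝ} {x₀ z : RN N} {R ρ K L : ℝ} (hR : R < 1) (hρ : 0 < ρ)
    (hz : ‖z - x₀‖ + ρ ≤ R) (hK : 0 ≤ K) (hL : 0 < L)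
    (hu : ∀ᵐ x, x ∈ Metric.ball x₀ R → |u x| ≤ K) (ht : tail s p u x₀ R ≤ ENNReal.ofReal K) :
    ∫⁻ x, tdens s p (fun x => u (z + ρ • x) / L) x ≤ ENNReal.ofReal
      ((K / L) ^ (p - 1) * ρ ^ (-((N : ℝ) + p)) *
        ((volume (Metric.ball (0 : RN N) 1)).toReal + 1)) := by
  set V := (volume (Metric.ball (0 : RN N) 1)).toReal with hV
  have hV0 : 0 ≤ V := ENNReal.toReal_nonneg
  have hVe : volume (Metric.ball (0 : RN N) 1) = ENNReal.ofReal V :=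
    (ENNReal.ofReal_toReal measure_ball_lt_top.ne).symm
  set B := Metric.ball x₀ R with hB
  have hBm : MeasurableSet B := Metric.isOpen_ball.measurableSet
  have hρR : ρ ≤ R := by linarith [norm_nonneg (z - x₀)]
  have hR0 : 0 < R := hρ.trans_le hρR
  have hσ : 0 < s * p := mul_pos hs.1 (by linarith)
  set f : RN N → ℝ≥0∞ := fun y => ENNReal.ofReal
    ((|u y| / L) ^ (p - 1) / (1 + ρ⁻¹ * ‖y - z‖) ^ ((N : ℝ) + s * p)) with hf
  have h0 : ∫⁻ x, tdens s p (fun x => u (z + ρ • x) / L) x =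
      ENNReal.ofReal (ρ ^ N)⁻¹ * ∫⁻ y, f y := by
    have := lintegral_comp_affine (ν := (volume : Measure (RN N))) z hρ f
    rw [finrank_euclideanSpace, Fintype.card_fin] at this
    rw [← this]
    refine lintegral_congr fun x => ?_
    simp only [tdens, hf, abs_div, abs_of_pos hL, add_sub_cancel_left, norm_smul,
      Real.norm_of_nonneg hρ.le]
    rw [inv_mul_cancel_left₀ hρ.ne']
  have h1 : ∫⁻ y in B, f y ≤ ENNReal.ofReal ((K / L) ^ (p - 1) * V) := by
    have : ∀ᵐ y ∂(volume.restrict B), f y ≤ ENNReal.ofReal ((K / L) ^ (p - 1)) := by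
      rw [ae_restrict_iff' hBm]
      filter_upwards [hu] with y hy hyB
      apply ENNReal.ofReal_le_ofReal
      have h2 : 1 ≤ (1 + ρ⁻¹ * ‖y - z‖) ^ ((N : ℝ) + s * p) :=
        Real.one_le_rpow (by linarith [show 0 ≤ ρ⁻¹ * ‖y - z‖ by positivity]) (by positivity)
      have h3 : (|u y| / L) ^ (p - 1) ≤ (K / L) ^ (p - 1) :=
        Real.rpow_le_rpow (by positivity) (by have := hy hyB; gcongr) (by linarith)
      exact (div_le_self (by positivity) h2).trans h3
    refine (lintegral_mono_ae this).trans ?_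
    rw [lintegral_const, Measure.restrict_apply_univ, ENNReal.ofReal_mul (by positivity), ← hVe]
    refine mul_le_mul_right ?_ _
    have h4 : volume B = volume (Metric.ball (0 : RN N) R) := Measure.addHaar_ball_center _ _ _
    rw [h4]
    exact measure_mono (Metric.ball_subset_ball hR.le)
  have h2 : ∫⁻ y in Bᶜ, f y ≤ ENNReal.ofReal ((K / L) ^ (p - 1) * ρ ^ (-p)) := by
    set I := ∫⁻ x in Bᶜ, ENNReal.ofReal (|u x| ^ (p - 1) / ‖x - x₀‖ ^ ((N : ℝ) + s * p)) with hI
    have ht' : ENNReal.ofReal (R ^ (s * p)) * I ≤ ENNReal.ofReal (K ^ (p - 1)) :=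
      le_ofReal_rpow_of_rpow_le (by linarith) hK ht
    have hI' : I ≤ ENNReal.ofReal (R ^ (-(s * p)) * K ^ (p - 1)) := by
      rw [ENNReal.ofReal_mul (by positivity)]
      refine le_trans (le_of_eq ?_) (mul_le_mul_right ht' _)
      rw [← mul_assoc, ← ENNReal.ofReal_mul (by positivity), ← Real.rpow_add hR0]
      simp
    have hfle : ∀ y ∈ Bᶜ, f y ≤ ENNReal.ofReal ((L ^ (p - 1))⁻¹) *
        ENNReal.ofReal (|u y| ^ (p - 1) / ‖y - x₀‖ ^ ((N : ℝ) + s * p)) := by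
      intro y hy
      have hy' : R ≤ ‖y - x₀‖ := by simpa [hB, dist_eq_norm] using hy
      have hy0 : 0 < ‖y - x₀‖ := hR0.trans_le hy'
      -- Outside the large ball the weight centred at z is compared with the one centred at x₀: the
      -- shift of centre is at most R < 1 and ρ ≤ 1.
      have h5 : ‖y - x₀‖ ≤ 1 + ρ⁻¹ * ‖y - z‖ := by
        have h6 : ‖y - x₀‖ ≤ ‖y - z‖ + ‖z - x₀‖ := norm_sub_le_norm_sub_add_norm_sub _ _ _
        have h7 : 1 * ‖y - z‖ ≤ ρ⁻¹ * ‖y - z‖ := by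
          have : 1 ≤ ρ⁻¹ := (one_le_inv₀ hρ).2 (by linarith)
          gcongr
        linarith
      rw [← ENNReal.ofReal_mul (by positivity)]
      apply ENNReal.ofReal_le_ofReal
      rw [Real.div_rpow (abs_nonneg _) hL.le, ← mul_div_assoc, inv_mul_eq_div (L ^ (p - 1))]
      have : ‖y - x₀‖ ^ ((N : ℝ) + s * p) ≤ (1 + ρ⁻¹ * ‖y - z‖) ^ ((N : ℝ) + s * p) :=
        Real.rpow_le_rpow hy0.le h5 (by positivity)
      exact div_le_div_of_nonneg_left (by positivity) (by positivity) this
    refine (setLIntegral_mono' hBm.compl hfle).trans ?_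
    rw [lintegral_const_mul' _ _ ENNReal.ofReal_ne_top]
    refine (mul_le_mul_right hI' _).trans ?_
    rw [← ENNReal.ofReal_mul (by positivity)]
    apply ENNReal.ofReal_le_ofReal
    have h8 : R ^ (-(s * p)) ≤ ρ ^ (-p) := by
      calc R ^ (-(s * p)) ≤ ρ ^ (-(s * p)) :=
            Real.rpow_le_rpow_of_nonpos hρ hρR (by linarith)
        _ ≤ ρ ^ (-p) := Real.rpow_le_rpow_of_exponent_ge hρ (by linarith)
            (by nlinarith [hs.2])
    rw [Real.div_rpow hK hL.le, div_eq_inv_mul]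
    have : 0 ≤ (L ^ (p - 1))⁻¹ * K ^ (p - 1) := by positivity
    nlinarith
  rw [h0, ← lintegral_add_compl f hBm]
  refine (mul_le_mul_right (add_le_add h1 h2) _).trans ?_
  rw [← ENNReal.ofReal_add (by positivity) (by positivity), ← ENNReal.ofReal_mul (by positivity)]
  apply ENNReal.ofReal_le_ofReal
  have hρN : (ρ ^ N)⁻¹ = ρ ^ (-(N : ℝ)) := by rw [Real.rpow_neg hρ.le, Real.rpow_natCast]
  have hρp : 1 ≤ ρ ^ (-p) :=
    Real.one_le_rpow_of_pos_of_le_one_of_nonpos hρ (by linarith) (by linarith)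
  rw [hρN, neg_add, Real.rpow_add hρ]
  have h9 : (K / L) ^ (p - 1) * V ≤ (K / L) ^ (p - 1) * V * ρ ^ (-p) :=
    le_mul_of_one_le_right (by positivity) hρp
  calc ρ ^ (-(N : ℝ)) * ((K / L) ^ (p - 1) * V + (K / L) ^ (p - 1) * ρ ^ (-p))
      ≤ ρ ^ (-(N : ℝ)) * ((K / L) ^ (p - 1) * V * ρ ^ (-p) + (K / L) ^ (p - 1) * ρ ^ (-p)) := by
        gcongr
    _ = _ := by ring

lemma compactlyInside_ball {Ω : Set (RN N)} {x₀ : RN N} {R : ℝ}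
    (h : Metric.closedBall x₀ R ⊆ Ω) : CompactlyInside (Metric.ball x₀ R) Ω := by
  have h1 : closure (Metric.ball x₀ R) ⊆ Metric.closedBall x₀ R :=
    Metric.closure_ball_subset_closedBall
  exact ⟨Metric.isOpen_ball, (isCompact_closedBall x₀ R).of_isClosed_subset isClosed_closure h1,
    h1.trans h⟩

/-- Normalization of a weak solution on a small ball. -/
lemma exists_isUnitSolution (hN : 0 < N) {s₁ s p : ℝ} (hs₁ : s₁ ∈ Ioo (0 : ℝ) 1)
    (hs : s ∈ Ioo (0 : ℝ) 1) (hp : 2 ≤ p) (hsp : p - 1 < s * p) {Ω : Set (RN N)} {u : RN N → ℝ}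
    (hu : IsWeakSolution s₁ s p Ω u) {x₀ z : RN N} {R ρ K L : ℝ} (hR : R < 1) (hρ : 0 < ρ)
    (hz : ‖z - x₀‖ + ρ ≤ R) (hΩ : Metric.closedBall x₀ R ⊆ Ω) (hK : 1 ≤ K)
    (hKu : supTail s p u x₀ R + gagliardo s p (Metric.ball x₀ R) u ≤ ENNReal.ofReal K)
    (hL : L = K * ((volume (Metric.ball (0 : RN N) 1)).toReal + 1) * ρ ^ (-((N : ℝ) + p))) :
    ∃ μ ∈ Icc (0 : ℝ) 1, ∃ v Z, IsUnitSolution s₁ s p μ v Z ∧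
      v =ᵐ[volume] fun x => u (z + ρ • x) / L := by
  classical
  obtain ⟨hu1, hup, hut, Z, hZ, hZs, hweak⟩ := hu
  set C₀ := (volume (Metric.ball (0 : RN N) 1)).toReal + 1 with hC₀
  have hC₀1 : 1 ≤ C₀ := by
    rw [hC₀]
    exact le_add_of_nonneg_left ENNReal.toReal_nonneg
  have hK0 : 0 < K := by linarith
  have hρR : ρ ≤ R := by linarith [norm_nonneg (z - x₀)]
  have hρ1 : ρ ≤ 1 := by linarith
  have hρN : 1 ≤ ρ ^ (-((N : ℝ) + p)) :=
    Real.one_le_rpow_of_pos_of_le_one_of_nonpos hρ hρ1 (by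
      have : (0 : ℝ) ≤ N := by positivity
      linarith)
  have hKL : K ≤ L := by
    rw [hL, mul_assoc]
    exact le_mul_of_one_le_right hK0.le (one_le_mul_of_one_le_of_one_le hC₀1 hρN)
  have hL1 : 1 ≤ L := hK.trans hKL
  have hL0 : 0 < L := by linarith
  have hKL0 : 0 ≤ K / L := by positivity
  have hKL1 : K / L ≤ 1 := (div_le_one hL0).2 hKL
  -- L is chosen for this identity. As K/L ≤ 1, the powers p-1 and p of K/L are at most K/L, so the
  -- same identity bounds both the tail and the energy by one.
  have hKLeq : K / L * ρ ^ (-((N : ℝ) + p)) * C₀ = 1 := by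
    have : ρ ^ (-((N : ℝ) + p)) ≠ 0 := by positivity
    rw [hL]; field_simp
  set B := Metric.ball x₀ R with hB
  have hBm : MeasurableSet B := Metric.isOpen_ball.measurableSet
  have hBΩ : CompactlyInside B Ω := compactlyInside_ball hΩ
  have hsup : eLpNorm u ∞ (volume.restrict B) ≤ ENNReal.ofReal K :=
    (le_self_add.trans le_self_add).trans hKu
  have htail : tail s p u x₀ R ≤ ENNReal.ofReal K := (le_add_self.trans le_self_add).trans hKu
  have hgag : gagliardo s p B u ≤ ENNReal.ofReal K := le_add_self.trans hKu
  have hum : AEMeasurable u := aemeasurable_of_memTailSpace hut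
  have hen : genergy s p B u ≤ ENNReal.ofReal (K ^ p) :=
    le_ofReal_rpow_of_rpow_le (by linarith) hK0.le (by rwa [← gagliardo_eq hum.restrict])
  have hen1 : genergy s₁ 1 B u < ∞ := by
    have := (hu1 B hBΩ).2
    rwa [gagliardo_eq hum.restrict, one_div_one, ENNReal.rpow_one] at this
  have hbd : ∀ᵐ x, x ∈ B → |u x| ≤ K := ae_abs_le_of_eLpNorm_top_le hBm hK0.le hsup
  have hmaps : ∀ x ∈ Metric.ball (0 : RN N) 1, z + ρ • x ∈ B := by
    intro x hx
    have hx' : ‖x‖ < 1 := by simpa using hx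
    rw [hB, mem_ball_iff_norm, show z + ρ • x - x₀ = (z - x₀) + ρ • x by abel]
    refine (norm_add_le _ _).trans_lt ?_
    rw [norm_smul, Real.norm_of_nonneg hρ.le]
    nlinarith
  set w : RN N → ℝ := fun x => u (z + ρ • x) / L with hw
  -- A measurable representative, truncated on the unit ball so that the bound by one holds at every
  -- point and not just almost everywhere.
  set v : RN N → ℝ := (Metric.ball (0 : RN N) 1).piecewise
    (fun x => max (-1) (min 1 (hum.mk u (z + ρ • x) / L))) (fun x => hum.mk u (z + ρ • x) / L)
    with hv
  have hq := quasiMeasurePreserving_affine (ν := (volume : Measure (RN N))) z hρ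
  have hvw : v =ᵐ[volume] w := by
    filter_upwards [hq.ae hbd, hq.ae hum.ae_eq_mk] with x hx1 hx2
    by_cases hx : x ∈ Metric.ball (0 : RN N) 1
    · have h1 : |u (z + ρ • x) / L| ≤ 1 := by
        rw [abs_div, abs_of_pos hL0]
        exact (div_le_div_of_nonneg_right (hx1 (hmaps x hx)) hL0.le).trans hKL1
      rw [hv, piecewise_eq_of_mem _ _ _ hx, ← hx2, min_eq_right (abs_le.1 h1).2,
        max_eq_right (abs_le.1 h1).1]
    · rw [hv, piecewise_eq_of_notMem _ _ _ hx, ← hx2]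
  have hq2 := quasiMeasurePreserving_affine (ν := (volume : Measure (RN N × RN N))) (z, z) hρ
  -- Under the rescaling the sign integral acquires ρ^(s₁-N) and the p-integral ρ^(sp-N) L^(-(p-1));
  -- μ is the quotient of the second factor by the first. It is at most one because sp > p - 1 ≥ 1 >
  -- s₁ and L ≥ 1.
  refine ⟨ρ ^ (s * p - s₁) * (L ^ (p - 1))⁻¹, ⟨by positivity, ?_⟩, v,
    fun y => Z ((z, z) + ρ • y), ?_, hvw⟩
  · refine mul_le_one₀ (Real.rpow_le_one hρ.le hρ1 (by linarith [hs₁.2])) (by positivity) ?_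
    exact inv_le_one_of_one_le₀ (Real.one_le_rpow hL1 (by linarith))
  have hmk : Measurable (fun x => hum.mk u (z + ρ • x) / L) := by
    have := hum.measurable_mk
    fun_prop
  refine ⟨?_, ?_, ?_, ?_, ?_, ?_, ?_, ?_⟩
  · exact Measurable.piecewise Metric.isOpen_ball.measurableSet
      (measurable_const.max (measurable_const.min hmk)) hmk
  · intro x hx
    rw [hv, piecewise_eq_of_mem _ _ _ hx, abs_le]
    exact ⟨le_max_left _ _, max_le (by norm_num) (min_le_left _ _)⟩
  · have h1 : ∫⁻ x, tdens s p v x = ∫⁻ x, tdens s p w x :=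
      lintegral_congr_ae (by filter_upwards [hvw] with x hx; rw [tdens, tdens, hx])
    rw [h1]
    refine (lintegral_tdens_affine_le hN hs hp hR hρ hz hK0.le hL0 hbd htail).trans ?_
    rw [ENNReal.ofReal_le_one]
    refine le_trans ?_ hKLeq.le
    gcongr
    exact Real.rpow_le_self_of_le_one hKL0 hKL1 (by linarith)
  · rw [genergy_congr hvw, hw, genergy_div hL0]
    refine ENNReal.mul_lt_top ENNReal.ofReal_lt_top ?_
    exact (genergy_affine z hρ Metric.isOpen_ball.measurableSet hBm hmaps u).trans_lt
      (ENNReal.mul_lt_top ENNReal.ofReal_lt_top hen1)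
  · rw [genergy_congr hvw, hw, genergy_div hL0]
    refine (mul_le_mul_right ((genergy_affine z hρ Metric.isOpen_ball.measurableSet hBm hmaps
      u).trans (mul_le_mul_right hen _)) _).trans ?_
    rw [← ENNReal.ofReal_mul (by positivity), ← ENNReal.ofReal_mul (by positivity),
      ENNReal.ofReal_le_one]
    have h1 : ρ ^ (s * p - N) ≤ ρ ^ (-((N : ℝ) + p)) :=
      Real.rpow_le_rpow_of_exponent_ge hρ hρ1 (by nlinarith [hs.1])
    calc (L ^ p)⁻¹ * (ρ ^ (s * p - N) * K ^ p)
        = (K / L) ^ p * ρ ^ (s * p - N) := by rw [Real.div_rpow hK0.le hL0.le]; ring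
      _ ≤ K / L * ρ ^ (-((N : ℝ) + p)) := by
          gcongr
          exact Real.rpow_le_self_of_le_one hKL0 hKL1 (by linarith)
      _ ≤ K / L * ρ ^ (-((N : ℝ) + p)) * C₀ :=
          le_mul_of_one_le_right (by positivity) hC₀1
      _ = 1 := hKLeq
  · exact hZ.1.aemeasurable.comp_quasiMeasurePreserving hq2
  · filter_upwards [hq2.ae hZs, ae_prod_of_ae hvw] with y hy hvy
    rw [hvy.1, hvy.2, hw]
    simp only
    rwa [← sub_div, sgn_div hL0]
  · intro φ hφ hφb hφs hφ1 hφp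
    have hball : Metric.closedBall z ρ ⊆ Ω := by
      refine (Metric.closedBall_subset_closedBall' ?_).trans hΩ
      rw [dist_eq_norm]; linarith
    have heq := hweak _ (isTestFunction_comp_affine (s₁ := s₁) (s := s) (p := p) (by linarith) hρ
      hball hφ hφb hφs hφ1 hφp)
    have h1 := integral_weak_affine Z φ z hρ ((N : ℝ) + s₁)
    have h2 := integral_weak_affine (fun y => jpow (p - 2) (u y.1 - u y.2)) φ z hρ
      ((N : ℝ) + s * p)
    have h3 : ∫ y : RN N × RN N, jpow (p - 2) (v y.1 - v y.2) * (φ y.1 - φ y.2) /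
        ‖y.1 - y.2‖ ^ ((N : ℝ) + s * p) = (L ^ (p - 1))⁻¹ * ∫ y : RN N × RN N,
        jpow (p - 2) (u ((z, z) + ρ • y).1 - u ((z, z) + ρ • y).2) * (φ y.1 - φ y.2) /
        ‖y.1 - y.2‖ ^ ((N : ℝ) + s * p) := by
      rw [← integral_const_mul]
      refine integral_congr_ae ?_
      filter_upwards [ae_prod_of_ae hvw] with y hy
      rw [hy.1, hy.2, hw]
      simp only
      rw [← sub_div, jpow_div hL0, show p - 2 + 1 = p - 1 by ring]
      simp only [Prod.fst_add, Prod.snd_add, Prod.smul_fst, Prod.smul_snd]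
      ring
    have h4 : ρ ^ (s * p - s₁) * ρ ^ ((N : ℝ) + s₁) = ρ ^ ((N : ℝ) + s * p) := by
      rw [← Real.rpow_add hρ]; congr 1; ring
    rw [h3, h1, h2]
    simp only [jpow]
    calc _ = (L ^ (p - 1))⁻¹ * (ρ ^ (N + N))⁻¹ *
          ((ρ ^ (s * p - s₁) * ρ ^ ((N : ℝ) + s₁)) * (∫ y : RN N × RN N, Z y *
            (φ (-(ρ⁻¹ • z) + ρ⁻¹ • y.1) - φ (-(ρ⁻¹ • z) + ρ⁻¹ • y.2)) /
              ‖y.1 - y.2‖ ^ ((N : ℝ) + s₁)) + ρ ^ ((N : ℝ) + s * p) * (∫ y : RN N × RN N,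
            |u y.1 - u y.2| ^ (p - 2) * (u y.1 - u y.2) *
            (φ (-(ρ⁻¹ • z) + ρ⁻¹ • y.1) - φ (-(ρ⁻¹ • z) + ρ⁻¹ • y.2)) /
              ‖y.1 - y.2‖ ^ ((N : ℝ) + s * p))) := by ring
      _ = 0 := by rw [h4, ← mul_add, heq, mul_zero, mul_zero]

/-! ### Translation estimates for weak solutions -/

/-- Averaging of integrals over small balls. -/
lemma lintegral_mul_volume_ball_le {f : RN N → ℝ≥0∞} (hf : Measurable f) {x₀ : RN N} {r δ : ℝ}
    {M : ℝ≥0∞} (hf0 : ∀ x ∉ Metric.ball x₀ r, f x = 0)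
    (hM : ∀ y ∈ Metric.ball x₀ (r + δ), ∫⁻ x in Metric.ball y δ, f x ≤ M) :
    (∫⁻ x, f x) * volume (Metric.ball (0 : RN N) δ) ≤ M * volume (Metric.ball x₀ (r + δ)) := by
  -- Integrating f over pairs at distance less than δ in either order compares the full integral
  -- with integrals over small balls, in place of a covering argument.
  set k : RN N → ℝ≥0∞ := (Metric.ball (0 : RN N) δ).indicator 1 with hk
  have hkm : Measurable k := measurable_ball_indicator_one _
  have hkv : ∫⁻ x, k x = volume (Metric.ball (0 : RN N) δ) :=
    lintegral_indicator_one Metric.isOpen_ball.measurableSet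
  rw [← hkv, ← lintegral_mul_conv hf hkm, Measure.volume_eq_prod,
    lintegral_prod_symm _ (by fun_prop), ← setLIntegral_const,
    ← lintegral_indicator Metric.isOpen_ball.measurableSet]
  refine lintegral_mono fun y => ?_
  simp only
  have h1 : ∫⁻ x, f x * k (x - y) = ∫⁻ x in Metric.ball y δ, f x := by
    rw [← lintegral_indicator Metric.isOpen_ball.measurableSet]
    refine lintegral_congr fun x => ?_
    by_cases hx : x ∈ Metric.ball y δ
    · have : x - y ∈ Metric.ball (0 : RN N) δ := by simpa [dist_eq_norm] using hx
      simp [hk, hx, this]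
    · have : x - y ∉ Metric.ball (0 : RN N) δ := by simpa [dist_eq_norm] using hx
      simp [hk, hx, this]
  by_cases hy : y ∈ Metric.ball x₀ (r + δ)
  · rw [indicator_of_mem hy, h1]
    exact hM y hy
  · rw [indicator_of_notMem hy, h1]
    refine le_of_eq (setLIntegral_eq_zero Metric.isOpen_ball.measurableSet fun x hx => hf0 x ?_)
    intro hx'
    apply hy
    rw [Metric.mem_ball] at hx hx' ⊢
    rw [dist_comm] at hx
    linarith [dist_triangle y x x₀]

/-- The bound on translations for weak solutions. -/
lemma exists_lintegral_diff_weakSolution_le (hN : 0 < N) {s₁ s p q : ℝ}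
    (hs₁ : s₁ ∈ Ioo (0 : ℝ) 1) (hs : s ∈ Ioo (0 : ℝ) 1) (hp : 2 ≤ p) (hsp : p - 1 < s * p)
    (hq : p ≤ q) :
    ∃ C κ : ℝ, 0 < C ∧ 0 < κ ∧ ∀ (Ω : Set (RN N)) (u : RN N → ℝ), IsWeakSolution s₁ s p Ω u →
      ∀ (x₀ : RN N) (R r K : ℝ), R ∈ Ioo (0 : ℝ) 1 → r ∈ Ioo 0 R → Metric.closedBall x₀ R ⊆ Ω →
      1 ≤ K → supTail s p u x₀ R + gagliardo s p (Metric.ball x₀ R) u ≤ ENNReal.ofReal K →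
      ∀ h : RN N, 0 < ‖h‖ → ‖h‖ < (R - r) / 4 →
      ∫⁻ x in Metric.ball x₀ r, ENNReal.ofReal (|diff h u x| ^ q) ≤
        ENNReal.ofReal (C * K ^ q / (R - r) ^ κ * ‖h‖ ^ q) := by
  obtain ⟨C₁, hC₁, hmain⟩ := diffBound_one_of_le hN hs₁ hs hp hsp hq (1 / 2) (by norm_num)
  have hq0 : 0 < q := by linarith
  set C₀ := (volume (Metric.ball (0 : RN N) 1)).toReal + 1 with hC₀
  have hC₀0 : 0 < C₀ := by
    rw [hC₀]
    exact add_pos_of_nonneg_of_pos ENNReal.toReal_nonneg one_pos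
  -- The factor L^q contributes (N+p)q powers of 1/ρ and the rescaled step h/ρ contributes q. The
  -- Jacobian ρ^N cancels the power from averaging over balls.
  set κ : ℝ := ((N : ℝ) + p) * q + q with hκ
  refine ⟨2 ^ κ * (2 ^ (N : ℝ) * C₀ ^ q * (C₁.toReal + 1)), κ, ?_, ?_, ?_⟩
  · have : 0 < C₁.toReal + 1 := add_pos_of_nonneg_of_pos ENNReal.toReal_nonneg one_pos
    positivity
  · have : 0 < p := by linarith
    positivity
  intro Ω u hu x₀ R r K hR hr hΩ hK hKu h hh0 hh
  -- Centres z in the ball of radius r + ρ/2 satisfy |z - x₀| + ρ < R, and |h| < (R-r)/4 becomes a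
  -- step shorter than 1/2 after rescaling, as the unit estimate at radius 1/2 requires.
  set ρ : ℝ := (R - r) / 2 with hρ
  have hρ0 : 0 < ρ := by rw [hρ]; linarith [hr.2]
  have hK0 : 0 < K := by linarith
  set L := K * C₀ * ρ ^ (-((N : ℝ) + p)) with hL
  have hL0 : 0 < L := by positivity
  set g : RN N → ℝ≥0∞ := fun x => ENNReal.ofReal (|diff h u x| ^ q) with hg
  have hball : ∀ z ∈ Metric.ball x₀ (r + ρ / 2), ∫⁻ x in Metric.ball z (ρ / 2), g x ≤
      ENNReal.ofReal (ρ ^ N * L ^ q * (‖h‖ / ρ) ^ q) * C₁ := by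
    intro z hz
    have hz' : ‖z - x₀‖ < r + ρ / 2 := by simpa [dist_eq_norm] using hz
    obtain ⟨μ, hμ, v, Z, hv, hvu⟩ := exists_isUnitSolution hN hs₁ hs hp hsp hu (z := z) hR.2 hρ0
      (by linarith) hΩ hK hKu hL
    have hh' : ‖ρ⁻¹ • h‖ = ‖h‖ / ρ := by
      rw [norm_smul, norm_inv, Real.norm_of_nonneg hρ0.le, inv_mul_eq_div]
    have h1 := hmain μ hμ v Z hv (ρ⁻¹ • h) (by rw [hh']; positivity)
      (by rw [hh', div_lt_iff₀ hρ0]; linarith)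
    have hshift : ∀ᵐ x : RN N, v (x + ρ⁻¹ • h) = u (z + ρ • (x + ρ⁻¹ • h)) / L :=
      (measurePreserving_add_right volume (ρ⁻¹ • h)).quasiMeasurePreserving.ae hvu
    have h2 : ∫⁻ x in Metric.ball (0 : RN N) (1 / 2),
        ENNReal.ofReal (|diff (ρ⁻¹ • h) v x| ^ q) =
        ENNReal.ofReal ((L ^ q)⁻¹) * ∫⁻ x in Metric.ball (0 : RN N) (1 / 2), g (z + ρ • x) := by
      rw [← lintegral_const_mul' _ _ ENNReal.ofReal_ne_top]
      refine lintegral_congr_ae (ae_restrict_of_ae ?_)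
      filter_upwards [hvu, hshift] with x hx1 hx2
      simp only [hg, diff]
      rw [hx1, hx2, ← ENNReal.ofReal_mul (by positivity), ← sub_div, abs_div,
        abs_of_pos hL0, Real.div_rpow (abs_nonneg _) hL0.le, smul_add, smul_smul,
        mul_inv_cancel₀ hρ0.ne', one_smul, ← add_assoc, div_eq_inv_mul]
    have h3 : ∫⁻ x in Metric.ball (0 : RN N) (1 / 2), g (z + ρ • x) =
        ENNReal.ofReal (ρ ^ N)⁻¹ * ∫⁻ x in Metric.ball z (ρ / 2), g x := by
      have := lintegral_comp_affine (ν := (volume : Measure (RN N))) z hρ0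
        ((Metric.ball z (ρ / 2)).indicator g)
      rw [finrank_euclideanSpace, Fintype.card_fin,
        lintegral_indicator Metric.isOpen_ball.measurableSet] at this
      rw [← this, ← lintegral_indicator Metric.isOpen_ball.measurableSet]
      refine lintegral_congr fun x => ?_
      have hiff : z + ρ • x ∈ Metric.ball z (ρ / 2) ↔ x ∈ Metric.ball (0 : RN N) (1 / 2) := by
        rw [mem_ball_iff_norm, mem_ball_zero_iff, add_sub_cancel_left, norm_smul,
          Real.norm_of_nonneg hρ0.le, div_eq_mul_one_div ρ, mul_lt_mul_iff_right₀ hρ0]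
      by_cases hx : x ∈ Metric.ball (0 : RN N) (1 / 2)
      · rw [indicator_of_mem hx, indicator_of_mem (hiff.2 hx)]
      · rw [indicator_of_notMem hx, indicator_of_notMem (fun hx' => hx (hiff.1 hx'))]
    rw [h2, h3, hh', one_mul] at h1
    calc ∫⁻ x in Metric.ball z (ρ / 2), g x
        = ENNReal.ofReal (ρ ^ N * L ^ q) * (ENNReal.ofReal ((L ^ q)⁻¹) *
          (ENNReal.ofReal (ρ ^ N)⁻¹ * ∫⁻ x in Metric.ball z (ρ / 2), g x)) := by
          rw [← mul_assoc, ← mul_assoc, ← ENNReal.ofReal_mul (by positivity),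
            ← ENNReal.ofReal_mul (by positivity)]
          have : ρ ^ N * L ^ q * (L ^ q)⁻¹ * (ρ ^ N)⁻¹ = 1 := by field_simp
          rw [this, ENNReal.ofReal_one, one_mul]
      _ ≤ ENNReal.ofReal (ρ ^ N * L ^ q) * (C₁ * ENNReal.ofReal ((‖h‖ / ρ) ^ q)) := by gcongr
      _ = _ := by
        rw [ENNReal.ofReal_mul (p := ρ ^ N * L ^ q) (by positivity)]
        ring
  have hum : AEMeasurable u := aemeasurable_of_memTailSpace hu.2.2.1
  have hmk := hum.measurable_mk
  set f : RN N → ℝ≥0∞ := (Metric.ball x₀ r).indicator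
    (fun x => ENNReal.ofReal (|diff h (hum.mk u) x| ^ q)) with hf
  have hgae : ∀ᵐ x, ENNReal.ofReal (|diff h (hum.mk u) x| ^ q) = g x := by
    have hshift : ∀ᵐ x : RN N, u (x + h) = hum.mk u (x + h) :=
      (measurePreserving_add_right volume h).quasiMeasurePreserving.ae hum.ae_eq_mk
    filter_upwards [hum.ae_eq_mk, hshift] with x hx1 hx2
    simp only [hg, diff]
    rw [hx1, hx2]
  have hfint : ∫⁻ x, f x = ∫⁻ x in Metric.ball x₀ r, g x := by
    rw [hf, lintegral_indicator Metric.isOpen_ball.measurableSet]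
    exact lintegral_congr_ae (ae_restrict_of_ae hgae)
  have hfm : Measurable f := by
    refine Measurable.indicator ?_ Metric.isOpen_ball.measurableSet
    have := measurable_diff (h := h) hmk
    fun_prop
  have havg := lintegral_mul_volume_ball_le hfm (x₀ := x₀) (r := r) (δ := ρ / 2)
    (M := ENNReal.ofReal (ρ ^ N * L ^ q * (‖h‖ / ρ) ^ q) * C₁)
    (fun x hx => indicator_of_notMem hx _) (fun y hy => by
      refine le_trans (lintegral_mono_ae (ae_restrict_of_ae ?_)) (hball y hy)
      filter_upwards [hgae] with x hx
      rw [← hx]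
      exact indicator_le_self _ _ _)
  set V := volume (Metric.ball (0 : RN N) 1) with hV
  have hV0 : V ≠ 0 := (Metric.measure_ball_pos volume _ one_pos).ne'
  have hVt : V ≠ ∞ := measure_ball_lt_top.ne
  have hVr : volume (Metric.ball x₀ (r + ρ / 2)) ≤ V := by
    rw [hV, Measure.addHaar_ball_center]
    exact measure_mono (Metric.ball_subset_ball (by linarith [hR.2]))
  rw [hfint, volume_ball_zero hN (by positivity), ← hV, ← mul_assoc] at havg
  have h5 := (ENNReal.mul_le_mul_iff_left hV0 hVt).1 (havg.trans (mul_le_mul_right hVr _))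
  calc ∫⁻ x in Metric.ball x₀ r, g x
      = ENNReal.ofReal ((ρ / 2) ^ (-(N : ℝ))) *
        ((∫⁻ x in Metric.ball x₀ r, g x) * ENNReal.ofReal ((ρ / 2) ^ (N : ℝ))) := by
        rw [mul_left_comm, ← ENNReal.ofReal_mul (by positivity),
          ← Real.rpow_add (by positivity)]
        simp
    _ ≤ ENNReal.ofReal ((ρ / 2) ^ (-(N : ℝ))) *
        (ENNReal.ofReal (ρ ^ N * L ^ q * (‖h‖ / ρ) ^ q) * ENNReal.ofReal (C₁.toReal + 1)) := by
        refine mul_le_mul_right (h5.trans (mul_le_mul_right ?_ _)) _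
        rw [ENNReal.le_ofReal_iff_toReal_le hC₁.ne (by positivity)]
        linarith
    _ ≤ _ := by
        rw [← ENNReal.ofReal_mul (by positivity), ← ENNReal.ofReal_mul (by positivity)]
        apply ENNReal.ofReal_le_ofReal
        have hRr : R - r = 2 * ρ := by rw [hρ]; ring
        have e1 : (ρ / 2) ^ (-(N : ℝ)) = 2 ^ (N : ℝ) * ρ ^ (-(N : ℝ)) := by
          rw [Real.div_rpow hρ0.le (by norm_num), Real.rpow_neg (by norm_num : (0 : ℝ) ≤ 2)]
          field_simp
        have e2 : L ^ q = K ^ q * C₀ ^ q * ρ ^ (-((N : ℝ) + p) * q) := by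
          rw [hL, Real.mul_rpow (by positivity) (by positivity),
            Real.mul_rpow hK0.le hC₀0.le, ← Real.rpow_mul hρ0.le]
        have e3 : (‖h‖ / ρ) ^ q = ‖h‖ ^ q * ρ ^ (-q) := by
          rw [Real.div_rpow (norm_nonneg _) hρ0.le, Real.rpow_neg hρ0.le, div_eq_mul_inv]
        have e4 : (R - r) ^ κ = 2 ^ κ * ρ ^ κ := by
          rw [hRr, Real.mul_rpow (by norm_num) hρ0.le]
        have e5 : ρ ^ (-(N : ℝ)) * ρ ^ N * ρ ^ (-((N : ℝ) + p) * q) * ρ ^ (-q) = (ρ ^ κ)⁻¹ := by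
          rw [← Real.rpow_natCast, ← Real.rpow_add hρ0, ← Real.rpow_add hρ0,
            ← Real.rpow_add hρ0, ← Real.rpow_neg hρ0.le, hκ]
          congr 1; ring
        have h2κ : (2 : ℝ) ^ κ ≠ 0 := by positivity
        apply le_of_eq
        rw [e1, e2, e3, e4]
        calc _ = 2 ^ (N : ℝ) * C₀ ^ q * (C₁.toReal + 1) * K ^ q * ‖h‖ ^ q *
              (ρ ^ (-(N : ℝ)) * ρ ^ N * ρ ^ (-((N : ℝ) + p) * q) * ρ ^ (-q)) := by ring
          _ = _ := by rw [e5]; field_simp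

/-! ### Weak limits of difference quotients -/

section WeakLimit

open Filter Topology

/-- Bounded families in a Hilbert space converge weakly along ultrafilters. -/
lemma exists_weak_limit {ι H : Type*} [NormedAddCommGroup H] [InnerProductSpace ℝ H]
    [CompleteSpace H] (F : Ultrafilter ι) {f : ι → H} {C : ℝ} (hf : ∀ᶠ t in F, ‖f t‖ ≤ C) :
    ∃ g : H, ∀ φ : H, Tendsto (fun t => inner ℝ (f t) φ) F (𝓝 (inner ℝ g φ)) := by
  have hcomp := WeakDual.isCompact_closedBall (𝕜 := ℝ) (E := H) 0 C
  set T : ι → WeakDual ℝ H := fun t => StrongDual.toWeakDual (InnerProductSpace.toDual ℝ H (f t))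
    with hT
  have hmem : ∀ᶠ t in F, T t ∈ WeakDual.toStrongDual ⁻¹' Metric.closedBall 0 C := by
    filter_upwards [hf] with t ht
    simpa [hT] using ht
  obtain ⟨ℓ, -, hℓ⟩ := hcomp.ultrafilter_le_nhds (F.map T)
    (le_principal_iff.2 (mem_map.2 hmem))
  refine ⟨(InnerProductSpace.toDual ℝ H).symm (WeakDual.toStrongDual ℓ), fun φ => ?_⟩
  have h1 : Tendsto T F (𝓝 ℓ) := hℓ
  have h2 := ((WeakDual.eval_continuous φ).tendsto ℓ).comp h1
  rw [InnerProductSpace.toDual_symm_apply]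
  exact h2

/-- Families bounded in `L²` converge weakly along ultrafilters. -/
lemma exists_weak_limit_integral {ι α : Type*} [MeasurableSpace α] {ν : Measure α}
    (F : Ultrafilter ι) {f : ι → α → ℝ} {C : ℝ≥0∞} (hC : C ≠ ∞)
    (hf : ∀ᶠ t in F, MemLp (f t) 2 ν ∧ eLpNorm (f t) 2 ν ≤ C) :
    ∃ g : α → ℝ, MemLp g 2 ν ∧ ∀ φ : α → ℝ, MemLp φ 2 ν →
      Tendsto (fun t => ∫ x, f t x * φ x ∂ν) F (𝓝 (∫ x, g x * φ x ∂ν)) := by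
  classical
  set T : ι → Lp ℝ 2 ν := fun t => if h : MemLp (f t) 2 ν then h.toLp (f t) else 0 with hT
  have hTb : ∀ᶠ t in F, ‖T t‖ ≤ C.toReal := by
    filter_upwards [hf] with t ht
    simp only [hT, dif_pos ht.1, Lp.norm_toLp]
    exact ENNReal.toReal_mono hC ht.2
  obtain ⟨g, hg⟩ := exists_weak_limit F hTb
  refine ⟨g, Lp.memLp g, fun φ hφ => ?_⟩
  have h1 := hg (hφ.toLp φ)
  have h2 : inner ℝ g (hφ.toLp φ) = ∫ x, g x * φ x ∂ν := by
    rw [L2.inner_def]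
    refine integral_congr_ae ?_
    filter_upwards [hφ.coeFn_toLp] with x hx
    rw [hx]; simp [mul_comm]
  rw [h2] at h1
  refine h1.congr' ?_
  filter_upwards [hf] with t ht
  rw [L2.inner_def]
  refine integral_congr_ae ?_
  simp only [hT, dif_pos ht.1]
  filter_upwards [hφ.coeFn_toLp, ht.1.coeFn_toLp] with x hx hx'
  rw [hx, hx']; simp [mul_comm]

/-- Lower semicontinuity of the `L^q` norm under weak convergence. -/
lemma lintegral_rpow_le_of_weak_limit {ι α : Type*} [MeasurableSpace α] {ν : Measure α}
    [IsFiniteMeasure ν] (F : Ultrafilter ι) {f : ι → α → ℝ} {q M : ℝ} (hq : 2 ≤ q) (hM : 0 ≤ M)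
    {g : α → ℝ} (hg : Measurable g)
    (hf : ∀ᶠ t in F, MemLp (f t) (ENNReal.ofReal q) ν ∧
      ∫⁻ x, ENNReal.ofReal (|f t x| ^ q) ∂ν ≤ ENNReal.ofReal M)
    (hlim : ∀ φ : α → ℝ, MemLp φ 2 ν →
      Tendsto (fun t => ∫ x, f t x * φ x ∂ν) F (𝓝 (∫ x, g x * φ x ∂ν))) :
    ∫⁻ x, ENNReal.ofReal (|g x| ^ q) ∂ν ≤ ENNReal.ofReal M := by
  have hq0 : 0 < q := by linarith
  have hq' : q.HolderConjugate (q / (q - 1)) := Real.HolderConjugate.conjExponent (by linarith)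
  set S : ℕ → Set α := fun k => {x | |g x| ≤ k} with hS
  have hSm : ∀ k, MeasurableSet (S k) := fun k =>
    measurableSet_le (by fun_prop) measurable_const
  -- The dual function |g|^(q-2) g, truncated to be bounded and hence an admissible L² test
  -- function. The product gφ is G, so Young's inequality in the limit reads ∫G ≤ M/q + (1 - 1/q)∫G
  -- with ∫G finite. Absorption gives ∫G ≤ M, and k tends to infinity by monotone convergence.
  set φ : ℕ → α → ℝ := fun k => (S k).indicator (fun x => jpow (q - 2) (g x)) with hφ
  have hφm : ∀ k, Measurable (φ k) := fun k =>
    ((measurable_jpow _).comp hg).indicator (hSm k)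
  set G : ℕ → α → ℝ := fun k => (S k).indicator (fun x => |g x| ^ q) with hG
  have hGm : ∀ k, Measurable (G k) := fun k => Measurable.indicator (by fun_prop) (hSm k)
  have hG0 : ∀ k x, 0 ≤ G k x := fun k x => indicator_nonneg (fun _ _ => by positivity) _
  have hGb : ∀ k x, ‖G k x‖ ≤ (k : ℝ) ^ q := by
    intro k x
    rw [Real.norm_of_nonneg (hG0 k x)]
    by_cases hx : x ∈ S k
    · simp only [hG, indicator_of_mem hx]
      exact Real.rpow_le_rpow (abs_nonneg _) hx hq0.le
    · simp only [hG, indicator_of_notMem hx]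
      positivity
  have habs : ∀ t : ℝ, |jpow (q - 2) t| = |t| ^ (q - 1) := fun t => by
    rw [abs_jpow (by linarith)]; congr 1; ring
  have hφG : ∀ k x, |φ k x| ^ (q / (q - 1)) = G k x := by
    intro k x
    have hq1 : q - 1 ≠ 0 := by linarith
    by_cases hx : x ∈ S k
    · simp only [hφ, hG, indicator_of_mem hx, habs]
      rw [← Real.rpow_mul (abs_nonneg _), mul_div_cancel₀ _ hq1]
    · simp only [hφ, hG, indicator_of_notMem hx, abs_zero]
      exact Real.zero_rpow (div_ne_zero hq0.ne' hq1)
  have hgφ : ∀ k x, g x * φ k x = G k x := by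
    intro k x
    by_cases hx : x ∈ S k
    · simp only [hφ, hG, indicator_of_mem hx, jpow]
      have h1 : g x * (|g x| ^ (q - 2) * g x) = |g x| ^ (q - 2) * |g x| ^ (2 : ℝ) := by
        rw [Real.rpow_two, sq_abs]; ring
      rw [h1, ← Real.rpow_add' (abs_nonneg _) (by linarith)]
      congr 1; ring
    · simp only [hφ, hG, indicator_of_notMem hx, mul_zero]
  have hGi : ∀ k, Integrable (G k) ν := fun k =>
    Integrable.of_bound (hGm k).aestronglyMeasurable _ (ae_of_all _ (hGb k))
  have hφb : ∀ k x, ‖φ k x‖ ≤ (k : ℝ) ^ (q - 1) := by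
    intro k x
    rw [Real.norm_eq_abs]
    by_cases hx : x ∈ S k
    · simp only [hφ, indicator_of_mem hx, habs]
      exact Real.rpow_le_rpow (abs_nonneg _) hx (by linarith)
    · simp only [hφ, indicator_of_notMem hx, abs_zero]
      positivity
  have hφL : ∀ k, MemLp (φ k) 2 ν := fun k =>
    MemLp.of_bound (hφm k).aestronglyMeasurable _ (ae_of_all _ (hφb k))
  have hbound : ∀ k, ∫ x, G k x ∂ν ≤ M := by
    intro k
    have h1 := hlim _ (hφL k)
    simp only [hgφ] at h1
    have h2 : ∀ᶠ t in F, ∫ x, f t x * φ k x ∂ν ≤ M / q + (∫ x, G k x ∂ν) / (q / (q - 1)) := by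
      filter_upwards [hf] with t ht
      have hint : Integrable (fun x => |f t x| ^ q) ν := by
        have := ht.1.integrable_norm_rpow (by simpa using hq0) ENNReal.ofReal_ne_top
        simpa [ENNReal.toReal_ofReal hq0.le] using this
      have hfi : Integrable (f t) ν := ht.1.integrable (by simp; linarith)
      have h3 : ∫ x, |f t x| ^ q ∂ν ≤ M := by
        rw [integral_eq_lintegral_of_nonneg_ae (ae_of_all _ fun x => by positivity)
          hint.aestronglyMeasurable]
        exact ENNReal.toReal_le_of_le_ofReal hM ht.2
      calc ∫ x, f t x * φ k x ∂ν
          ≤ ∫ x, (|f t x| ^ q / q + G k x / (q / (q - 1))) ∂ν := by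
            refine integral_mono (hfi.mul_bdd (hφm k).aestronglyMeasurable
              (ae_of_all _ (hφb k))) ((hint.div_const _).add ((hGi k).div_const _)) fun x => ?_
            simp only
            rw [← hφG]
            exact Real.young_inequality _ _ hq'
        _ = (∫ x, |f t x| ^ q ∂ν) / q + (∫ x, G k x ∂ν) / (q / (q - 1)) := by
            rw [integral_add (hint.div_const _) ((hGi k).div_const _), integral_div,
              integral_div]
        _ ≤ _ := by gcongr
    have h4 := le_of_tendsto h1 h2
    have h5 : (∫ x, G k x ∂ν) / (q / (q - 1)) = (∫ x, G k x ∂ν) - (∫ x, G k x ∂ν) / q := by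
      have : q - 1 ≠ 0 := by linarith
      field_simp
    rw [h5] at h4
    have h6 : (∫ x, G k x ∂ν) / q ≤ M / q := by linarith
    rwa [div_le_div_iff_of_pos_right hq0] at h6
  have hmono : Monotone fun k x => ENNReal.ofReal (G k x) := by
    intro k l hkl x
    apply ENNReal.ofReal_le_ofReal
    refine indicator_le_indicator_of_subset (fun y hy => ?_) (fun y => by positivity) x
    exact (show |g y| ≤ k from hy).trans (by exact_mod_cast hkl)
  have hsup : ∀ x, ⨆ k, ENNReal.ofReal (G k x) = ENNReal.ofReal (|g x| ^ q) := by
    intro x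
    refine le_antisymm (iSup_le fun k => ENNReal.ofReal_le_ofReal
      (indicator_le_self' (fun _ _ => by positivity) x)) ?_
    obtain ⟨k, hk⟩ := exists_nat_ge |g x|
    refine le_iSup_of_le k (le_of_eq ?_)
    have : x ∈ S k := hk
    simp only [hG, indicator_of_mem this]
  simp_rw [← hsup]
  rw [lintegral_iSup (fun k => (hGm k).ennreal_ofReal) hmono]
  refine iSup_le fun k => ?_
  rw [← ofReal_integral_eq_lintegral_ofReal (hGi k) (ae_of_all _ (hG0 k))]
  exact ENNReal.ofReal_le_ofReal (hbound k)

end WeakLimit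

open Filter Topology in
/-- Discrete integration by parts in the limit. -/
lemma tendsto_integral_diff_div {U : Set (RN N)} (hU : IsOpen U) {u : RN N → ℝ}
    (hu : IntegrableOn u U) {φ : RN N → ℝ} (hφ : ContDiff ℝ ((⊤ : ℕ∞) : WithTop ℕ∞) φ)
    (hφc : HasCompactSupport φ) (hφU : tsupport φ ⊆ U) (e : RN N) :
    Tendsto (fun t : ℝ => ∫ x in U, diff (t • e) u x / t * φ x) (𝓝[>] 0)
      (𝓝 (-∫ x in U, u x * fderiv ℝ φ x e)) := by
  obtain ⟨δ, hδ, hδU⟩ := hφc.isCompact.exists_thickening_subset_open hU hφU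
  obtain ⟨C, hC⟩ := ContDiff.lipschitzWith_of_hasCompactSupport hφc hφ (by simp)
  obtain ⟨B, hB⟩ := hφc.exists_bound_of_continuous hφ.continuous
  set w : RN N → ℝ := U.indicator u with hw
  have hwi : Integrable w := (integrable_indicator_iff hU.measurableSet).2 hu
  have hφ0 : ∀ x ∉ U, φ x = 0 := fun x hx => image_eq_zero_of_notMem_tsupport fun h => hx (hφU h)
  have hsmall : ∀ᶠ t : ℝ in 𝓝[>] 0, t * ‖e‖ < δ := by
    have : Tendsto (fun t : ℝ => t * ‖e‖) (𝓝[>] 0) (𝓝 0) := by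
      have h : Tendsto (fun t : ℝ => t * ‖e‖) (𝓝 0) (𝓝 (0 * ‖e‖)) :=
        (continuous_id.mul continuous_const).tendsto 0
      rw [zero_mul] at h
      exact h.mono_left nhdsWithin_le_nhds
    exact this.eventually_lt_const hδ
  -- Once t‖e‖ is below the distance δ, the shifted support of φ stays in U, so u may be extended by
  -- zero. Translation invariance on the whole space then moves the difference quotient onto φ.
  have heq : ∀ᶠ t : ℝ in 𝓝[>] 0, ∫ x, w x * (t⁻¹ • (φ (x + t • (-e)) - φ x)) =
      ∫ x in U, diff (t • e) u x / t * φ x := by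
    filter_upwards [hsmall, self_mem_nhdsWithin] with t ht ht0
    have ht0' : (0 : ℝ) < t := ht0
    have h1 : ∫ x in U, diff (t • e) u x / t * φ x =
        ∫ x, (w (x + t • e) * φ x - w x * φ x) * t⁻¹ := by
      rw [← integral_indicator hU.measurableSet]
      refine integral_congr_ae (ae_of_all _ fun x => ?_)
      by_cases hx : x ∈ tsupport φ
      · have hx1 : x ∈ U := hφU hx
        have hx2 : x + t • e ∈ U := by
          apply hδU
          refine Metric.mem_thickening_iff.2 ⟨x, hx, ?_⟩
          rwa [dist_eq_norm, add_sub_cancel_left, norm_smul, Real.norm_of_nonneg ht0'.le]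
        simp only [hw, indicator_of_mem hx1, indicator_of_mem hx2, diff]
        ring
      · have : φ x = 0 := image_eq_zero_of_notMem_tsupport hx
        by_cases hxU : x ∈ U <;> simp [this, hxU]
    have hi1 : Integrable (fun x => w x * φ x) :=
      hwi.mul_bdd hφ.continuous.aestronglyMeasurable (ae_of_all _ hB)
    have hi2 : Integrable (fun x => w (x + t • e) * φ x) :=
      (hwi.comp_add_right (t • e)).mul_bdd hφ.continuous.aestronglyMeasurable (ae_of_all _ hB)
    have hi3 : Integrable (fun x => w x * φ (x + t • (-e))) :=
      hwi.mul_bdd (hφ.continuous.comp (continuous_add_const _)).aestronglyMeasurable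
        (ae_of_all _ fun x => hB _)
    have h2 : ∫ x, w (x + t • e) * φ x = ∫ x, w x * φ (x + t • (-e)) := by
      rw [← integral_add_right_eq_self (fun x => w x * φ (x + t • (-e))) (t • e)]
      refine integral_congr_ae (ae_of_all _ fun x => ?_)
      simp
    rw [h1, integral_mul_const, integral_sub hi2 hi1, h2, ← integral_sub hi3 hi1,
      ← integral_mul_const]
    refine integral_congr_ae (ae_of_all _ fun x => ?_)
    simp only [smul_eq_mul]
    ring
  refine Tendsto.congr' heq ?_
  have hlim : -∫ x in U, u x * fderiv ℝ φ x e = ∫ x, w x * fderiv ℝ φ x (-e) := by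
    rw [← integral_neg, ← integral_indicator hU.measurableSet]
    refine integral_congr_ae (ae_of_all _ fun x => ?_)
    by_cases hx : x ∈ U <;> simp [hw, hx]
  rw [hlim]
  refine tendsto_integral_filter_of_dominated_convergence (fun x => |w x| * (C * ‖e‖)) ?_ ?_
    (hwi.abs.mul_const _) ?_
  · refine Eventually.of_forall fun t => hwi.aestronglyMeasurable.mul ?_
    have := hφ.continuous
    exact Continuous.aestronglyMeasurable (by fun_prop)
  · filter_upwards [self_mem_nhdsWithin] with t ht
    refine ae_of_all _ fun x => ?_
    have ht' : (0 : ℝ) < t := ht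
    rw [norm_mul, Real.norm_eq_abs (w x), norm_smul, norm_inv, Real.norm_of_nonneg ht'.le]
    have h1 := hC.norm_sub_le (x + t • (-e)) x
    rw [add_sub_cancel_left, norm_smul, norm_neg, Real.norm_of_nonneg ht'.le] at h1
    refine mul_le_mul_of_nonneg_left ?_ (abs_nonneg _)
    rw [inv_mul_le_iff₀ ht']
    linarith
  · refine ae_of_all _ fun x => ?_
    have h1 : HasLineDerivAt ℝ φ (fderiv ℝ φ x (-e)) x (-e) :=
      ((hφ.differentiable (by simp)) x).hasFDerivAt.hasLineDerivAt _
    exact (h1.tendsto_slope_zero_right).const_mul _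

open Filter Topology in
/-- A weak directional derivative obtained from a bound on difference quotients. -/
lemma exists_weak_lineDeriv {U : Set (RN N)} (hU : IsOpen U) (hUv : volume U ≠ ∞) {u : RN N → ℝ}
    (hum : AEMeasurable u) (hu : IntegrableOn u U) {q M d : ℝ} (hq : 2 ≤ q) (hM : 0 ≤ M)
    (hd : 0 < d) (e : RN N)
    (hdiff : ∀ t ∈ Ioo 0 d, ∫⁻ x in U, ENNReal.ofReal (|diff (t • e) u x| ^ q) ≤
      ENNReal.ofReal (M * t ^ q)) :
    ∃ g : RN N → ℝ, Measurable g ∧ ∫⁻ x in U, ENNReal.ofReal (|g x| ^ q) ≤ ENNReal.ofReal M ∧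
      ∀ φ : RN N → ℝ, ContDiff ℝ ((⊤ : ℕ∞) : WithTop ℕ∞) φ → HasCompactSupport φ →
        tsupport φ ⊆ U → ∫ x in U, u x * fderiv ℝ φ x e = -∫ x in U, g x * φ x := by
  have hq0 : 0 < q := by linarith
  have : IsFiniteMeasure (volume.restrict U) := ⟨by
    rw [Measure.restrict_apply_univ]; exact hUv.lt_top⟩
  -- An ultrafilter finer than t → 0⁺ replaces the choice of a subsequence. Weak compactness in L²
  -- is enough because q ≥ 2 and U has finite measure; the L^q bound is recovered by lower
  -- semicontinuity.
  set F : Ultrafilter ℝ := Ultrafilter.of (𝓝[>] (0 : ℝ)) with hF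
  have hFle : (F : Filter ℝ) ≤ 𝓝[>] 0 := Ultrafilter.of_le _
  set f : ℝ → RN N → ℝ := fun t x => diff (t • e) u x / t with hf
  have hfm : ∀ t, AEMeasurable (f t) := fun t => by
    have h1 : AEMeasurable (fun x => u (x + t • e)) :=
      hum.comp_quasiMeasurePreserving (measurePreserving_add_right volume _).quasiMeasurePreserving
    exact (h1.sub hum).div_const _
  have hfl : ∀ t ∈ Ioo 0 d, ∫⁻ x in U, ENNReal.ofReal (|f t x| ^ q) ≤ ENNReal.ofReal M := by
    intro t ht
    have htq : 0 < t ^ q := Real.rpow_pos_of_pos ht.1 _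
    have h1 : ∀ x, ENNReal.ofReal (|f t x| ^ q) =
        ENNReal.ofReal ((t ^ q)⁻¹) * ENNReal.ofReal (|diff (t • e) u x| ^ q) := by
      intro x
      rw [hf, ← ENNReal.ofReal_mul (by positivity)]
      simp only
      rw [abs_div, abs_of_pos ht.1, Real.div_rpow (abs_nonneg _) ht.1.le, div_eq_inv_mul]
    simp_rw [h1]
    rw [lintegral_const_mul' _ _ ENNReal.ofReal_ne_top]
    refine (mul_le_mul_right (hdiff t ht) _).trans (le_of_eq ?_)
    rw [← ENNReal.ofReal_mul (by positivity)]
    congr 1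
    field_simp
  have hfe : ∀ t ∈ Ioo 0 d, eLpNorm (f t) (ENNReal.ofReal q) (volume.restrict U) ≤
      ENNReal.ofReal M ^ (1 / q) := by
    intro t ht
    have := hfl t ht
    rw [lintegral_ofReal_abs_rpow hq0] at this
    have h2 := ENNReal.rpow_le_rpow this (by positivity : 0 ≤ 1 / q)
    rwa [← ENNReal.rpow_mul, mul_one_div_cancel hq0.ne', ENNReal.rpow_one] at h2
  have hfq : ∀ t ∈ Ioo 0 d, MemLp (f t) (ENNReal.ofReal q) (volume.restrict U) := fun t ht =>
    ⟨(hfm t).restrict.aestronglyMeasurable, (hfe t ht).trans_lt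
      (ENNReal.rpow_lt_top_of_nonneg (by positivity) ENNReal.ofReal_ne_top)⟩
  have h2q : (2 : ℝ≥0∞) ≤ ENNReal.ofReal q := by
    rw [← ENNReal.ofReal_ofNat]; exact ENNReal.ofReal_le_ofReal hq
  have hev : ∀ᶠ t in F, t ∈ Ioo 0 d := hFle (Ioo_mem_nhdsGT hd)
  set C : ℝ≥0∞ := ENNReal.ofReal M ^ (1 / q) * (volume.restrict U) univ ^
    (1 / (2 : ℝ≥0∞).toReal - 1 / (ENNReal.ofReal q).toReal) with hC
  have hCt : C ≠ ∞ := by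
    refine ENNReal.mul_ne_top
      (ENNReal.rpow_ne_top_of_nonneg (by positivity) ENNReal.ofReal_ne_top)
      (ENNReal.rpow_ne_top_of_nonneg ?_ (measure_ne_top _ _))
    rw [ENNReal.toReal_ofReal hq0.le, ENNReal.toReal_ofNat, sub_nonneg]
    exact one_div_le_one_div_of_le two_pos hq
  obtain ⟨g, hg2, hglim⟩ := exists_weak_limit_integral (ν := volume.restrict U) F (f := f) hCt (by
    filter_upwards [hev] with t ht
    refine ⟨(hfq t ht).mono_exponent h2q, ?_⟩
    refine (eLpNorm_le_eLpNorm_mul_rpow_measure_univ h2q (hfq t ht).1).trans ?_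
    exact mul_le_mul_left (hfe t ht) _)
  have hgm : AEMeasurable g (volume.restrict U) := hg2.1.aemeasurable
  have hgmk : ∀ φ : RN N → ℝ, ∫ x in U, hgm.mk g x * φ x = ∫ x in U, g x * φ x := fun φ => by
    refine integral_congr_ae ?_
    filter_upwards [hgm.ae_eq_mk] with x hx
    rw [hx]
  refine ⟨hgm.mk g, hgm.measurable_mk, ?_, ?_⟩
  · refine lintegral_rpow_le_of_weak_limit F (f := f) hq hM hgm.measurable_mk ?_ ?_
    · filter_upwards [hev] with t ht
      exact ⟨hfq t ht, hfl t ht⟩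
    · intro φ hφ
      rw [hgmk]
      exact hglim φ hφ
  · intro φ hφ hφc hφU
    have h1 := (tendsto_integral_diff_div hU hu hφ hφc hφU e).mono_left hFle
    have hφ2 : MemLp φ 2 (volume.restrict U) := hφ.continuous.memLp_of_hasCompactSupport hφc
    have h2 := tendsto_nhds_unique h1 (hglim φ hφ2)
    rw [hgmk, ← h2, neg_neg]

/-! ### Weak gradients: assembly from coordinates, restriction, uniqueness -/

lemma gradient_apply (φ : RN N → ℝ) (x : RN N) (i : Fin N) :
    gradient φ x i = fderiv ℝ φ x (EuclideanSpace.single i 1) := by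
  rw [← inner_gradient_left, EuclideanSpace.inner_single_right]
  simp

lemma norm_gradient (φ : RN N → ℝ) (x : RN N) : ‖gradient φ x‖ = ‖fderiv ℝ φ x‖ := by
  rw [gradient, LinearIsometryEquiv.norm_map]

lemma norm_rpow_le_sum (hN : 0 < N) (v : RN N) {q : ℝ} (hq : 0 ≤ q) :
    ‖v‖ ^ q ≤ (N : ℝ) ^ q * ∑ i, |v i| ^ q := by
  have : Nonempty (Fin N) := ⟨⟨0, hN⟩⟩
  obtain ⟨j, -, hj⟩ := Finset.exists_max_image Finset.univ (fun i => |v i|) Finset.univ_nonempty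
  have hN1 : (1 : ℝ) ≤ N := by exact_mod_cast hN
  have h1 : ‖v‖ ≤ N * |v j| := by
    refine abs_le_of_sq_le_sq' ?_ (by positivity) |>.2
    rw [EuclideanSpace.norm_sq_eq]
    calc ∑ i, ‖v i‖ ^ 2 ≤ ∑ _i : Fin N, |v j| ^ 2 := by
          refine Finset.sum_le_sum fun i _ => ?_
          have := hj i (Finset.mem_univ i)
          rw [Real.norm_eq_abs]
          gcongr
      _ = N * |v j| ^ 2 := by simp
      _ ≤ (N * |v j|) ^ 2 := by
          rw [mul_pow]
          have : (N : ℝ) ≤ N ^ 2 := by nlinarith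
          gcongr
  calc ‖v‖ ^ q ≤ (N * |v j|) ^ q := Real.rpow_le_rpow (norm_nonneg _) h1 hq
    _ = (N : ℝ) ^ q * |v j| ^ q := Real.mul_rpow (by positivity) (abs_nonneg _)
    _ ≤ _ := by
      gcongr
      exact Finset.single_le_sum (f := fun i => |v i| ^ q) (fun i _ => by positivity)
        (Finset.mem_univ j)

lemma integral_eq_of_tsupport_subset {E : Type*} [NormedAddCommGroup E] [NormedSpace ℝ E]
    {V : Set (RN N)} {φ : RN N → ℝ} (hφ : tsupport φ ⊆ V) {F : RN N → E}
    (hF : ∀ x ∉ tsupport φ, F x = 0) : ∫ x in V, F x = ∫ x, F x :=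
  setIntegral_eq_integral_of_forall_compl_eq_zero fun x hx => hF x fun h => hx (hφ h)

lemma gradient_eq_zero_of_notMem_tsupport {φ : RN N → ℝ} {x : RN N} (hx : x ∉ tsupport φ) :
    gradient φ x = 0 := by
  rw [← norm_eq_zero, norm_gradient, norm_eq_zero]
  exact image_eq_zero_of_notMem_tsupport fun h => hx (tsupport_fderiv_subset ℝ h)

/-- The weak gradient restricts to smaller open sets. -/
lemma IsWeakGradient.mono {U Ω : Set (RN N)} (hUΩ : U ⊆ Ω) {u : RN N → ℝ} {G : RN N → RN N}
    (h : IsWeakGradient Ω u G) : IsWeakGradient U u G := by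
  refine ⟨h.1.mono_set hUΩ, h.2.1.mono_set hUΩ, fun φ hφ hφc hφU => ?_⟩
  have h1 := h.2.2 φ hφ hφc (hφU.trans hUΩ)
  have hz1 : ∀ x ∉ tsupport φ, u x • gradient φ x = 0 := fun x hx => by
    rw [gradient_eq_zero_of_notMem_tsupport hx, smul_zero]
  have hz2 : ∀ x ∉ tsupport φ, φ x • G x = 0 := fun x hx => by
    rw [image_eq_zero_of_notMem_tsupport hx, zero_smul]
  rw [integral_eq_of_tsupport_subset (hφU.trans hUΩ) hz1,
    integral_eq_of_tsupport_subset (hφU.trans hUΩ) hz2] at h1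
  rw [integral_eq_of_tsupport_subset hφU hz1, integral_eq_of_tsupport_subset hφU hz2, h1]

lemma integrable_smul_of_hasCompactSupport {U : Set (RN N)} {G : RN N → RN N}
    (hG : LocallyIntegrableOn G U) {φ : RN N → ℝ} (hφ : Continuous φ) (hφc : HasCompactSupport φ)
    (hφU : tsupport φ ⊆ U) : Integrable (fun x => φ x • G x) := by
  obtain ⟨B, hB⟩ := hφc.exists_bound_of_continuous hφ
  have h1 : IntegrableOn G (tsupport φ) := hG.integrableOn_compact_subset hφU hφc.isCompact
  have h2 : IntegrableOn (fun x => φ x • G x) (tsupport φ) :=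
    h1.bdd_smul B hφ.aestronglyMeasurable (ae_of_all _ hB)
  refine (integrableOn_iff_integrable_of_support_subset fun x hx => ?_).1 h2
  by_contra h
  exact hx (by simp [image_eq_zero_of_notMem_tsupport h])

/-- Uniqueness of the weak gradient. -/
lemma IsWeakGradient.ae_eq {U : Set (RN N)} (hU : IsOpen U) {u : RN N → ℝ} {G H : RN N → RN N}
    (hG : IsWeakGradient U u G) (hH : IsWeakGradient U u H) : ∀ᵐ x, x ∈ U → G x = H x := by
  have h := hU.ae_eq_zero_of_integral_contDiff_smul_eq_zero (f := fun x => G x - H x)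
    (μ := volume) (hG.2.1.sub hH.2.1) (fun φ hφ hφc hφU => by
      have h1 := hG.2.2 φ hφ hφc hφU
      have h2 := hH.2.2 φ hφ hφc hφU
      rw [h1, neg_inj] at h2
      rw [integral_eq_of_tsupport_subset hφU (fun x hx => by
          rw [image_eq_zero_of_notMem_tsupport hx, zero_smul]),
        integral_eq_of_tsupport_subset hφU (fun x hx => by
          rw [image_eq_zero_of_notMem_tsupport hx, zero_smul])] at h2
      simp only [smul_sub]
      rw [integral_sub (integrable_smul_of_hasCompactSupport hG.2.1 hφ.continuous hφc hφU)
        (integrable_smul_of_hasCompactSupport hH.2.1 hφ.continuous hφc hφU), h2, sub_self])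
  filter_upwards [h] with x hx hxU
  exact sub_eq_zero.1 (hx hxU)

/-- Functions with bounded difference quotients have a weak gradient. -/
lemma exists_isWeakGradient_of_diff (hN : 0 < N) {U : Set (RN N)} (hU : IsOpen U)
    (hUv : volume U ≠ ∞) {u : RN N → ℝ} (hum : AEMeasurable u) (hu : IntegrableOn u U)
    {q M d : ℝ} (hq : 2 ≤ q) (hM : 0 ≤ M) (hd : 0 < d)
    (hdiff : ∀ h : RN N, 0 < ‖h‖ → ‖h‖ < d → ∫⁻ x in U, ENNReal.ofReal (|diff h u x| ^ q) ≤
      ENNReal.ofReal (M * ‖h‖ ^ q)) :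
    ∃ G : RN N → RN N, Measurable G ∧ IsWeakGradient U u G ∧
      ∫⁻ x in U, ENNReal.ofReal (‖G x‖ ^ q) ≤ ENNReal.ofReal ((N : ℝ) ^ (q + 1) * M) := by
  have hq0 : 0 < q := by linarith
  have : IsFiniteMeasure (volume.restrict U) := ⟨by
    rw [Measure.restrict_apply_univ]; exact hUv.lt_top⟩
  have hex : ∀ i : Fin N, ∃ g : RN N → ℝ, Measurable g ∧
      ∫⁻ x in U, ENNReal.ofReal (|g x| ^ q) ≤ ENNReal.ofReal M ∧
      ∀ φ : RN N → ℝ, ContDiff ℝ ((⊤ : ℕ∞) : WithTop ℕ∞) φ → HasCompactSupport φ →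
        tsupport φ ⊆ U → ∫ x in U, u x * fderiv ℝ φ x (EuclideanSpace.single i 1) =
          -∫ x in U, g x * φ x := by
    intro i
    refine exists_weak_lineDeriv hU hUv hum hu hq hM hd _ fun t ht => ?_
    have hn : ‖t • (EuclideanSpace.single i 1 : RN N)‖ = t := by
      rw [norm_smul, PiLp.norm_single, norm_one, mul_one,
        Real.norm_of_nonneg ht.1.le]
    have := hdiff (t • EuclideanSpace.single i 1) (by rw [hn]; exact ht.1) (by rw [hn]; exact ht.2)
    rwa [hn] at this
  choose g hgm hgq hgw using hex
  set G : RN N → RN N := fun x => WithLp.toLp 2 (fun i => g i x) with hG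
  have hGm : Measurable G :=
    (PiLp.continuous_toLp 2 _).measurable.comp (measurable_pi_lambda _ fun i => hgm i)
  have hGq : ∫⁻ x in U, ENNReal.ofReal (‖G x‖ ^ q) ≤
      ENNReal.ofReal ((N : ℝ) ^ (q + 1) * M) := by
    calc ∫⁻ x in U, ENNReal.ofReal (‖G x‖ ^ q)
        ≤ ∫⁻ x in U, ENNReal.ofReal ((N : ℝ) ^ q) * ∑ i, ENNReal.ofReal (|g i x| ^ q) := by
          refine lintegral_mono fun x => ?_
          rw [← ENNReal.ofReal_sum_of_nonneg (fun i _ => by positivity),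
            ← ENNReal.ofReal_mul (by positivity)]
          exact ENNReal.ofReal_le_ofReal (norm_rpow_le_sum hN (G x) hq0.le)
      _ = ENNReal.ofReal ((N : ℝ) ^ q) * ∑ i, ∫⁻ x in U, ENNReal.ofReal (|g i x| ^ q) := by
          rw [lintegral_const_mul' _ _ ENNReal.ofReal_ne_top, lintegral_finsetSum]
          intro i _
          have := hgm i
          fun_prop
      _ ≤ ENNReal.ofReal ((N : ℝ) ^ q) * ∑ _i : Fin N, ENNReal.ofReal M := by
          gcongr with i
          exact hgq i
      _ = _ := by
          rw [Finset.sum_const, Finset.card_univ, Fintype.card_fin, nsmul_eq_mul,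
            ← ENNReal.ofReal_natCast, ← ENNReal.ofReal_mul (by positivity),
            ← ENNReal.ofReal_mul (by positivity), Real.rpow_add_one (by positivity), mul_assoc]
  have hgLp : ∀ i, MemLp (g i) (ENNReal.ofReal q) (volume.restrict U) := fun i => by
    refine ⟨(hgm i).aestronglyMeasurable, ?_⟩
    have h1 := (hgq i).trans_lt ENNReal.ofReal_lt_top
    rw [lintegral_ofReal_abs_rpow hq0] at h1
    exact (ENNReal.rpow_lt_top_iff_of_pos hq0).1 h1
  have hgi : ∀ i, IntegrableOn (g i) U := fun i =>
    (hgLp i).integrable (by rw [ENNReal.one_le_ofReal]; linarith)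
  have hGi : IntegrableOn G U := by
    have h1 : Integrable (fun x => ∑ i, |g i x|) (volume.restrict U) :=
      integrable_finsetSum _ fun i _ => (hgi i).abs
    refine (h1.const_mul (N : ℝ)).mono' hGm.aestronglyMeasurable (ae_of_all _ fun x => ?_)
    have := norm_rpow_le_sum hN (G x) zero_le_one
    simpa using this
  refine ⟨G, hGm, ⟨hu.locallyIntegrableOn, hGi.locallyIntegrableOn, fun φ hφ hφc hφU => ?_⟩, hGq⟩
  have hφi : Integrable (fun x => φ x • G x) (volume.restrict U) := by
    obtain ⟨B, hB⟩ := hφc.exists_bound_of_continuous hφ.continuous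
    exact Integrable.bdd_smul hGi B hφ.continuous.aestronglyMeasurable (ae_of_all _ hB)
  have hui : Integrable (fun x => u x • gradient φ x) (volume.restrict U) := by
    obtain ⟨B, hB⟩ := (hφc.fderiv ℝ).exists_bound_of_continuous (hφ.continuous_fderiv (by simp))
    have hc : Continuous (gradient φ) :=
      (InnerProductSpace.toDual ℝ (RN N)).symm.continuous.comp (hφ.continuous_fderiv (by simp))
    exact Integrable.smul_bdd hu B hc.aestronglyMeasurable
      (ae_of_all _ fun x => (norm_gradient φ x).trans_le (hB x))
  ext i
  have h1 := (EuclideanSpace.proj (𝕜 := ℝ) i).integral_comp_comm hui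
  have h2 := (EuclideanSpace.proj (𝕜 := ℝ) i).integral_comp_comm hφi
  simp only [PiLp.proj_apply, PiLp.smul_apply, smul_eq_mul, gradient_apply] at h1 h2
  rw [PiLp.neg_apply, ← h1, ← h2, hgw i φ hφ hφc hφU]
  simp only [hG, mul_comm]

/-! ### Localisation, exhaustion and gluing -/

lemma CompactlyInside.volume_ne_top {V Ω : Set (RN N)} (hV : CompactlyInside V Ω) :
    volume V ≠ ∞ :=
  ((measure_mono subset_closure).trans_lt hV.2.1.measure_lt_top).ne

lemma LocallyBounded.integrableOn {Ω V : Set (RN N)} {u : RN N → ℝ} (hu : LocallyBounded Ω u)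
    (hV : CompactlyInside V Ω) : IntegrableOn u V := by
  have : IsFiniteMeasure (volume.restrict V) := ⟨by
    rw [Measure.restrict_apply_univ]; exact hV.volume_ne_top.lt_top⟩
  exact (hu V hV).integrable le_top

/-- Outside the ball 1 + |x| is at most c |x - x₀|, so the tail density is dominated by the one in
the definition of the tail space. -/
lemma tail_lt_top {s p : ℝ} (hs : 0 ≤ s) (hp : 2 ≤ p) {u : RN N → ℝ}
    (hu : MemTailSpace (p - 1) (s * p) u) (x₀ : RN N) {R : ℝ} (hR : 0 < R) :
    tail s p u x₀ R < ∞ := by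
  have hsp : 0 ≤ s * p := mul_nonneg hs (by linarith)
  refine ENNReal.rpow_lt_top_of_nonneg (one_div_nonneg.2 (by linarith))
    (ENNReal.mul_ne_top ENNReal.ofReal_ne_top (ne_of_lt ?_))
  set c : ℝ := (1 + ‖x₀‖) / R + 1 with hc
  have hc0 : 0 < c := by positivity
  refine lt_of_le_of_lt (b := ENNReal.ofReal (c ^ ((N : ℝ) + s * p)) *
    ∫⁻ x, ENNReal.ofReal (|u x| ^ (p - 1) / (1 + ‖x‖) ^ ((N : ℝ) + s * p))) ?_
    (ENNReal.mul_lt_top ENNReal.ofReal_lt_top hu.2)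
  rw [← lintegral_const_mul' _ _ ENNReal.ofReal_ne_top]
  refine le_trans (setLIntegral_mono' Metric.isOpen_ball.measurableSet.compl fun x hx => ?_)
    (setLIntegral_le_lintegral _ _)
  rw [← ENNReal.ofReal_mul (by positivity)]
  apply ENNReal.ofReal_le_ofReal
  have hx' : R ≤ ‖x - x₀‖ := by simpa [dist_eq_norm] using hx
  have hx0 : 0 < ‖x - x₀‖ := hR.trans_le hx'
  have h1 : 1 + ‖x‖ ≤ c * ‖x - x₀‖ := by
    have h2 : ‖x‖ ≤ ‖x - x₀‖ + ‖x₀‖ := norm_le_norm_sub_add x x₀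
    have h3 : 1 + ‖x₀‖ ≤ (1 + ‖x₀‖) / R * ‖x - x₀‖ := by
      rw [div_mul_eq_mul_div, le_div_iff₀ hR]
      gcongr
    rw [hc]; linarith
  have h4 : (1 + ‖x‖) ^ ((N : ℝ) + s * p) ≤
      c ^ ((N : ℝ) + s * p) * ‖x - x₀‖ ^ ((N : ℝ) + s * p) := by
    rw [← Real.mul_rpow hc0.le hx0.le]
    exact Real.rpow_le_rpow (by positivity) h1 (by positivity)
  rw [← mul_div_assoc, div_le_div_iff₀ (by positivity) (by positivity)]
  have h5 : 0 ≤ |u x| ^ (p - 1) := by positivity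
  nlinarith

lemma supTail_add_gagliardo_lt_top {s₁ s p : ℝ} (hs : 0 ≤ s) (hp : 2 ≤ p) {Ω : Set (RN N)}
    {u : RN N → ℝ} (hu : IsWeakSolution s₁ s p Ω u) (hb : LocallyBounded Ω u) {x₀ : RN N} {R : ℝ}
    (hR : 0 < R) (hΩ : Metric.closedBall x₀ R ⊆ Ω) :
    supTail s p u x₀ R + gagliardo s p (Metric.ball x₀ R) u < ∞ := by
  have hV := compactlyInside_ball hΩ
  exact ENNReal.add_lt_top.2 ⟨ENNReal.add_lt_top.2 ⟨(hb _ hV).2, tail_lt_top hs hp hu.2.2.1 x₀ hR⟩,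
    (hu.2.1 _ hV).2⟩

/-- The bound on translations localizes to sets compactly inside the domain. -/
lemma exists_lintegral_diff_le_of_compactlyInside (hN : 0 < N) {s₁ s p q : ℝ}
    (hs₁ : s₁ ∈ Ioo (0 : ℝ) 1) (hs : s ∈ Ioo (0 : ℝ) 1) (hp : 2 ≤ p) (hsp : p - 1 < s * p)
    (hq : p ≤ q) {Ω : Set (RN N)} (hΩ : IsOpen Ω) {u : RN N → ℝ}
    (hu : IsWeakSolution s₁ s p Ω u) (hb : LocallyBounded Ω u) {V : Set (RN N)}
    (hV : CompactlyInside V Ω) :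
    ∃ M d : ℝ, 0 ≤ M ∧ 0 < d ∧ ∀ h : RN N, 0 < ‖h‖ → ‖h‖ < d →
      ∫⁻ x in V, ENNReal.ofReal (|diff h u x| ^ q) ≤ ENNReal.ofReal (M * ‖h‖ ^ q) := by
  obtain ⟨C, κ, hC, hκ, hmain⟩ := exists_lintegral_diff_weakSolution_le hN hs₁ hs hp hsp hq
  have key : ∃ M d : ℝ, 0 ≤ M ∧ 0 < d ∧ ∀ h : RN N, 0 < ‖h‖ → ‖h‖ < d →
      ∫⁻ x in closure V, ENNReal.ofReal (|diff h u x| ^ q) ≤ ENNReal.ofReal (M * ‖h‖ ^ q) := by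
    -- The bound passes to subsets and to finite unions, adding the constants and taking the smaller
    -- step, and holds near each point by the ball estimate. Compactness of the closure concludes.
    refine hV.2.1.induction_on (p := fun S => ∃ M d : ℝ, 0 ≤ M ∧ 0 < d ∧
      ∀ h : RN N, 0 < ‖h‖ → ‖h‖ < d →
      ∫⁻ x in S, ENNReal.ofReal (|diff h u x| ^ q) ≤ ENNReal.ofReal (M * ‖h‖ ^ q)) ?_ ?_ ?_ ?_
    · exact ⟨0, 1, le_rfl, one_pos, fun h _ _ => by simp⟩
    · rintro S T hST ⟨M, d, hM, hd, h⟩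
      exact ⟨M, d, hM, hd, fun y hy hy' => (lintegral_mono_set hST).trans (h y hy hy')⟩
    · rintro S T ⟨M, d, hM, hd, h⟩ ⟨M', d', hM', hd', h'⟩
      refine ⟨M + M', min d d', by positivity, lt_min hd hd', fun y hy hy' => ?_⟩
      refine (lintegral_union_le _ _ _).trans ?_
      rw [add_mul, ENNReal.ofReal_add (by positivity) (by positivity)]
      exact add_le_add (h y hy (hy'.trans_le (min_le_left _ _)))
        (h' y hy (hy'.trans_le (min_le_right _ _)))
    · intro x hx
      obtain ⟨ε, hε, hεΩ⟩ := Metric.isOpen_iff.1 hΩ x (hV.2.2 hx)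
      set R := min (ε / 2) (1 / 2) with hR
      have hR0 : 0 < R := by positivity
      have hR1 : R < 1 := (min_le_right _ _).trans_lt (by norm_num)
      have hball : Metric.closedBall x R ⊆ Ω :=
        (Metric.closedBall_subset_ball ((min_le_left _ _).trans_lt (by linarith))).trans hεΩ
      have hfin := supTail_add_gagliardo_lt_top hs.1.le hp hu hb hR0 hball
      set A := supTail s p u x R + gagliardo s p (Metric.ball x R) u with hA
      refine ⟨Metric.ball x (R / 2), mem_nhdsWithin_of_mem_nhds
        (Metric.ball_mem_nhds x (by positivity)), C * (A.toReal + 1) ^ q / (R - R / 2) ^ κ,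
        (R - R / 2) / 4, ?_, by linarith, ?_⟩
      · have : 0 < R - R / 2 := by linarith
        have : 0 ≤ A.toReal := ENNReal.toReal_nonneg
        positivity
      · refine hmain Ω u hu x R (R / 2) (A.toReal + 1) ⟨hR0, hR1⟩ ⟨by linarith, by linarith⟩ hball
          (by linarith [ENNReal.toReal_nonneg (a := A)]) ?_
        rw [ENNReal.le_ofReal_iff_toReal_le hfin.ne (by positivity)]
        linarith
  obtain ⟨M, d, hM, hd, h⟩ := key
  exact ⟨M, d, hM, hd, fun y hy hy' => (lintegral_mono_set subset_closure).trans (h y hy hy')⟩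

/-- An exhaustion of an open set by sets compactly inside it. -/
lemma exists_exhaustion {Ω : Set (RN N)} (hΩ : IsOpen Ω) :
    ∃ V : ℕ → Set (RN N), (∀ n, CompactlyInside (V n) Ω) ∧
      ∀ K : Set (RN N), IsCompact K → K ⊆ Ω → ∃ n, K ⊆ V n := by
  set δ : ℕ → ℝ := fun n => 1 / ((n : ℝ) + 1) with hδ
  have hδ0 : ∀ n, 0 < δ n := fun n => Nat.one_div_pos_of_nat
  refine ⟨fun n => Metric.ball 0 ((n : ℝ) + 1) ∩ (Metric.cthickening (δ n) Ωᶜ)ᶜ, fun n => ?_,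
    fun K hK hKΩ => ?_⟩
  -- Removing the closed neighbourhood of the complement makes the set open, while its closure still
  -- avoids the open neighbourhood and hence lies in Ω.
  · have h1 : closure (Metric.ball (0 : RN N) ((n : ℝ) + 1) ∩ (Metric.cthickening (δ n) Ωᶜ)ᶜ) ⊆
        Metric.closedBall 0 ((n : ℝ) + 1) ∩ (Metric.thickening (δ n) Ωᶜ)ᶜ :=
      closure_minimal (inter_subset_inter Metric.ball_subset_closedBall
        (compl_subset_compl.2 (Metric.thickening_subset_cthickening _ _)))
        (Metric.isClosed_closedBall.inter Metric.isOpen_thickening.isClosed_compl)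
    refine ⟨Metric.isOpen_ball.inter Metric.isClosed_cthickening.isOpen_compl,
      (isCompact_closedBall _ _).of_isClosed_subset isClosed_closure
        (h1.trans inter_subset_left), (h1.trans inter_subset_right).trans ?_⟩
    rw [compl_subset_comm]
    exact Metric.self_subset_thickening (hδ0 n) _
  · obtain ⟨ε, hε, hdis⟩ := (disjoint_compl_right_iff_subset.2 hKΩ).exists_cthickenings hK
      hΩ.isClosed_compl
    obtain ⟨r, hr⟩ := hK.isBounded.subset_ball 0
    obtain ⟨m, hm⟩ := exists_nat_one_div_lt hε
    obtain ⟨k, hk⟩ := exists_nat_ge r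
    refine ⟨max m k, fun x hx => ⟨?_, fun hx' => ?_⟩⟩
    · refine Metric.ball_subset_ball ?_ (hr hx)
      have : (k : ℝ) ≤ (max m k : ℕ) := by exact_mod_cast le_max_right m k
      linarith
    · refine disjoint_left.1 hdis (Metric.self_subset_cthickening K hx)
        (Metric.cthickening_mono ?_ _ hx')
      refine le_trans ?_ hm.le
      exact Nat.one_div_le_one_div (le_max_left m k)

/-- Weak gradients on an exhaustion glue to a weak gradient. -/
lemma exists_isWeakGradient_of_exhaustion {Ω : Set (RN N)} {u : RN N → ℝ} {V : ℕ → Set (RN N)}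
    (hV : ∀ n, CompactlyInside (V n) Ω)
    (hexh : ∀ K : Set (RN N), IsCompact K → K ⊆ Ω → ∃ n, K ⊆ V n) {G : ℕ → RN N → RN N}
    (hG : ∀ n, IsWeakGradient (V n) u (G n)) :
    ∃ H : RN N → RN N, IsWeakGradient Ω u H ∧ ∀ n, ∀ᵐ x, x ∈ V n → H x = G n x := by
  classical
  -- The selected index is immaterial: on overlaps the local gradients agree almost everywhere by
  -- uniqueness, and there are countably many overlaps.
  set H : RN N → RN N := fun x => if h : ∃ n, x ∈ V n then G (Nat.find h) x else 0 with hH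
  have hae : ∀ n, ∀ᵐ x, x ∈ V n → H x = G n x := by
    intro n
    have h1 : ∀ᵐ x, ∀ m, x ∈ V m ∩ V n → G m x = G n x := by
      refine ae_all_iff.2 fun m => ?_
      exact ((hG m).mono inter_subset_left).ae_eq ((hV m).1.inter (hV n).1)
        ((hG n).mono inter_subset_right)
    filter_upwards [h1] with x hx hxn
    have hex : ∃ n, x ∈ V n := ⟨n, hxn⟩
    simp only [hH, dif_pos hex]
    exact hx _ ⟨Nat.find_spec hex, hxn⟩
  have hloc : ∀ x ∈ Ω, ∃ n, V n ∈ nhds x := by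
    intro x hx
    obtain ⟨n, hn⟩ := hexh {x} isCompact_singleton (singleton_subset_iff.2 hx)
    exact ⟨n, (hV n).1.mem_nhds (singleton_subset_iff.1 hn)⟩
  refine ⟨H, ⟨fun x hx => ?_, fun x hx => ?_, fun φ hφ hφc hφΩ => ?_⟩, hae⟩
  · obtain ⟨n, hn⟩ := hloc x hx
    have h1 := (hG n).1 x (mem_of_mem_nhds hn)
    rw [nhdsWithin_eq_nhds.2 hn] at h1
    exact h1.filter_mono nhdsWithin_le_nhds
  · obtain ⟨n, hn⟩ := hloc x hx
    have h1 : LocallyIntegrableOn H (V n) := by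
      intro y hy
      have h2 := (hG n).2.1 y hy
      rw [nhdsWithin_eq_nhds.2 ((hV n).1.mem_nhds hy)] at h2 ⊢
      obtain ⟨S, hS, hSi⟩ := h2
      refine ⟨S ∩ V n, Filter.inter_mem hS ((hV n).1.mem_nhds hy), ?_⟩
      have h3 : IntegrableOn (G n) (S ∩ V n) := hSi.mono_set inter_subset_left
      refine h3.congr ?_
      have h4 : ∀ᵐ x ∂(volume.restrict (V n)), H x = G n x :=
        (ae_restrict_iff' (hV n).1.measurableSet).2 (hae n)
      filter_upwards [ae_restrict_of_ae_restrict_of_subset (inter_subset_right (s := S)) h4]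
        with z hz
      exact hz.symm
    have h5 := h1 x (mem_of_mem_nhds hn)
    rw [nhdsWithin_eq_nhds.2 hn] at h5
    exact h5.filter_mono nhdsWithin_le_nhds
  · obtain ⟨n, hn⟩ := hexh _ hφc.isCompact hφΩ
    have h1 := (hG n).2.2 φ hφ hφc hn
    have hz1 : ∀ x ∉ tsupport φ, u x • gradient φ x = 0 := fun x hx => by
      rw [gradient_eq_zero_of_notMem_tsupport hx, smul_zero]
    have hz2 : ∀ K : RN N → RN N, ∀ x ∉ tsupport φ, φ x • K x = 0 := fun K x hx => by
      rw [image_eq_zero_of_notMem_tsupport hx, zero_smul]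
    rw [integral_eq_of_tsupport_subset hn hz1, integral_eq_of_tsupport_subset hn (hz2 _)] at h1
    rw [integral_eq_of_tsupport_subset hφΩ hz1, integral_eq_of_tsupport_subset hφΩ (hz2 _), h1]
    congr 1
    refine integral_congr_ae ?_
    filter_upwards [hae n] with x hx
    by_cases hxV : x ∈ V n
    · rw [hx hxV]
    · have : φ x = 0 := image_eq_zero_of_notMem_tsupport fun h => hxV (hn h)
      simp [this]

lemma memLp_of_lintegral_lt_top {q : ℝ} (hq : 0 < q) {U : Set (RN N)} {G : RN N → RN N}
    (hG : Measurable G) (h : ∫⁻ x in U, ENNReal.ofReal (‖G x‖ ^ q) < ∞) :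
    MemLp G (ENNReal.ofReal q) (volume.restrict U) := by
  rw [← memLp_norm_iff hG.aestronglyMeasurable]
  refine ⟨hG.norm.aestronglyMeasurable, ?_⟩
  have h1 := lintegral_ofReal_abs_rpow (m := q) hq (fun x => ‖G x‖) (ν := volume.restrict U)
  simp only [abs_norm] at h1
  rw [h1] at h
  exact (ENNReal.rpow_lt_top_iff_of_pos hq).1 h

/-- Weak solutions have a locally `q`-integrable weak gradient. -/
lemma memW1Loc_of_isWeakSolution (hN : 0 < N) {s₁ s p q : ℝ}
    (hs₁ : s₁ ∈ Ioo (0 : ℝ) 1) (hs : s ∈ Ioo (0 : ℝ) 1) (hp : 2 ≤ p) (hsp : p - 1 < s * p)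
    (hq : p ≤ q) {Ω : Set (RN N)} (hΩ : IsOpen Ω) {u : RN N → ℝ}
    (hu : IsWeakSolution s₁ s p Ω u) (hb : LocallyBounded Ω u) : MemW1Loc q Ω u := by
  have hq0 : 0 < q := by linarith
  have hum : AEMeasurable u := aemeasurable_of_memTailSpace hu.2.2.1
  obtain ⟨V, hV, hexh⟩ := exists_exhaustion hΩ
  have hex : ∀ n, ∃ G : RN N → RN N, IsWeakGradient (V n) u G ∧
      MemLp G (ENNReal.ofReal q) (volume.restrict (V n)) := by
    intro n
    obtain ⟨M, d, hM, hd, h⟩ :=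
      exists_lintegral_diff_le_of_compactlyInside hN hs₁ hs hp hsp hq hΩ hu hb (hV n)
    obtain ⟨G, hGm, hG, hGq⟩ := exists_isWeakGradient_of_diff hN (hV n).1 (hV n).volume_ne_top hum
      (hb.integrableOn (hV n)) (hp.trans hq) hM hd h
    exact ⟨G, hG, memLp_of_lintegral_lt_top hq0 hGm (hGq.trans_lt ENNReal.ofReal_lt_top)⟩
  choose G hG hGq using hex
  obtain ⟨H, hH, hHG⟩ := exists_isWeakGradient_of_exhaustion hV hexh hG
  refine ⟨H, hH, fun W hW => ⟨?_, ?_⟩⟩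
  · have : IsFiniteMeasure (volume.restrict W) := ⟨by
      rw [Measure.restrict_apply_univ]; exact hW.volume_ne_top.lt_top⟩
    exact (hb W hW).mono_exponent le_top
  · obtain ⟨n, hn⟩ := hexh _ hW.2.1 hW.2.2
    have h1 : H =ᵐ[volume.restrict (V n)] G n :=
      (ae_restrict_iff' (hV n).1.measurableSet).2 (hHG n)
    exact ((memLp_congr_ae h1).2 (hGq n)).mono_measure
      (Measure.restrict_mono (subset_closure.trans hn) le_rfl)

end NonlocalOneP

theorem theorem1p3 (N : ℕ) (hN : 2 ≤ N) (p s₁ sp : ℝ) (hp : 2 ≤ p)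
    (hs₁ : s₁ ∈ Set.Ioo (0 : ℝ) 1) (hsp : sp ∈ Set.Ioo ((p - 1) / p) 1)
    (q : ℝ) (hq : p ≤ q) :
    ∃ C κ : ℝ, 0 < C ∧ 0 < κ ∧
      ∀ (Ω : Set (NonlocalOneP.RN N)), IsOpen Ω → IsConnected Ω → Bornology.IsBounded Ω →
      ∀ u : NonlocalOneP.RN N → ℝ,
        NonlocalOneP.IsWeakSolution s₁ sp p Ω u → NonlocalOneP.LocallyBounded Ω u →
        NonlocalOneP.MemW1Loc q Ω u ∧
        ∀ G : NonlocalOneP.RN N → NonlocalOneP.RN N, NonlocalOneP.IsWeakGradient Ω u G →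
        ∀ (x₀ : NonlocalOneP.RN N) (R r : ℝ), R ∈ Set.Ioo (0 : ℝ) 1 → r ∈ Set.Ioo 0 R →
          Metric.closedBall x₀ R ⊆ Ω →
          eLpNorm G (ENNReal.ofReal q) (volume.restrict (Metric.ball x₀ r)) ^ q ≤
            ENNReal.ofReal C *
              (NonlocalOneP.supTail sp p u x₀ R +
                NonlocalOneP.gagliardo sp p (Metric.ball x₀ R) u + 1) ^ q /
              ENNReal.ofReal ((R - r) ^ κ) := by
  have hN0 : 0 < N := by omega
  have hp0 : 0 < p := by linarith
  have hq0 : 0 < q := by linarith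
  have hspp : p - 1 < sp * p := (div_lt_iff₀ hp0).1 hsp.1
  have hs : sp ∈ Set.Ioo (0 : ℝ) 1 :=
    ⟨(div_nonneg (by linarith) hp0.le).trans_lt hsp.1, hsp.2⟩
  obtain ⟨C, κ, hC, hκ, hmain⟩ :=
    NonlocalOneP.exists_lintegral_diff_weakSolution_le hN0 hs₁ hs hp hspp hq
  refine ⟨(N : ℝ) ^ (q + 1) * C, κ, by positivity, hκ, ?_⟩
  intro Ω hΩ _ _ u hu hb
  refine ⟨NonlocalOneP.memW1Loc_of_isWeakSolution hN0 hs₁ hs hp hspp hq hΩ hu hb, ?_⟩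
  intro G hG x₀ R r hR hr hball
  have hfin := NonlocalOneP.supTail_add_gagliardo_lt_top hs.1.le hp hu hb hR.1 hball
  set A := NonlocalOneP.supTail sp p u x₀ R +
    NonlocalOneP.gagliardo sp p (Metric.ball x₀ R) u with hA
  -- The translation estimate needs a real size K ≥ 1. Since A is finite, K = A + 1 is available,
  -- which is the origin of the summand 1 in the final bound.
  have hK : ENNReal.ofReal (A.toReal + 1) = A + 1 := by
    rw [ENNReal.ofReal_add ENNReal.toReal_nonneg zero_le_one, ENNReal.ofReal_toReal hfin.ne,
      ENNReal.ofReal_one]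
  have hK0 : 0 < A.toReal + 1 := add_pos_of_nonneg_of_pos ENNReal.toReal_nonneg one_pos
  have hRr : 0 < R - r := sub_pos.2 hr.2
  have hsub : Metric.ball x₀ r ⊆ Ω :=
    (Metric.ball_subset_closedBall.trans (Metric.closedBall_subset_closedBall hr.2.le)).trans hball
  have hVr : NonlocalOneP.CompactlyInside (Metric.ball x₀ r) Ω :=
    NonlocalOneP.compactlyInside_ball ((Metric.closedBall_subset_closedBall hr.2.le).trans hball)
  -- The quantitative bound is proved for a gradient H built on B_r from the difference quotients.
  -- By uniqueness it coincides there with the given G.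
  obtain ⟨H, hHm, hH, hHq⟩ := NonlocalOneP.exists_isWeakGradient_of_diff hN0 Metric.isOpen_ball
    hVr.volume_ne_top (NonlocalOneP.aemeasurable_of_memTailSpace hu.2.2.1) (hb.integrableOn hVr)
    (hp.trans hq) (M := C * (A.toReal + 1) ^ q / (R - r) ^ κ) (by positivity)
    (show 0 < (R - r) / 4 by linarith)
    (hmain Ω u hu x₀ R r (A.toReal + 1) hR hr hball
      (le_add_of_nonneg_left ENNReal.toReal_nonneg) (hK ▸ le_self_add))
  have hGH : G =ᵐ[volume.restrict (Metric.ball x₀ r)] H :=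
    (ae_restrict_iff' Metric.isOpen_ball.measurableSet).2
      ((hG.mono hsub).ae_eq Metric.isOpen_ball hH)
  have hnorm := NonlocalOneP.lintegral_ofReal_abs_rpow (m := q) hq0 (fun x => ‖H x‖)
    (ν := volume.restrict (Metric.ball x₀ r))
  simp only [abs_norm] at hnorm
  rw [eLpNorm_congr_ae hGH, ← eLpNorm_norm, ← hnorm, ← hK,
    ENNReal.ofReal_rpow_of_pos hK0, ← ENNReal.ofReal_mul (by positivity),
    ← ENNReal.ofReal_div_of_pos (by positivity)]
  refine hHq.trans (ENNReal.ofReal_le_ofReal (le_of_eq ?_))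
  ring
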